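/- **Conventions.** All Lévy processes are real, càdlàg, start at $0$; the characteristic exponent $\psi$ of $X$ is defined by $E[e^{i\xi X_t}]=e^{-t\psi(\xi)}$, $\xi\in\mathbb R$. With the Lévy–Khintchine triplet $(\sigma^2,b,F)$, $$\psi(\xi)=\tfrac{\sigma^2}{2}\xi^2-ib\xi+\int_{\mathbb R\setminus 0}\bigl(1-e^{ix\xi}+\mathbf 1_{(-1,1)}(x)\,ix\xi\bigr)F(dx).$$ For $\mu\ge0$, $\mathrm{SM}_\mu$ is the set of non-negative measures $G$ on $(0,\infty)$ with $\operatorname{supp}G\subset[\mu,\infty)$ and $\int(1+t)^{-1}G(dt)<\infty$. $\mathrm{SLM}_\mu$ is the set of non-negative measures $G$ on $(0,\infty)$, supported in $[\mu,\infty)$, such that $(a_2t^2+a_1t)^{-1}G(dt)\in \mathrm{SM}_\mu$ for some $a_1,a_2\ge0$ with $a_1+a_2>0$. An *sSL-measure of class* $\mathrm{sSLM}_\mu$ is a difference $G=G_1-G_2$ with $G_1,G_2\in\mathrm{SLM}_\mu$, whose Laplace transform $\int e^{-tx}G(dt)$ is non-negative for all $x>0$. For $\mu_-\le0\le\mu_+$,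 a Lévy process is of class $sSL_{\mu_-,\mu_+}$ if its Lévy measure is $f(x)dx$ with $$f(x)=\mathbf 1_{x<0}\int e^{tx}G_-(dt)+\mathbf 1_{x>0}\int e^{-tx}G_+(dt),\qquad G_-\in\mathrm{sSLM}_{\mu_+},\quad G_+\in\mathrm{sSLM}_{-\mu_-}.$$ A Lévy process without Gaussian component (a drift is allowed) is of class $sSL^+_\mu$ with sSL-measure $G\in \mathrm{sSLM}_\mu$ if its Lévy measure is $\mathbf 1_{x>0}\bigl(\int e^{-tx}G(dt)\bigr)dx$. A subordinator is a Lévy process $Z$ with values in $[0,\infty)$; its Laplace exponent $\Psi$ is defined by $E[e^{-qZ_t}]=e^{-t\Psi(q)}$, $q\ge0$. **Theorem.** Let $\mu_-\le0\le\mu_+$, $\mu_-<\mu_+$, $D=\mathbb C\setminus i\bigl((-\infty,\mu_-]\cup[\mu_+,\infty)\bigr)$ and $\beta=-(\mu_-+\mu_+)/2$. Let $X$ be a Lévy process of class $sSL_{\mu_-,\mu_+}$ with characteristic exponent $\psi$, satisfying the following conditions. 1. (Verification conditions) $\psi$ is analytic in $D$; there are $\nu<2$, $\delta>0$, $C>0$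 such that the exponent $\psi_J(\xi)=\psi(\xi)-\frac{\sigma^2}{2}\xi^2+ic\xi$ of the jump component (where $c\in\mathbb R$ is the drift, which depends on the truncation convention in the Lévy–Khintchine formula; any real $c$ is allowed) satisfies $|\psi_J(\xi)|\le C\bigl(|\xi|^\nu+|\xi-i\mu_-|^{-1+\delta}+|\xi-i\mu_+|^{-1+\delta}\bigr)$ for all $\xi\in D$; and for a.e. $t\in(-\infty,\mu_-)\cup(\mu_+,\infty)$ the limit $\operatorname{Im}\psi(it+0)=\lim_{\epsilon\downarrow0}\operatorname{Im}\psi(it+\epsilon)$ exists. 2. (Symmetry) $\psi(\xi-i\beta)=\psi(-\xi-i\beta)$ for all $\xi$ with $\xi-i\beta\in D$. 3. The signed measure $G(dq)=\pi^{-1}\operatorname{Im}\psi\bigl(i(\sqrt q-\beta)+0\bigr)dq$ on $(0,\infty)$ has a non-negative Laplace transform on $(0,\infty)$. Put $\mu=(\mu_+-\mu_-)^2/4$ and $\Psi_Z(q)=\psi(\sqrt q-i\beta)-\psi(-i\beta)$, $q\ge0$. Then: (a) $G$ is an sSL-measure of class $\mathrm{sSLM}_\mu$; (b) $\Psi_Z$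 is the Laplace exponent of a subordinator $Z$; (c) any such $Z$ is of class $sSL^+_\mu$, and $G$ is its sSL-measure; (d) if $Z$ is such a subordinator, $W$ is a standard Brownian motion independent of $Z$, and $Y=\sqrt2\,W$, then, under the Esscher transform $\mathbb Q_\beta$, $X$ has the law of the process $(Y_{Z_t})_{t\ge0}$; that is, for every $T\ge0$, under the measure with density $e^{\beta X_T}/E[e^{\beta X_T}]$, the process $(X_t)_{0\le t\le T}$ has the same law as $(Y_{Z_t})_{0\le t\le T}$. -/

import Mathlib

open MeasureTheory ProbabilityTheory Filter Topology Set
open scoped NNReal ENNReal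

noncomputable section

namespace StieltjesLevy

/-! ### Lévy processes and subordinators -/

/-- A real Lévy process under the probability measure `P`: it starts at `0`, has independent and
stationary increments, and its trajectories are a.s. right-continuous with left limits. -/
structure IsLevyProcess {Ω : Type*} [MeasurableSpace Ω] (X : ℝ≥0 → Ω → ℝ) (P : Measure Ω) :
    Prop where
  measurable : ∀ t, Measurable (X t)
  start_zero : ∀ᵐ ω ∂P, X 0 ω = 0
  indep_increments : HasIndepIncrements X P
  stationary : ∀ s t : ℝ≥0, IdentDistrib (fun ω => X (s + t) ω - X s ω) (X t) P P
  cadlag : ∀ᵐ ω ∂P, ∀ t : ℝ≥0, ContinuousWithinAt (fun s => X s ω) (Ici t) t ∧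
    ∃ l : ℝ, Tendsto (fun s => X s ω) (𝓝[<] t) (𝓝 l)

/-- A subordinator: a Lévy process with values in `[0, ∞)`. -/
def IsSubordinator {Ω : Type*} [MeasurableSpace Ω] (Z : ℝ≥0 → Ω → ℝ≥0) (P : Measure Ω) : Prop :=
  IsLevyProcess (fun t ω => (Z t ω : ℝ)) P

/-- `E[exp(iξ X_t)] = exp(-t ψ(ξ))` for all real `ξ` and all `t ≥ 0`. -/
def HasCharExponent {Ω : Type*} [MeasurableSpace Ω] (X : ℝ≥0 → Ω → ℝ) (P : Measure Ω)
    (ψ : ℂ → ℂ) : Prop :=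
  ∀ (t : ℝ≥0) (ξ : ℝ),
    ∫ ω, Complex.exp (Complex.I * ξ * (X t ω : ℂ)) ∂P = Complex.exp (-((t : ℝ) * ψ ξ))

/-- `E[exp(-q Z_t)] = exp(-t Ψ(q))` for all real `q ≥ 0` and all `t ≥ 0`. -/
def HasLaplaceExponent {Ω : Type*} [MeasurableSpace Ω] (Z : ℝ≥0 → Ω → ℝ≥0) (P : Measure Ω)
    (Ψ : ℝ → ℂ) : Prop :=
  ∀ (t : ℝ≥0) (q : ℝ), 0 ≤ q →
    ((∫ ω, Real.exp (-(q * (Z t ω : ℝ))) ∂P : ℝ) : ℂ) = Complex.exp (-((t : ℝ) * Ψ q))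

/-- The Lévy–Khintchine formula, with the truncation function `1_{(-1,1)}`; `v` is the variance
coefficient `σ²`, `b` the drift, `F` the Lévy measure. -/
def levyKhintchine (v b : ℝ) (F : Measure ℝ) (ξ : ℂ) : ℂ :=
  v / 2 * ξ ^ 2 - Complex.I * b * ξ +
    ∫ x : ℝ, (1 - Complex.exp (Complex.I * x * ξ) +
      (Ioo (-1 : ℝ) 1).indicator (fun _ => (1 : ℂ)) x * (Complex.I * x * ξ)) ∂F

/-- `X` is a Lévy process with generating triplet `(v, b, F)`, where `v = σ²`. -/
structure HasLevyTriplet {Ω : Type*} [MeasurableSpace Ω] (X : ℝ≥0 → Ω → ℝ) (P : Measure Ω)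
    (v b : ℝ) (F : Measure ℝ) : Prop where
  isLevy : IsLevyProcess X P
  nonneg : 0 ≤ v
  no_mass_zero : F {0} = 0
  finite : ∫⁻ x, ENNReal.ofReal (min (x ^ 2) 1) ∂F < ∞
  charExponent : HasCharExponent X P (levyKhintchine v b F)

/-! ### Stieltjes measures, SL-measures and signed SL-measures

Measures on `(0, ∞)` are measures on `ℝ` that vanish on `(-∞, 0]`. A signed SL-measure
`G = G₁ - G₂` may have infinite total variation, so it is given by the pair `(G₁, G₂)`. -/

/-- The class `SM_μ`: Stieltjes measures on `(0, ∞)` supported in `[μ, ∞)`. -/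
structure IsStieltjesMeasure (μ : ℝ) (G : Measure ℝ) : Prop where
  null_nonpos : G (Iic 0) = 0
  support : G (Iio μ) = 0
  finite : ∫⁻ t, ENNReal.ofReal (1 + t)⁻¹ ∂G < ∞

/-- The class `SLM_μ`: measures `G` on `(0, ∞)`, supported in `[μ, ∞)`, such that
`(a₂ t² + a₁ t)⁻¹ G(dt)` is in `SM_μ` for some `a₂, a₁ ≥ 0` with `a₂ + a₁ > 0`. -/
structure IsSLMeasure (μ : ℝ) (G : Measure ℝ) : Prop where
  null_nonpos : G (Iic 0) = 0
  support : G (Iio μ) = 0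
  exists_stieltjes : ∃ a₂ a₁ : ℝ, 0 ≤ a₂ ∧ 0 ≤ a₁ ∧ 0 < a₂ + a₁ ∧
    IsStieltjesMeasure μ (G.withDensity (fun t => ENNReal.ofReal (a₂ * t ^ 2 + a₁ * t)⁻¹))

/-- The Laplace transform of `G₁ - G₂` at `x`. -/
def laplaceDiff (G₁ G₂ : Measure ℝ) (x : ℝ) : ℝ :=
  (∫ t, Real.exp (-(t * x)) ∂G₁) - ∫ t, Real.exp (-(t * x)) ∂G₂

/-- The class `sSLM_μ`: `G = G₁ - G₂` with `G₁, G₂` in `SLM_μ`, whose Laplace transform is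
non-negative on `(0, ∞)`. -/
structure IsSSLMeasure (μ : ℝ) (G₁ G₂ : Measure ℝ) : Prop where
  pos_part : IsSLMeasure μ G₁
  neg_part : IsSLMeasure μ G₂
  laplace_nonneg : ∀ x : ℝ, 0 < x → 0 ≤ laplaceDiff G₁ G₂ x

/-! ### sSL-processes -/

/-- The Lévy measure `f(x) dx`, where `f` is the Laplace transform of `G₊ = Gp₁ - Gp₂` at `x` for
`x > 0`, and the Laplace transform of `G₋ = Gm₁ - Gm₂` at `-x` for `x < 0`. -/
def sslLevyMeasure (Gm₁ Gm₂ Gp₁ Gp₂ : Measure ℝ) : Measure ℝ :=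
  (volume.restrict (Iio (0 : ℝ))).withDensity
      (fun x => ENNReal.ofReal (laplaceDiff Gm₁ Gm₂ (-x))) +
    (volume.restrict (Ioi (0 : ℝ))).withDensity
      (fun x => ENNReal.ofReal (laplaceDiff Gp₁ Gp₂ x))

/-- `F` is the Lévy measure of a process of class `sSL_{μ₋,μ₊}`. -/
def IsSSLLevyMeasure (μm μp : ℝ) (F : Measure ℝ) : Prop :=
  ∃ Gm₁ Gm₂ Gp₁ Gp₂ : Measure ℝ, IsSSLMeasure μp Gm₁ Gm₂ ∧ IsSSLMeasure (-μm) Gp₁ Gp₂ ∧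
    F = sslLevyMeasure Gm₁ Gm₂ Gp₁ Gp₂

/-- `Z` is a Lévy process of class `sSL⁺_μ` (no Gaussian component, positive jumps only, a drift
is allowed) with sSL-measure `G = G₁ - G₂`. -/
def IsSSLPlusProcess {Ω : Type*} [MeasurableSpace Ω] (Z : ℝ≥0 → Ω → ℝ) (P : Measure Ω)
    (μ : ℝ) (G₁ G₂ : Measure ℝ) : Prop :=
  IsSSLMeasure μ G₁ G₂ ∧ ∃ b : ℝ, HasLevyTriplet Z P 0 b (sslLevyMeasure 0 0 G₁ G₂)

/-! ### The verification conditions -/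

/-- `ℂ \ i((-∞, μ₋] ∪ [μ₊, ∞))`. -/
def slitDomain (μm μp : ℝ) : Set ℂ :=
  {ξ | ¬ (ξ.re = 0 ∧ (ξ.im ≤ μm ∨ μp ≤ ξ.im))}

/-- The conditions on the (analytically continued) characteristic exponent `ψ` and on the
exponent `ψJ` of the jump component. -/
structure VerificationConditions (ψ ψJ : ℂ → ℂ) (μm μp : ℝ) : Prop where
  analytic : AnalyticOnNhd ℂ ψ (slitDomain μm μp)
  bound : ∃ ν δ C : ℝ, ν < 2 ∧ 0 < δ ∧ 0 < C ∧ ∀ ξ ∈ slitDomain μm μp,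
    ‖ψJ ξ‖ ≤ C * (‖ξ‖ ^ ν + ‖ξ - Complex.I * μm‖ ^ (-1 + δ) + ‖ξ - Complex.I * μp‖ ^ (-1 + δ))
  boundary_limit : ∀ᵐ t : ℝ, t < μm ∨ μp < t →
    ∃ l : ℝ, Tendsto (fun ε : ℝ => (ψ (Complex.I * t + ε)).im) (𝓝[>] 0) (𝓝 l)

/-! ### The measure `G(dq) = π⁻¹ Im ψ(i(√q - β) + 0) dq` -/

/-- `Im ψ(it + 0)`, the boundary value from the right half-plane. -/
def imBoundary (ψ : ℂ → ℂ) (t : ℝ) : ℝ :=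
  limUnder (𝓝[>] (0 : ℝ)) (fun ε : ℝ => (ψ (Complex.I * t + ε)).im)

/-- The density `π⁻¹ Im ψ(i(√q - β) + 0)`. -/
def subDensity (ψ : ℂ → ℂ) (β q : ℝ) : ℝ := Real.pi⁻¹ * imBoundary ψ (√q - β)

/-- The positive part of `π⁻¹ Im ψ(i(√q - β) + 0) dq` on `(0, ∞)`. -/
def subMeasurePos (ψ : ℂ → ℂ) (β : ℝ) : Measure ℝ :=
  (volume.restrict (Ioi (0 : ℝ))).withDensity (fun q => ENNReal.ofReal (subDensity ψ β q))

/-- The negative part of `π⁻¹ Im ψ(i(√q - β) + 0) dq` on `(0, ∞)`. -/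
def subMeasureNeg (ψ : ℂ → ℂ) (β : ℝ) : Measure ℝ :=
  (volume.restrict (Ioi (0 : ℝ))).withDensity (fun q => ENNReal.ofReal (-subDensity ψ β q))

/-- `Ψ_Z(q) = ψ(√q - iβ) - ψ(-iβ)`. -/
def subLaplaceExponent (ψ : ℂ → ℂ) (β q : ℝ) : ℂ :=
  ψ ((√q : ℝ) - Complex.I * β) - ψ (-(Complex.I * β))

/-- The Esscher transform with parameter `β` on the time horizon `[0, T]`: the measure with
density `exp(β X_T) / E[exp(β X_T)]` with respect to `P`. -/
def esscherTransform {Ω : Type*} [MeasurableSpace Ω] (X : ℝ≥0 → Ω → ℝ) (P : Measure Ω)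
    (β : ℝ) (T : ℝ≥0) : Measure Ω :=
  P.tilted (fun ω => β * X T ω)

end StieltjesLevy

end

noncomputable section

namespace StieltjesLevy

/-! ### Analytic tools -/

/-! By Fubini, the Lévy–Khintchine integral of an sSL-process becomes Stieltjes-type transforms of
G₊ at iξ and of G₋ at -iξ, up to a linear term. This gives a formula for ψ on the real line, which
the identity theorem carries to the whole slit domain (`charExponent_eq`). The symmetry hypothesis
allows ψ(ξ - iβ) to be replaced by its even part. This removes the drift, merges the two cuts, and
leaves ψ(ξ - iβ) - ψ(-iβ) = (v/2)ξ² + ∫ (1/s - s/(s² + ξ²)) (H₁ - H₂)(ds), with H₁, H₂ carried by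
[(μ₊ - μ₋)/2, ∞) (`exists_even_representation`).

H₁ - H₂ is identified by Stieltjes inversion. At ξ = is + ε the imaginary part is a Poisson-type
integral, and its integral over [a, b] converges to a multiple of the mass of [a, b], endpoints
counted by half. The verification bound gives dominated convergence on the side of ψ, so H₁ - H₂ has
density (2/π) Im ψ(i(s - β) + 0). Substituting q = s² turns this density into G and yields ψ(ξ - iβ)
- ψ(-iβ) = Ψ(ξ²) with Ψ(z) = (v/2)z + ∫ (1/q - 1/(q + z)) G(dq) (`squareRepresentation`). Both parts
of G integrate q⁻² and vanish below μ > 0, so G is an sSL-measure.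

Since 1/q - 1/(q + z) is the integral of (1 - e^{-zx}) e^{-qx} over x > 0, non-negativity of the
Laplace transform of G makes Ψ a Bernstein function with drift v/2 and that transform as Lévy
density. A Poisson random measure then produces a subordinator (`exists_subordinator`). Conversely,
the Laplace transform of any such subordinator is known on [0, ∞) only. The Pringsheim-type lemma
`landau` extends it to the half-plane Re z < μ, which contains the imaginary axis, and the triplet
can be read off.

Given Z, the variable √2 W(Z_t) is Gaussian, so its exponential moment at w is exp(-tΨ(-w²)). At w =
iξ - β this is a constant times the characteristic function of X_t. Hence the law of X_t is a
multiple of e^{-βy} times the law of √2 W(Z_t), and tilting by e^{βy} undoes the factor. If μ₋ = 0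
or μ₊ = 0, then β lies on the edge of the admissible strip. For this reason the identity is reached
as a limit from θβ with θ < 1, by Fatou and dominated convergence
(`SquareRepresentation.integral_cexp_esscher`). Independence and stationarity of increments lift the
one-time statement to the law of the path
(`IsLevyProcess.integral_cexp_increments_esscherTransform`, `identDistrib_subordinated`). -/

theorem differentiableOn_integral_of_dominated {α : Type*} [MeasurableSpace α] {μ : Measure α}
    {F : ℂ → α → ℂ} {U : Set ℂ} (hmeas : ∀ z ∈ U, AEStronglyMeasurable (F z) μ)
    (hd : ∀ᵐ a ∂μ, DifferentiableOn ℂ (fun z => F z a) U)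
    (hb : ∀ z ∈ U, ∃ r > 0, Metric.ball z r ⊆ U ∧ ∃ bound : α → ℝ, Integrable bound μ ∧
      ∀ᵐ a ∂μ, ∀ w ∈ Metric.ball z r, ‖F w a‖ ≤ bound a) :
    DifferentiableOn ℂ (fun z => ∫ a, F z a ∂μ) U := by
  intro z hz
  obtain ⟨r, hr, hrU, bound, hbi, hbd⟩ := hb z hz
  have hint : ∀ w ∈ Metric.ball z r, Integrable (F w) μ := fun w hw =>
    hbi.mono' (hmeas w (hrU hw)) (hbd.mono fun a ha => ha w hw)
  have hderiv : ∀ᵐ a ∂μ, ∀ w ∈ Metric.ball z r,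
      HasDerivAt (fun z => F z a) (deriv (fun z => F z a) w) w := by
    filter_upwards [hd] with a ha w hw
    exact (ha.differentiableAt
      (mem_of_superset (Metric.isOpen_ball.mem_nhds hw) hrU)).hasDerivAt
  have key := hasDerivAt_integral_of_dominated_loc_of_deriv_le (μ := μ) (F := F) (x₀ := z)
    (F' := fun w a => deriv (fun z => F z a) w) (bound := fun a => bound a / (r / 3))
    (s := Metric.ball z (r / 2)) (Metric.ball_mem_nhds z (half_pos hr)) ?_
    (hint z (Metric.mem_ball_self hr)) ?_ ?_ (hbi.div_const _) ?_
  · exact key.2.differentiableAt.differentiableWithinAt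
  · filter_upwards [Metric.ball_mem_nhds z hr] with w hw using hmeas w (hrU hw)
  -- The derivative is measurable in the parameter as a limit of difference quotients; the shift by
  -- 2 keeps z + u n inside the ball.
  · let u : ℕ → ℂ := fun n => ((r / (n + 2) : ℝ) : ℂ)
    have hu0 : ∀ n, u n ≠ 0 := fun n => by
      simp only [u, ne_eq, Complex.ofReal_eq_zero]; positivity
    have hut : Tendsto u atTop (𝓝[≠] 0) := by
      refine tendsto_nhdsWithin_iff.2 ⟨?_, Eventually.of_forall hu0⟩
      rw [← Complex.ofReal_zero]
      refine (Complex.continuous_ofReal.tendsto 0).comp ?_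
      have h2 := (tendsto_const_div_atTop_nhds_zero_nat r).comp (tendsto_add_atTop_nat 2)
      refine h2.congr fun n => ?_
      simp
    refine aestronglyMeasurable_of_tendsto_ae (u := atTop)
      (f := fun n a => (u n)⁻¹ • (F (z + u n) a - F z a)) (fun n => ?_) ?_
    · refine ((hint _ ?_).1.sub (hint z (Metric.mem_ball_self hr)).1).const_smul (u n)⁻¹
      simp only [u, Metric.mem_ball, dist_self_add_left, Complex.norm_real, Real.norm_eq_abs]
      rw [abs_of_pos (by positivity)]
      exact div_lt_self hr (by linarith [(Nat.cast_nonneg n : (0 : ℝ) ≤ n)])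
    · filter_upwards [hderiv] with a ha
      have := hasDerivAt_iff_tendsto_slope_zero.1 (ha z (Metric.mem_ball_self hr))
      exact this.comp hut
  -- Cauchy's estimate on a circle of radius r/3 bounds the derivative, so dominating the integrand
  -- alone suffices; r/2 + r/3 < r keeps the circle in the ball.
  · filter_upwards [hd, hbd] with a had hab w hw
    have hsub : Metric.closedBall w (r / 3) ⊆ Metric.ball z r := fun y hy => by
      have h1 := Metric.mem_closedBall.1 hy
      have h2 := Metric.mem_ball.1 hw
      exact Metric.mem_ball.2 (by linarith [dist_triangle y w z])
    refine Complex.norm_deriv_le_of_forall_mem_sphere_norm_le (by positivity) ?_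
      fun y hy => hab y (hsub (Metric.sphere_subset_closedBall hy))
    exact ((had.mono hrU).mono hsub).diffContOnCl_ball subset_rfl
  · filter_upwards [hderiv] with a ha w hw
    exact ha w (Metric.ball_subset_ball (by linarith) hw)

theorem eqOn_of_eq_ofReal {f g : ℂ → ℂ} {U : Set ℂ} (hU : IsOpen U) (hc : IsPreconnected U)
    (hf : DifferentiableOn ℂ f U) (hg : DifferentiableOn ℂ g U) {x₀ : ℝ} (hx₀ : (x₀ : ℂ) ∈ U)
    (h : ∀ᶠ x : ℝ in 𝓝 x₀, f x = g x) : EqOn f g U := by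
  refine (hf.analyticOnNhd hU).eqOn_of_preconnected_of_frequently_eq (hg.analyticOnNhd hU) hc hx₀ ?_
  have h2 : ∃ᶠ x : ℝ in 𝓝[≠] x₀, f x = g x := (h.filter_mono nhdsWithin_le_nhds).frequently
  have ht : Tendsto (fun x : ℝ => (x : ℂ)) (𝓝[≠] x₀) (𝓝[≠] (x₀ : ℂ)) := by
    refine tendsto_nhdsWithin_iff.2
      ⟨(Complex.continuous_ofReal.tendsto x₀).mono_left nhdsWithin_le_nhds, ?_⟩
    filter_upwards [self_mem_nhdsWithin] with x hx
    simpa using hx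
  exact ht.frequently h2

theorem isOpen_re_lt (r : ℝ) : IsOpen {z : ℂ | z.re < r} :=
  isOpen_lt Complex.continuous_re continuous_const

theorem isPreconnected_re_lt (r : ℝ) : IsPreconnected {z : ℂ | z.re < r} :=
  (convex_halfSpace_re_lt r).isPreconnected

/-! ### Exponential moments from analytic continuation -/

section Landau

variable {Ω : Type*} [MeasurableSpace Ω] {P : Measure Ω} {Z : Ω → ℝ} {r : ℝ} {F : ℂ → ℂ}

theorem complexMGF_eq_of_subset {P : Measure Ω} (hF : DifferentiableOn ℂ F {z | z.re < r})
    (hset : Iio r ⊆ integrableExpSet Z P)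
    {x₀ : ℝ} (hx₀ : x₀ < r) (h : ∀ᶠ x : ℝ in 𝓝 x₀, complexMGF Z P x = F x) {z : ℂ}
    (hz : z.re < r) : complexMGF Z P z = F z := by
  have hint : Iio r ⊆ interior (integrableExpSet Z P) := interior_maximal hset isOpen_Iio
  refine eqOn_of_eq_ofReal (isOpen_re_lt r) (isPreconnected_re_lt r) ?_ hF (x₀ := x₀)
    (by simpa using hx₀) h hz
  exact differentiableOn_complexMGF.mono fun z hz => hint hz

/-- A Pringsheim-type theorem: if the Laplace transform of a non-negative random variable
continues analytically to a half-plane, then the exponential moments in that half-plane exist. -/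
theorem landau [IsFiniteMeasure P] (hm : Measurable Z) (h0 : ∀ᵐ ω ∂P, 0 ≤ Z ω) (hr : 0 < r)
    (hF : DifferentiableOn ℂ F {z | z.re < r})
    (h : ∀ q : ℝ, 0 ≤ q → ((∫ ω, Real.exp (-(q * Z ω)) ∂P : ℝ) : ℂ) = F (-q)) :
    (∀ a < r, Integrable (fun ω => Real.exp (a * Z ω)) P) ∧
      ∀ z : ℂ, z.re < r → complexMGF Z P z = F z := by
  have hneg : Iio 0 ⊆ integrableExpSet Z P := fun a (ha : a < 0) =>
    (integrable_const (1 : ℝ)).mono' (by fun_prop) (by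
      filter_upwards [h0] with ω hω
      rw [Real.norm_eq_abs, Real.abs_exp, Real.exp_le_one_iff]
      exact mul_nonpos_of_nonpos_of_nonneg ha.le hω)
  have hreal : ∀ x : ℝ, x < 0 → complexMGF Z P x = F x := fun x hx => by
    have := h (-x) (by linarith)
    rw [complexMGF_ofReal, mgf]
    simpa using this
  have hreal' : ∀ᶠ x : ℝ in 𝓝 (-1 : ℝ), complexMGF Z P x = F x := by
    filter_upwards [Iio_mem_nhds (show (-1 : ℝ) < 0 by norm_num)] with x hx using hreal x hx
  have hleft : ∀ z : ℂ, z.re < 0 → complexMGF Z P z = F z := fun z hz =>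
    complexMGF_eq_of_subset (hF.mono fun z (hz : z.re < 0) => hz.trans hr) hneg
      (by norm_num) hreal' hz
  have hm1 : ((-1 : ℂ)).re ∈ interior (integrableExpSet Z P) :=
    interior_maximal hneg isOpen_Iio (by simp)
  -- The expansion is made at -1, an interior point of the region of known integrability, because
  -- moments at 0 are not yet available. The coefficients are non-negative moments.
  have hmom : ∀ n : ℕ, iteratedDeriv n F (-1) =
      ((∫ ω, Z ω ^ n * Real.exp (-Z ω) ∂P : ℝ) : ℂ) := fun n => by
    have hev : F =ᶠ[𝓝 (-1)] complexMGF Z P := by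
      filter_upwards [(isOpen_re_lt 0).mem_nhds (show (-1 : ℂ) ∈ {z : ℂ | z.re < 0} by simp)]
        with z hz using (hleft z hz).symm
    rw [hev.iteratedDeriv_eq, iteratedDeriv_complexMGF hm1, ← integral_complex_ofReal]
    congr 1 with ω
    push_cast
    simp
  have hpos : ∀ a : ℝ, 0 ≤ a → a < r → Integrable (fun ω => Real.exp (a * Z ω)) P := by
    -- The disc about -1 of radius 1 + r lies in the half-plane and contains every a in [0, r), so
    -- the Taylor series of F converges at a.
    intro a ha har
    have hball : DifferentiableOn ℂ F (Metric.ball (-1) (1 + r)) := hF.mono fun z hz => by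
      rw [Metric.mem_ball, dist_eq_norm, sub_neg_eq_add] at hz
      have := (Complex.re_le_norm (z + 1)).trans_lt hz
      simp only [Complex.add_re, Complex.one_re] at this
      show z.re < r
      linarith
    have haball : (a : ℂ) ∈ Metric.ball (-1 : ℂ) (1 + r) := by
      rw [Metric.mem_ball, dist_eq_norm, sub_neg_eq_add]
      rw [show (a : ℂ) + 1 = ((a + 1 : ℝ) : ℂ) by push_cast; ring, Complex.norm_real,
        Real.norm_eq_abs, abs_of_nonneg (by linarith)]
      linarith
    have hs := Complex.hasSum_taylorSeries_on_ball hball haball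
    have hs' : Summable fun n : ℕ =>
        ((n.factorial : ℝ)⁻¹ * ((a + 1) ^ n * ∫ ω, Z ω ^ n * Real.exp (-Z ω) ∂P)) := by
      rw [← Complex.summable_ofReal]
      refine hs.summable.congr fun n => ?_
      rw [hmom]
      push_cast
      simp [smul_eq_mul]
    have hterm : ∀ n : ℕ, Integrable (fun ω => Z ω ^ n * Real.exp (-Z ω)) P := fun n => by
      have := integrable_pow_mul_exp_of_mem_interior_integrableExpSet (X := Z) (μ := P)
        (v := -1) (by simpa using hm1) n
      simpa using this
    refine ⟨by fun_prop, ?_⟩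
    rw [hasFiniteIntegral_iff_ofReal (Eventually.of_forall fun _ => (Real.exp_pos _).le)]
    -- e^{aZ} = e^{(a+1)Z} e^{-Z} is expanded in powers of (a + 1)Z. All terms are non-negative, so
    -- Tonelli turns convergence of the Taylor series into integrability.
    have hser : ∀ᵐ ω ∂P, ENNReal.ofReal (Real.exp (a * Z ω)) = ∑' n : ℕ,
        ENNReal.ofReal ((n.factorial : ℝ)⁻¹ * ((a + 1) ^ n * (Z ω ^ n * Real.exp (-Z ω)))) := by
      filter_upwards [h0] with ω hω
      have hsum := (NormedSpace.expSeries_div_hasSum_exp ((a + 1) * Z ω)).mul_right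
        (Real.exp (-Z ω))
      rw [← Real.exp_eq_exp_ℝ, ← Real.exp_add,
        show (a + 1) * Z ω + -Z ω = a * Z ω by ring] at hsum
      rw [← ENNReal.ofReal_tsum_of_nonneg (fun n => by positivity)]
      · rw [← hsum.tsum_eq]
        congr 2 with n
        rw [mul_pow]; field_simp
      · refine hsum.summable.congr fun n => ?_
        rw [mul_pow]; field_simp
    rw [lintegral_congr_ae hser, lintegral_tsum fun n => by fun_prop]
    have : ∀ n : ℕ, ∫⁻ ω, ENNReal.ofReal
        ((n.factorial : ℝ)⁻¹ * ((a + 1) ^ n * (Z ω ^ n * Real.exp (-Z ω)))) ∂P =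
        ENNReal.ofReal
          ((n.factorial : ℝ)⁻¹ * ((a + 1) ^ n * ∫ ω, Z ω ^ n * Real.exp (-Z ω) ∂P)) := fun n => by
      rw [← integral_const_mul, ← integral_const_mul, ofReal_integral_eq_lintegral_ofReal]
      · exact ((hterm n).const_mul _).const_mul _
      · filter_upwards [h0] with ω hω
        simp only [Pi.zero_apply]
        positivity
    simp_rw [this]
    rw [← ENNReal.ofReal_tsum_of_nonneg _ hs']
    · exact ENNReal.ofReal_lt_top
    · intro n
      have : 0 ≤ ∫ ω, Z ω ^ n * Real.exp (-Z ω) ∂P := integral_nonneg_of_ae (by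
        filter_upwards [h0] with ω hω
        simp only [Pi.zero_apply]
        positivity)
      positivity
  have hall : ∀ a < r, Integrable (fun ω => Real.exp (a * Z ω)) P := fun a ha => by
    rcases lt_or_ge a 0 with h' | h'
    · exact hneg h'
    · exact hpos a h' ha
  exact ⟨hall, fun z hz => complexMGF_eq_of_subset hF hall (by linarith) hreal' hz⟩

end Landau

section

/-! ### Integrability with respect to SL-measures -/

/-- The weight `1 / (t (1 + t)²)`, which is integrable with respect to every SL-measure. -/
def slWeight (t : ℝ) : ℝ := (t * (1 + t) ^ 2)⁻¹

theorem measurable_slWeight : Measurable slWeight := by unfold slWeight; fun_prop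

theorem slWeight_pos {t : ℝ} (ht : 0 < t) : 0 < slWeight t := by unfold slWeight; positivity

/-- The measure w·G is finite and G is recovered by dividing by w. This makes Fubini available for
measures that are specified only through an integrability condition. -/
theorem sFinite_of_integrable_pos {α : Type*} [MeasurableSpace α] {G : Measure α} {w : α → ℝ}
    (hw : Measurable w) (hi : Integrable w G) (hpos : ∀ᵐ t ∂G, 0 < w t) : SFinite G := by
  have hfin : IsFiniteMeasure (G.withDensity fun t => ENNReal.ofReal (w t)) := by
    refine isFiniteMeasure_withDensity (ne_of_lt ?_)
    rw [← hasFiniteIntegral_iff_ofReal (hpos.mono fun t ht => ht.le)]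
    exact hi.2
  have h := withDensity_inv_same (μ := G) (f := fun t => ENNReal.ofReal (w t)) (by fun_prop)
    (hpos.mono fun t ht => by simpa using ht) (Eventually.of_forall fun t => by simp)
  rw [← h]
  infer_instance

variable {μ : ℝ} {G G₁ G₂ : Measure ℝ}

theorem IsSLMeasure.ae_pos (hG : IsSLMeasure μ G) : ∀ᵐ t ∂G, 0 < t := by
  rw [ae_iff]
  convert hG.null_nonpos using 2
  ext t; simp

theorem IsSLMeasure.ae_ge (hG : IsSLMeasure μ G) : ∀ᵐ t ∂G, μ ≤ t := by
  rw [ae_iff]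
  convert hG.support using 2
  ext t; simp

/-- Since a₂t + a₁ ≤ (a₂ + a₁)(1 + t), one weight serves for all admissible pairs (a₂, a₁). -/
theorem IsSLMeasure.integrable_slWeight (hG : IsSLMeasure μ G) : Integrable slWeight G := by
  obtain ⟨a₂, a₁, h2, h1, h21, hS⟩ := hG.exists_stieltjes
  have hfin := hS.finite
  rw [lintegral_withDensity_eq_lintegral_mul _ (by fun_prop) (by fun_prop)] at hfin
  refine ⟨measurable_slWeight.aestronglyMeasurable, ?_⟩
  rw [hasFiniteIntegral_iff_ofReal (hG.ae_pos.mono fun t ht => (slWeight_pos ht).le)]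
  calc ∫⁻ t, ENNReal.ofReal (slWeight t) ∂G
      ≤ ∫⁻ t, ENNReal.ofReal (a₂ + a₁) * ((fun t => ENNReal.ofReal (a₂ * t ^ 2 + a₁ * t)⁻¹) *
          fun t => ENNReal.ofReal (1 + t)⁻¹) t ∂G := by
        refine lintegral_mono_ae (hG.ae_pos.mono fun t ht => ?_)
        have hden : 0 < a₂ * t ^ 2 + a₁ * t := by
          rcases h2.lt_or_eq with h | h
          · positivity
          · have : 0 < a₁ := by linarith
            positivity
        simp only [Pi.mul_apply]
        rw [← ENNReal.ofReal_mul (by positivity), ← ENNReal.ofReal_mul (by positivity)]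
        refine ENNReal.ofReal_le_ofReal ?_
        rw [slWeight, ← mul_inv, ← div_eq_mul_inv, inv_eq_one_div,
          div_le_div_iff₀ (by positivity) (by positivity)]
        have : 0 ≤ a₂ * t + a₁ * t ^ 2 := by positivity
        nlinarith [mul_nonneg h2 (by positivity : 0 ≤ t ^ 2 + t),
          mul_nonneg h1 (by positivity : 0 ≤ t ^ 3 + t ^ 2)]
    _ < ∞ := by
        rw [lintegral_const_mul _ (by fun_prop)]
        exact ENNReal.mul_lt_top ENNReal.ofReal_lt_top hfin

theorem IsSLMeasure.sFinite (hG : IsSLMeasure μ G) : SFinite G :=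
  sFinite_of_integrable_pos measurable_slWeight hG.integrable_slWeight
    (hG.ae_pos.mono fun _ ht => slWeight_pos ht)

/-! ### Laplace transforms and Fubini -/

theorem measurable_laplaceDiff [SFinite G₁] [SFinite G₂] : Measurable (laplaceDiff G₁ G₂) := by
  unfold laplaceDiff
  refine Measurable.sub ?_ ?_ <;>
  exact (StronglyMeasurable.integral_prod_right
    (f := fun x t => Real.exp (-(t * x))) (by fun_prop)).measurable

theorem laplace_fubini [SFinite G] {m : ℝ → ℂ} (hm : Measurable m) {N : ℝ → ℝ}
    (hN : Integrable N G)
    (h : ∀ᵐ t ∂G, IntegrableOn (fun x : ℝ => m x * (Real.exp (-(t * x)) : ℝ)) (Ioi 0) ∧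
      ∫ x in Ioi (0 : ℝ), ‖m x * (Real.exp (-(t * x)) : ℝ)‖ ≤ N t) :
    IntegrableOn (fun x : ℝ => m x * ((∫ t, Real.exp (-(t * x)) ∂G : ℝ) : ℂ)) (Ioi 0) ∧
    Integrable (fun t => ∫ x in Ioi (0 : ℝ), m x * (Real.exp (-(t * x)) : ℝ)) G ∧
    ∫ x in Ioi (0 : ℝ), m x * ((∫ t, Real.exp (-(t * x)) ∂G : ℝ) : ℂ) =
      ∫ t, (∫ x in Ioi (0 : ℝ), m x * (Real.exp (-(t * x)) : ℝ)) ∂G := by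
  have hmeas : StronglyMeasurable
      (fun p : ℝ × ℝ => m p.2 * ((Real.exp (-(p.1 * p.2)) : ℝ) : ℂ)) :=
    Measurable.stronglyMeasurable (by fun_prop)
  have hint : Integrable (fun p : ℝ × ℝ => m p.2 * ((Real.exp (-(p.1 * p.2)) : ℝ) : ℂ))
      (G.prod (volume.restrict (Ioi 0))) := by
    rw [integrable_prod_iff hmeas.aestronglyMeasurable]
    refine ⟨h.mono fun t ht => ht.1, hN.mono' ?_ (h.mono fun t ht => ?_)⟩
    · exact (hmeas.norm.integral_prod_right').aestronglyMeasurable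
    · rw [Real.norm_of_nonneg (integral_nonneg fun _ => norm_nonneg _)]
      exact ht.2
  have hinner : ∀ x : ℝ, m x * ((∫ t, Real.exp (-(t * x)) ∂G : ℝ) : ℂ) =
      ∫ t, m x * ((Real.exp (-(t * x)) : ℝ) : ℂ) ∂G := fun x => by
    rw [integral_const_mul, integral_complex_ofReal]
  simp_rw [hinner]
  exact ⟨hint.integral_prod_right, hint.integral_prod_left, (integral_integral_swap
    (f := fun t x => m x * ((Real.exp (-(t * x)) : ℝ) : ℂ)) hint).symm⟩

theorem integrableOn_cexp_neg_mul {a : ℂ} (ha : 0 < a.re) :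
    IntegrableOn (fun x : ℝ => Complex.exp (-(a * x))) (Ioi 0) := by
  simpa using integrableOn_exp_mul_complex_Ioi (a := -a) (by simpa using ha) 0

theorem integral_cexp_neg_mul {a : ℂ} (ha : 0 < a.re) :
    ∫ x in Ioi (0 : ℝ), Complex.exp (-(a * x)) = 1 / a := by
  have := integral_exp_mul_complex_Ioi (a := -a) (by simpa using ha) 0
  simpa using this

theorem integrableOn_exp_neg_mul {a : ℝ} (ha : 0 < a) :
    IntegrableOn (fun x : ℝ => Real.exp (-(a * x))) (Ioi 0) := by
  simpa using integrableOn_exp_mul_Ioi (a := -a) (by simpa using ha) 0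

theorem integral_exp_neg_mul {a : ℝ} (ha : 0 < a) :
    ∫ x in Ioi (0 : ℝ), Real.exp (-(a * x)) = 1 / a := by
  have := integral_exp_mul_Ioi (a := -a) (by simpa using ha) 0
  simpa using this

/-- Follows from e^{-x} ≤ 1/(1 + x). It replaces min(x, 1) by a function whose Laplace transform is
explicit. -/
theorem min_le_two_mul_one_sub_exp {x : ℝ} (hx : 0 < x) :
    min x 1 ≤ 2 * (1 - Real.exp (-x)) := by
  have h1 : Real.exp (-x) ≤ 1 / (1 + x) := by
    rw [Real.exp_neg, ← one_div]
    exact one_div_le_one_div_of_le (by linarith) (by linarith [Real.add_one_le_exp x])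
  have h2 : min x 1 ≤ 2 * (1 - 1 / (1 + x)) := by
    have : 1 - 1 / (1 + x) = x / (1 + x) := by field_simp; ring
    rw [this, ← mul_div_assoc, le_div_iff₀ (by linarith)]
    rcases le_total x 1 with h | h
    · rw [min_eq_left h]; nlinarith
    · rw [min_eq_right h]; linarith
  linarith

theorem one_sub_exp_sq_mul_exp (t x : ℝ) :
    (1 - Real.exp (-x)) ^ 2 * Real.exp (-(t * x)) =
      Real.exp (-(t * x)) - 2 * Real.exp (-((t + 1) * x)) + Real.exp (-((t + 2) * x)) := by
  rw [show -((t + 1) * x) = -(t * x) + -x by ring, show -((t + 2) * x) = -(t * x) + -x + -x by ring,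
    Real.exp_add, Real.exp_add, Real.exp_add]
  ring

theorem integrableOn_one_sub_exp_sq {t : ℝ} (ht : 0 < t) :
    IntegrableOn (fun x => (1 - Real.exp (-x)) ^ 2 * Real.exp (-(t * x))) (Ioi 0) := by
  simp_rw [one_sub_exp_sq_mul_exp]
  exact ((integrableOn_exp_neg_mul ht).sub ((integrableOn_exp_neg_mul (by linarith)).const_mul 2)).add
    (integrableOn_exp_neg_mul (by linarith))

theorem integral_one_sub_exp_sq {t : ℝ} (ht : 0 < t) :
    ∫ x in Ioi (0 : ℝ), (1 - Real.exp (-x)) ^ 2 * Real.exp (-(t * x)) =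
      2 / (t * (t + 1) * (t + 2)) := by
  have i0 := integrableOn_exp_neg_mul ht
  have i1 := (integrableOn_exp_neg_mul (a := t + 1) (by linarith)).const_mul 2
  have i2 := integrableOn_exp_neg_mul (a := t + 2) (by linarith)
  have i01 : IntegrableOn (fun x => Real.exp (-(t * x)) - 2 * Real.exp (-((t + 1) * x))) (Ioi 0) :=
    i0.sub i1
  simp_rw [one_sub_exp_sq_mul_exp]
  rw [integral_add i01 i2, integral_sub i0 i1, integral_const_mul,
    integral_exp_neg_mul ht, integral_exp_neg_mul (by linarith), integral_exp_neg_mul (by linarith)]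
  field_simp
  ring

/-- The bound min(x², 1) ≤ 4(1 - e^{-x})² dominates the multiplier, and the Laplace transform
2/(t(t+1)(t+2)) of (1 - e^{-x})² is at most 2 `slWeight t`. Hence second-order vanishing at 0 is
exactly what an SL-measure can absorb. -/
theorem laplace_fubini_of_le_min_sq (hG : IsSLMeasure μ G) {m : ℝ → ℂ} (hm : Measurable m) {C : ℝ}
    (hb : ∀ x, 0 < x → ‖m x‖ ≤ C * min (x ^ 2) 1) :
    IntegrableOn (fun x : ℝ => m x * ((∫ t, Real.exp (-(t * x)) ∂G : ℝ) : ℂ)) (Ioi 0) ∧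
    Integrable (fun t => ∫ x in Ioi (0 : ℝ), m x * (Real.exp (-(t * x)) : ℝ)) G ∧
    ∫ x in Ioi (0 : ℝ), m x * ((∫ t, Real.exp (-(t * x)) ∂G : ℝ) : ℂ) =
      ∫ t, (∫ x in Ioi (0 : ℝ), m x * (Real.exp (-(t * x)) : ℝ)) ∂G := by
  have := hG.sFinite
  have hC : 0 ≤ C := by
    have := (norm_nonneg _).trans (hb 1 one_pos)
    simpa using this
  refine laplace_fubini hm (N := fun t => C * 4 * (2 * slWeight t))
    ((hG.integrable_slWeight.const_mul 2).const_mul _) (hG.ae_pos.mono fun t ht => ?_)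
  have hle : ∀ x ∈ Ioi (0 : ℝ), ‖m x * ((Real.exp (-(t * x)) : ℝ) : ℂ)‖ ≤
      C * 4 * ((1 - Real.exp (-x)) ^ 2 * Real.exp (-(t * x))) := fun x (hx : 0 < x) => by
    rw [norm_mul, Complex.norm_real, Real.norm_eq_abs, Real.abs_exp, ← mul_assoc]
    refine mul_le_mul_of_nonneg_right ((hb x hx).trans ?_) (Real.exp_pos _).le
    rw [mul_assoc]
    refine mul_le_mul_of_nonneg_left ?_ hC
    have h1 := min_le_two_mul_one_sub_exp hx
    have h0 : 0 < min x 1 := lt_min hx one_pos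
    have h2 : min (x ^ 2) 1 = (min x 1) ^ 2 := by
      rcases le_total x 1 with h | h
      · rw [min_eq_left h, min_eq_left (by nlinarith)]
      · rw [min_eq_right h, min_eq_right (by nlinarith), one_pow]
    rw [h2]
    nlinarith
  have hi := (integrableOn_one_sub_exp_sq ht).const_mul (C * 4)
  have hi' : IntegrableOn (fun x : ℝ => m x * (Real.exp (-(t * x)) : ℝ)) (Ioi 0) :=
    hi.mono' (by fun_prop) ((ae_restrict_iff' measurableSet_Ioi).2 (Eventually.of_forall hle))
  refine ⟨hi', (setIntegral_mono_on hi'.norm hi measurableSet_Ioi hle).trans ?_⟩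
  rw [integral_const_mul, integral_one_sub_exp_sq ht]
  refine mul_le_mul_of_nonneg_left ?_ (by positivity)
  rw [slWeight, ← div_eq_mul_inv]
  refine div_le_div_of_nonneg_left (by norm_num) (by positivity) ?_
  nlinarith [mul_pos ht ht]

/-! ### The compensated Stieltjes kernel -/

/-- The Laplace transform in `x` of `1 - exp(x z) + z (exp(-x) - exp(-2x))`. -/
def stieltjesKernel (z : ℂ) (t : ℝ) : ℂ := 1 / t - 1 / (t - z) + z * (1 / (t + 1) - 1 / (t + 2))

/-- The integral of the compensated Stieltjes kernel against `G₁ - G₂`. -/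
def stieltjesTransform (G₁ G₂ : Measure ℝ) (z : ℂ) : ℂ :=
  (∫ t, stieltjesKernel z t ∂G₁) - ∫ t, stieltjesKernel z t ∂G₂

/-- The compensator e^{-x} - e^{-2x} agrees with x to first order at 0 and decays at infinity.
Unlike the indicator truncation it has a rational Laplace transform, so the result is analytic in z
by inspection. -/
theorem integral_compensated_exp {t : ℝ} (ht : 0 < t) {z : ℂ} (hz : z.re ≤ 0) :
    ∫ x in Ioi (0 : ℝ), (1 - Complex.exp (x * z) +
      z * (Complex.exp (-x) - Complex.exp (-(2 * x)))) * ((Real.exp (-(t * x)) : ℝ) : ℂ) =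
      stieltjesKernel z t := by
  have e : ∀ x : ℝ, (1 - Complex.exp (x * z) +
      z * (Complex.exp (-x) - Complex.exp (-(2 * x)))) * ((Real.exp (-(t * x)) : ℝ) : ℂ) =
      Complex.exp (-(t * x)) - Complex.exp (-((t - z) * x)) +
        z * (Complex.exp (-((t + 1) * x)) - Complex.exp (-((t + 2) * x))) := fun x => by
    rw [show -((t - z) * x : ℂ) = -(t * x) + x * z by ring,
      show -((t + 1 : ℂ) * x) = -(t * x) + -x by ring,
      show -((t + 2 : ℂ) * x) = -(t * x) + -(2 * x) by ring, Complex.exp_add, Complex.exp_add,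
      Complex.exp_add]
    push_cast
    ring
  have p0 : 0 < (t : ℂ).re := by simpa using ht
  have p1 : 0 < ((t : ℂ) - z).re := by simp; linarith
  have p2 : 0 < ((t : ℂ) + 1).re := by simp; linarith
  have p3 : 0 < ((t : ℂ) + 2).re := by simp; linarith
  have i01 : IntegrableOn (fun x : ℝ => Complex.exp (-(t * x)) - Complex.exp (-((t - z) * x)))
      (Ioi 0) := (integrableOn_cexp_neg_mul p0).sub (integrableOn_cexp_neg_mul p1)
  have i23 : IntegrableOn (fun x : ℝ => Complex.exp (-((t + 1) * x)) - Complex.exp (-((t + 2) * x)))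
      (Ioi 0) := (integrableOn_cexp_neg_mul p2).sub (integrableOn_cexp_neg_mul p3)
  simp_rw [e]
  rw [integral_add i01 (i23.const_mul _), integral_sub (integrableOn_cexp_neg_mul p0) (integrableOn_cexp_neg_mul p1), integral_const_mul,
    integral_sub (integrableOn_cexp_neg_mul p2) (integrableOn_cexp_neg_mul p3),
    integral_cexp_neg_mul p0, integral_cexp_neg_mul p1, integral_cexp_neg_mul p2,
    integral_cexp_neg_mul p3]
  rfl

/-- Over a common denominator the cancellation shows: the kernel is O(t⁻³) at infinity and carries a
factor z. -/
theorem stieltjesKernel_eq {t : ℝ} (ht : 0 < t) {z : ℂ} (hz : (t : ℂ) - z ≠ 0) :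
    stieltjesKernel z t = -(z * ((z + 3) * t + 2)) / ((t + 1) * (t + 2) * t * (t - z)) := by
  have h0 : (t : ℂ) ≠ 0 := by simpa using ht.ne'
  have h1 : (t : ℂ) + 1 ≠ 0 := by norm_cast; positivity
  have h2 : (t : ℂ) + 2 ≠ 0 := by norm_cast; positivity
  rw [stieltjesKernel]
  field_simp
  ring

/-- The quotient ‖z‖(1 + t)/‖t - z‖ is kept whole because it has two uses: it is locally bounded on
the cut plane, and it stays bounded as z tends to the tip of a cut starting at 0 along suitable real
points. -/
theorem norm_stieltjesKernel_le {t : ℝ} (ht : 0 < t) {z : ℂ} (hz : (t : ℂ) - z ≠ 0) :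
    ‖stieltjesKernel z t‖ ≤ (‖z‖ + 3) * (‖z‖ * (1 + t) / ‖t - z‖) * slWeight t := by
  have hz' : 0 < ‖(t : ℂ) - z‖ := norm_pos_iff.2 hz
  have n1 : ‖(t : ℂ) + 1‖ = t + 1 := by
    rw [show (t : ℂ) + 1 = ((t + 1 : ℝ) : ℂ) by push_cast; rfl, Complex.norm_real,
      Real.norm_of_nonneg (by positivity)]
  have n2 : ‖(t : ℂ) + 2‖ = t + 2 := by
    rw [show (t : ℂ) + 2 = ((t + 2 : ℝ) : ℂ) by push_cast; rfl, Complex.norm_real,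
      Real.norm_of_nonneg (by positivity)]
  have n0 : ‖(t : ℂ)‖ = t := by rw [Complex.norm_real, Real.norm_of_nonneg ht.le]
  have n3 : ‖(z + 3) * t + 2‖ ≤ (‖z‖ + 3) * (1 + t) := by
    refine (norm_add_le _ _).trans ?_
    rw [norm_mul, n0]
    have : ‖z + 3‖ ≤ ‖z‖ + 3 := (norm_add_le _ _).trans (by simp)
    have h2 : ‖(2 : ℂ)‖ = 2 := by simp
    rw [h2]
    nlinarith [norm_nonneg z]
  rw [stieltjesKernel_eq ht hz, norm_div, norm_neg, norm_mul, norm_mul, norm_mul, norm_mul, n1, n2,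
    n0, slWeight]
  rw [show (‖z‖ + 3) * (‖z‖ * (1 + t) / ‖(t : ℂ) - z‖) * (t * (1 + t) ^ 2)⁻¹ =
    ‖z‖ * ((‖z‖ + 3) * (1 + t)) / ((t + 1) * (t + 1) * t * ‖(t : ℂ) - z‖) by field_simp; ring]
  gcongr
  linarith

theorem measurable_stieltjesKernel (z : ℂ) : Measurable (stieltjesKernel z) := by
  unfold stieltjesKernel; fun_prop

end

section

variable {μ : ℝ} {G G₁ G₂ : Measure ℝ}

/-! ### Analyticity of the Stieltjes transform -/

/-- The plane cut along `[μ, ∞)`. -/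
def cutPlane (μ : ℝ) : Set ℂ := {z | ¬ (z.im = 0 ∧ μ ≤ z.re)}

theorem isOpen_cutPlane (μ : ℝ) : IsOpen (cutPlane μ) := by
  have : IsClosed {z : ℂ | z.im = 0 ∧ μ ≤ z.re} :=
    (isClosed_eq Complex.continuous_im continuous_const).inter
      (isClosed_le continuous_const Complex.continuous_re)
  exact this.isOpen_compl

theorem sub_ne_zero_of_mem_cutPlane {z : ℂ} (hz : z ∈ cutPlane μ) {t : ℝ} (ht : μ ≤ t) :
    (t : ℂ) - z ≠ 0 := fun h => hz (by
  rw [← sub_eq_zero.1 h]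
  simpa using ht)

/-- For bounded t the distance to the cut gives the lower bound, for large t the growth t - ‖w‖
does. The constant c is chosen so that the two regimes meet at 1 + t = 1 + r + (‖z‖ + r). -/
theorem exists_ball_norm_sub_ge (hμ : 0 ≤ μ) {z : ℂ} (hz : z ∈ cutPlane μ) :
    ∃ r > 0, ∃ c > 0, Metric.ball z r ⊆ cutPlane μ ∧
      ∀ w ∈ Metric.ball z r, ∀ t : ℝ, μ ≤ t → c * (1 + t) ≤ ‖(t : ℂ) - w‖ := by
  obtain ⟨r', hr', hsub⟩ := Metric.isOpen_iff.1 (isOpen_cutPlane μ) z hz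
  have hr : 0 < r' / 2 := half_pos hr'
  have hR : 0 ≤ ‖z‖ := norm_nonneg z
  obtain ⟨r, hrr⟩ : ∃ r, r = r' / 2 := ⟨_, rfl⟩
  rw [← hrr] at hr
  refine ⟨r, hr, r / (1 + r + (‖z‖ + r)), by positivity,
    (Metric.ball_subset_ball (by linarith)).trans hsub, fun w hw t ht => ?_⟩
  have h1 : r ≤ ‖(t : ℂ) - w‖ := by
    by_contra! hlt
    have : (t : ℂ) ∈ Metric.ball z r' := by
      rw [Metric.mem_ball] at hw ⊢
      have := dist_triangle (t : ℂ) w z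
      rw [dist_eq_norm (t : ℂ) w] at this
      linarith
    exact hsub this (by simpa using ht)
  have h2 : t - (‖z‖ + r) ≤ ‖(t : ℂ) - w‖ := by
    have h3 : ‖w‖ ≤ ‖z‖ + r := by
      rw [Metric.mem_ball, dist_eq_norm] at hw
      linarith [norm_sub_norm_le w z]
    have h4 := norm_sub_norm_le (t : ℂ) w
    rw [Complex.norm_real, Real.norm_of_nonneg (hμ.trans ht)] at h4
    linarith
  rw [div_mul_eq_mul_div, div_le_iff₀ (by positivity)]
  rcases le_total (1 + t) (1 + r + (‖z‖ + r)) with h | h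
  · exact mul_le_mul h1 h (by linarith) (norm_nonneg _)
  · have h5 : r * (1 + t) ≤ (t - (‖z‖ + r)) * (1 + r + (‖z‖ + r)) := by nlinarith
    exact h5.trans (mul_le_mul_of_nonneg_right h2 (by positivity))

theorem exists_ball_stieltjesKernel_le (hμ : 0 ≤ μ) {z : ℂ} (hz : z ∈ cutPlane μ) :
    ∃ r > 0, Metric.ball z r ⊆ cutPlane μ ∧ ∃ C : ℝ,
      ∀ w ∈ Metric.ball z r, ∀ t : ℝ, 0 < t → μ ≤ t → ‖stieltjesKernel w t‖ ≤ C * slWeight t := by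
  obtain ⟨r, hr, c, hc, hsub, hle⟩ := exists_ball_norm_sub_ge hμ hz
  refine ⟨r, hr, hsub, (‖z‖ + r + 3) * ((‖z‖ + r) / c), fun w hw t h0 ht => ?_⟩
  have hw' : ‖w‖ ≤ ‖z‖ + r := by
    rw [Metric.mem_ball, dist_eq_norm] at hw
    linarith [norm_sub_norm_le w z]
  refine (norm_stieltjesKernel_le h0 (sub_ne_zero_of_mem_cutPlane (hsub hw) ht)).trans ?_
  refine mul_le_mul_of_nonneg_right ?_ (slWeight_pos h0).le
  refine mul_le_mul (by linarith) ?_ (by positivity) (by positivity)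
  have h1 := hle w hw t ht
  have hpos : 0 < c * (1 + t) := by positivity
  calc ‖w‖ * (1 + t) / ‖(t : ℂ) - w‖ ≤ (‖z‖ + r) * (1 + t) / (c * (1 + t)) := by gcongr
    _ = (‖z‖ + r) / c := by field_simp

theorem IsSLMeasure.integrable_stieltjesKernel (hμ : 0 ≤ μ) (hG : IsSLMeasure μ G) {z : ℂ}
    (hz : z ∈ cutPlane μ) : Integrable (stieltjesKernel z) G := by
  obtain ⟨r, hr, -, C, hC⟩ := exists_ball_stieltjesKernel_le hμ hz
  refine (hG.integrable_slWeight.const_mul C).mono'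
    (measurable_stieltjesKernel z).aestronglyMeasurable ?_
  filter_upwards [hG.ae_pos, hG.ae_ge] with t h0 ht using hC z (Metric.mem_ball_self hr) t h0 ht

theorem IsSLMeasure.differentiableOn_integral (hμ : 0 ≤ μ) (hG : IsSLMeasure μ G) :
    DifferentiableOn ℂ (fun z => ∫ t, stieltjesKernel z t ∂G) (cutPlane μ) := by
  refine differentiableOn_integral_of_dominated
    (fun z _ => (measurable_stieltjesKernel z).aestronglyMeasurable) ?_ fun z hz => ?_
  · filter_upwards [hG.ae_ge] with t ht
    unfold stieltjesKernel
    have : ∀ z ∈ cutPlane μ, (t : ℂ) - z ≠ 0 := fun z hz => sub_ne_zero_of_mem_cutPlane hz ht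
    fun_prop (disch := assumption)
  · obtain ⟨r, hr, hsub, C, hC⟩ := exists_ball_stieltjesKernel_le hμ hz
    refine ⟨r, hr, hsub, _, hG.integrable_slWeight.const_mul C, ?_⟩
    filter_upwards [hG.ae_pos, hG.ae_ge] with t h0 ht w hw using hC w hw t h0 ht

theorem IsSSLMeasure.differentiableOn_stieltjesTransform (hμ : 0 ≤ μ)
    (hG : IsSSLMeasure μ G₁ G₂) :
    DifferentiableOn ℂ (stieltjesTransform G₁ G₂) (cutPlane μ) :=
  (hG.pos_part.differentiableOn_integral hμ).sub (hG.neg_part.differentiableOn_integral hμ)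

/-! ### The Lévy–Khintchine integral of an sSL-measure -/

/-- The integrand of the Lévy–Khintchine formula. -/
def levyIntegrand (ξ : ℂ) (x : ℝ) : ℂ :=
  1 - Complex.exp (Complex.I * x * ξ) +
    (Ioo (-1 : ℝ) 1).indicator (fun _ => (1 : ℂ)) x * (Complex.I * x * ξ)

theorem exp_neg_sub_one_add_le {y : ℝ} (hy : 0 ≤ y) : |Real.exp (-y) - 1 + y| ≤ y ^ 2 := by
  rw [abs_of_nonneg (by linarith [Real.one_sub_le_exp_neg y])]
  have h1 : Real.exp (-y) ≤ 1 / (1 + y) := by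
    rw [Real.exp_neg, ← one_div]
    exact one_div_le_one_div_of_le (by linarith) (by linarith [Real.add_one_le_exp y])
  have h2 : 1 / (1 + y) ≤ 1 - y + y ^ 2 := by
    rw [div_le_iff₀ (by linarith)]
    nlinarith [pow_nonneg hy 3]
  linarith

/-- Exchanging the indicator truncation for the exponential compensator costs only O(min(x², 1)),
which the Lévy measure integrates; the exchange therefore alters the drift alone. -/
theorem abs_compensator_le {x : ℝ} (hx : 0 < x) :
    |(Ioo (-1 : ℝ) 1).indicator (fun _ => (1 : ℝ)) x * x -
      (Real.exp (-x) - Real.exp (-(2 * x)))| ≤ 5 * min (x ^ 2) 1 := by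
  rcases lt_or_ge x 1 with h | h
  · rw [indicator_of_mem (by constructor <;> linarith), min_eq_left (by nlinarith)]
    have h1 := exp_neg_sub_one_add_le hx.le
    have h2 := exp_neg_sub_one_add_le (y := 2 * x) (by linarith)
    rw [abs_le] at *
    constructor <;> nlinarith
  · rw [indicator_of_notMem (by intro hx'; linarith [hx'.2]), min_eq_right (by nlinarith)]
    have h1 : Real.exp (-x) ≤ 1 := Real.exp_le_one_iff.2 (by linarith)
    have h2 : Real.exp (-(2 * x)) ≤ 1 := Real.exp_le_one_iff.2 (by linarith)
    have h3 := Real.exp_pos (-x)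
    have h4 := Real.exp_pos (-(2 * x))
    rw [abs_le]
    constructor <;> linarith

/-- For x < 1 the first-order terms of the exponential and of the compensator cancel. For x ≥ 1 the
bound uses that exp(ixξ) has modulus 1 at real ξ. -/
theorem norm_compensated_exp_le (ξ : ℝ) {x : ℝ} (hx : 0 < x) :
    ‖1 - Complex.exp (x * (Complex.I * ξ)) +
      Complex.I * ξ * (Complex.exp (-x) - Complex.exp (-(2 * x)))‖ ≤
      (3 * ξ ^ 2 + 5 * |ξ| + 2) * min (x ^ 2) 1 := by
  have hn : ‖Complex.I * (ξ : ℂ)‖ = |ξ| := by simp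
  have he : ‖Complex.exp (x * (Complex.I * ξ))‖ = 1 := by
    rw [show (x : ℂ) * (Complex.I * ξ) = ((x * ξ : ℝ) : ℂ) * Complex.I by push_cast; ring,
      Complex.norm_exp_ofReal_mul_I]
  have hE : (Complex.exp (-x) - Complex.exp (-(2 * x)) : ℂ) =
      ((Real.exp (-x) - Real.exp (-(2 * x)) : ℝ) : ℂ) := by push_cast; rfl
  have hbig : ‖1 - Complex.exp (x * (Complex.I * ξ)) +
      Complex.I * ξ * (Complex.exp (-x) - Complex.exp (-(2 * x)))‖ ≤ 2 + |ξ| := by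
    refine (norm_add_le _ _).trans (add_le_add ((norm_sub_le _ _).trans ?_) ?_)
    · rw [he, norm_one]; norm_num
    · rw [norm_mul, hn, hE, Complex.norm_real, Real.norm_eq_abs]
      refine mul_le_of_le_one_right (abs_nonneg _) ?_
      have h1 : Real.exp (-x) ≤ 1 := Real.exp_le_one_iff.2 (by linarith)
      have h2 : Real.exp (-(2 * x)) ≤ 1 := Real.exp_le_one_iff.2 (by linarith)
      rw [abs_le]
      constructor <;> linarith [Real.exp_pos (-x), Real.exp_pos (-(2 * x))]
  rcases lt_or_ge x 1 with h | h
  · rw [min_eq_left (by nlinarith)]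
    set y : ℂ := x * (Complex.I * ξ) with hy
    have hyn : ‖y‖ = x * |ξ| := by
      rw [hy, norm_mul, hn, Complex.norm_real, Real.norm_of_nonneg hx.le]
    have h1 : ‖Complex.exp y - 1 - y‖ ≤ 3 * ‖y‖ ^ 2 := by
      rcases le_total ‖y‖ 1 with h' | h'
      · exact (Complex.norm_exp_sub_one_sub_id_le h').trans (by nlinarith [norm_nonneg y])
      · refine (norm_sub_le _ _).trans ((add_le_add_left (norm_sub_le _ _) _).trans ?_)
        rw [he, norm_one]
        nlinarith
    have h2 : |Real.exp (-x) - Real.exp (-(2 * x)) - x| ≤ 5 * x ^ 2 := by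
      have := abs_compensator_le hx
      rw [indicator_of_mem (by constructor <;> linarith), min_eq_left (by nlinarith), one_mul,
        abs_sub_comm] at this
      exact this
    have e : 1 - Complex.exp y + Complex.I * ξ * (Complex.exp (-x) - Complex.exp (-(2 * x))) =
        -(Complex.exp y - 1 - y) +
          Complex.I * ξ * ((Real.exp (-x) - Real.exp (-(2 * x)) - x : ℝ) : ℂ) := by
      rw [hy]; push_cast; ring
    rw [e]
    refine (norm_add_le _ _).trans ?_
    rw [norm_neg, norm_mul, hn, Complex.norm_real, Real.norm_eq_abs]
    rw [hyn, mul_pow, sq_abs] at h1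
    have h3 := mul_le_mul_of_nonneg_left h2 (abs_nonneg ξ)
    nlinarith [sq_nonneg x]
  · rw [min_eq_right (by nlinarith), mul_one]
    nlinarith [abs_nonneg ξ, sq_nonneg ξ]

theorem ofReal_laplaceDiff_integral (hG : IsSSLMeasure μ G₁ G₂) {m : ℝ → ℂ} (hm : Measurable m)
    {C : ℝ} (hb : ∀ x, 0 < x → ‖m x‖ ≤ C * min (x ^ 2) 1) :
    IntegrableOn (fun x : ℝ => m x * (laplaceDiff G₁ G₂ x : ℂ)) (Ioi 0) ∧
    ∫ x in Ioi (0 : ℝ), m x * (laplaceDiff G₁ G₂ x : ℂ) =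
      (∫ t, (∫ x in Ioi (0 : ℝ), m x * (Real.exp (-(t * x)) : ℝ)) ∂G₁) -
      ∫ t, (∫ x in Ioi (0 : ℝ), m x * (Real.exp (-(t * x)) : ℝ)) ∂G₂ := by
  obtain ⟨i1, -, e1⟩ := laplace_fubini_of_le_min_sq hG.pos_part hm hb
  obtain ⟨i2, -, e2⟩ := laplace_fubini_of_le_min_sq hG.neg_part hm hb
  have e : ∀ x : ℝ, m x * (laplaceDiff G₁ G₂ x : ℂ) =
      m x * ((∫ t, Real.exp (-(t * x)) ∂G₁ : ℝ) : ℂ) -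
        m x * ((∫ t, Real.exp (-(t * x)) ∂G₂ : ℝ) : ℂ) := fun x => by
    rw [laplaceDiff]; push_cast; ring
  simp_rw [e]
  exact ⟨i1.sub i2, by rw [integral_sub i1 i2, e1, e2]⟩

theorem IsSSLMeasure.integral_levyIntegrand (hG : IsSSLMeasure μ G₁ G₂) : ∃ c : ℝ, ∀ ξ : ℝ,
    IntegrableOn (fun x : ℝ => levyIntegrand ξ x * (laplaceDiff G₁ G₂ x : ℂ)) (Ioi 0) ∧
    ∫ x in Ioi (0 : ℝ), levyIntegrand ξ x * (laplaceDiff G₁ G₂ x : ℂ) =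
      stieltjesTransform G₁ G₂ (Complex.I * ξ) + Complex.I * ξ * c := by
  -- The difference of the two compensators; its integral against the Lévy density is the real
  -- constant c, independent of ξ.
  let m₂ : ℝ → ℝ := fun x => (Ioo (-1 : ℝ) 1).indicator (fun _ => (1 : ℝ)) x * x -
      (Real.exp (-x) - Real.exp (-(2 * x)))
  have hm₂ : Measurable m₂ := by
    have : Measurable ((Ioo (-1 : ℝ) 1).indicator fun _ => (1 : ℝ)) :=
      measurable_const.indicator measurableSet_Ioo
    fun_prop
  obtain ⟨i2, -⟩ := ofReal_laplaceDiff_integral hG (m := fun x => (m₂ x : ℂ)) (by fun_prop)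
    (C := 5) fun x hx => by
      rw [Complex.norm_real]
      exact abs_compensator_le hx
  refine ⟨∫ x in Ioi (0 : ℝ), m₂ x * laplaceDiff G₁ G₂ x, fun ξ => ?_⟩
  obtain ⟨i1, e1⟩ := ofReal_laplaceDiff_integral hG (m := fun x : ℝ =>
    1 - Complex.exp (x * (Complex.I * ξ)) +
      Complex.I * ξ * (Complex.exp (-x) - Complex.exp (-(2 * x)))) (by fun_prop)
    (fun x hx => norm_compensated_exp_le ξ hx)
  have e : ∀ x : ℝ, levyIntegrand ξ x * (laplaceDiff G₁ G₂ x : ℂ) =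
      (1 - Complex.exp (x * (Complex.I * ξ)) +
      Complex.I * ξ * (Complex.exp (-x) - Complex.exp (-(2 * x)))) * (laplaceDiff G₁ G₂ x : ℂ) +
      Complex.I * ξ * ((m₂ x : ℂ) * (laplaceDiff G₁ G₂ x : ℂ)) := fun x => by
    have hi : ((Ioo (-1 : ℝ) 1).indicator (fun _ => (1 : ℂ)) x) =
        (((Ioo (-1 : ℝ) 1).indicator (fun _ => (1 : ℝ)) x : ℝ) : ℂ) := by
      by_cases hx : x ∈ Ioo (-1 : ℝ) 1 <;> simp [hx]
    simp only [levyIntegrand, m₂, hi]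
    push_cast
    rw [show Complex.I * x * ξ = x * (Complex.I * ξ) by ring]
    ring
  simp_rw [e]
  refine ⟨i1.add (i2.const_mul _), ?_⟩
  rw [integral_add i1 (i2.const_mul _), integral_const_mul, e1]
  congr 1
  · rw [stieltjesTransform]
    congr 1 <;>
    refine integral_congr_ae ?_
    · filter_upwards [hG.pos_part.ae_pos] with t ht
      exact integral_compensated_exp ht (by simp)
    · filter_upwards [hG.neg_part.ae_pos] with t ht
      exact integral_compensated_exp ht (by simp)
  · congr 1
    rw [← integral_complex_ofReal]
    congr 1 with x
    push_cast
    rfl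

theorem integrable_withDensity_ofReal {S : Set ℝ} (hS : MeasurableSet S) {f : ℝ → ℝ}
    (hf : Measurable f) (h0 : ∀ x ∈ S, 0 ≤ f x) {g : ℝ → ℂ} :
    (Integrable g ((volume.restrict S).withDensity fun x => ENNReal.ofReal (f x)) ↔
      IntegrableOn (fun x => g x * (f x : ℂ)) S) ∧
    ∫ x, g x ∂((volume.restrict S).withDensity fun x => ENNReal.ofReal (f x)) =
      ∫ x in S, g x * (f x : ℂ) := by
  have hae : ∀ᵐ x ∂(volume.restrict S),
      (ENNReal.ofReal (f x)).toReal • g x = g x * (f x : ℂ) := by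
    refine (ae_restrict_iff' hS).2 (Eventually.of_forall fun x hx => ?_)
    rw [ENNReal.toReal_ofReal (h0 x hx), Complex.real_smul, mul_comm]
  constructor
  · rw [integrable_withDensity_iff_integrable_smul' (by fun_prop)
      (Eventually.of_forall fun _ => ENNReal.ofReal_lt_top), IntegrableOn]
    exact integrable_congr hae
  · rw [integral_withDensity_eq_integral_toReal_smul (by fun_prop)
      (Eventually.of_forall fun _ => ENNReal.ofReal_lt_top)]
    exact integral_congr_ae hae

theorem integral_Iio_eq_integral_Ioi_comp_neg (g : ℝ → ℂ) :
    (IntegrableOn g (Iio 0) ↔ IntegrableOn (fun x => g (-x)) (Ioi 0)) ∧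
    ∫ x in Iio (0 : ℝ), g x = ∫ x in Ioi (0 : ℝ), g (-x) := by
  have hmp := (Measure.measurePreserving_neg (volume : Measure ℝ)).restrict_preimage
    (measurableSet_Iio (a := (0 : ℝ)))
  have hpre : (Neg.neg : ℝ → ℝ) ⁻¹' Iio 0 = Ioi 0 := by ext x; simp
  rw [hpre] at hmp
  have hemb : MeasurableEmbedding (Neg.neg : ℝ → ℝ) := (Homeomorph.neg ℝ).measurableEmbedding
  exact ⟨(hmp.integrable_comp_emb hemb).symm, (hmp.integral_comp hemb g).symm⟩

/-- Reflection x ↦ -x carries the negative jumps to the positive half-line with ξ replaced by -ξ.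
This is why G₋ enters at -iξ and why its drift correction has the opposite sign. -/
theorem exists_levyKhintchine_eq {μm μp v b : ℝ} {Gm₁ Gm₂ Gp₁ Gp₂ : Measure ℝ}
    (hm : IsSSLMeasure μp Gm₁ Gm₂) (hp : IsSSLMeasure (-μm) Gp₁ Gp₂) :
    ∃ c : ℝ, ∀ ξ : ℝ, levyKhintchine v b (sslLevyMeasure Gm₁ Gm₂ Gp₁ Gp₂) ξ =
      v / 2 * (ξ : ℂ) ^ 2 - Complex.I * c * ξ + stieltjesTransform Gp₁ Gp₂ (Complex.I * ξ) +
        stieltjesTransform Gm₁ Gm₂ (-(Complex.I * ξ)) := by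
  obtain ⟨cp, hcp⟩ := hp.integral_levyIntegrand
  obtain ⟨cm, hcm⟩ := hm.integral_levyIntegrand
  have := hp.pos_part.sFinite
  have := hp.neg_part.sFinite
  have := hm.pos_part.sFinite
  have := hm.neg_part.sFinite
  refine ⟨b - cp + cm, fun ξ => ?_⟩
  obtain ⟨ip, ep⟩ := hcp ξ
  obtain ⟨im, em⟩ := hcm (-ξ)
  have hA := integrable_withDensity_ofReal (S := Iio 0) (f := fun x => laplaceDiff Gm₁ Gm₂ (-x))
    measurableSet_Iio (measurable_laplaceDiff.comp measurable_neg)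
    (fun x (hx : x < 0) => hm.laplace_nonneg (-x) (by linarith)) (g := levyIntegrand ξ)
  have hB := integrable_withDensity_ofReal (S := Ioi 0) (f := laplaceDiff Gp₁ Gp₂)
    measurableSet_Ioi measurable_laplaceDiff (fun x hx => hp.laplace_nonneg x hx)
    (g := levyIntegrand ξ)
  have hneg := integral_Iio_eq_integral_Ioi_comp_neg fun x =>
    levyIntegrand ξ x * (laplaceDiff Gm₁ Gm₂ (-x) : ℂ)
  have hlev : ∀ x : ℝ, levyIntegrand ξ (-x) = levyIntegrand ((-ξ : ℝ) : ℂ) x := fun x => by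
    have : (Ioo (-1 : ℝ) 1).indicator (fun _ => (1 : ℂ)) (-x) =
        (Ioo (-1 : ℝ) 1).indicator (fun _ => (1 : ℂ)) x := by
      simp only [indicator, mem_Ioo]
      congr 1
      exact propext ⟨fun h => ⟨by linarith [h.2], by linarith [h.1]⟩,
        fun h => ⟨by linarith [h.2], by linarith [h.1]⟩⟩
    simp only [levyIntegrand, this]
    push_cast
    ring_nf
  simp only [neg_neg, hlev] at hneg
  have key : ∫ x : ℝ, levyIntegrand ξ x ∂(sslLevyMeasure Gm₁ Gm₂ Gp₁ Gp₂) =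
      stieltjesTransform Gp₁ Gp₂ (Complex.I * ξ) + Complex.I * ξ * cp +
      (stieltjesTransform Gm₁ Gm₂ (-(Complex.I * ξ)) - Complex.I * ξ * cm) := by
    rw [sslLevyMeasure, integral_add_measure (hA.1.2 (hneg.1.2 im)) (hB.1.2 ip), hA.2, hB.2,
      hneg.2, ep, em]
    push_cast
    rw [mul_neg]
    ring
  rw [levyKhintchine]
  change _ + ∫ x : ℝ, levyIntegrand ξ x ∂(sslLevyMeasure Gm₁ Gm₂ Gp₁ Gp₂) = _
  rw [key]
  push_cast
  ring

end

section

variable {μ : ℝ} {G G₁ G₂ : Measure ℝ}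

/-! ### The slit domain -/

theorem isOpen_slitDomain (μm μp : ℝ) : IsOpen (slitDomain μm μp) := by
  have : IsClosed {z : ℂ | z.re = 0 ∧ (z.im ≤ μm ∨ μp ≤ z.im)} :=
    (isClosed_eq Complex.continuous_re continuous_const).inter
      ((isClosed_le Complex.continuous_im continuous_const).union
        (isClosed_le continuous_const Complex.continuous_im))
  exact this.isOpen_compl

/-- The domain is star-convex about the midpoint i(μ₋ + μ₊)/2 of the gap between the cuts. -/
theorem isPreconnected_slitDomain {μm μp : ℝ} (h : μm < μp) :
    IsPreconnected (slitDomain μm μp) := by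
  have hs : StarConvex ℝ (Complex.I * ((μm + μp) / 2 : ℝ)) (slitDomain μm μp) := by
    intro z hz a b ha hb hab hmem
    simp only [Complex.add_re, Complex.add_im, Complex.smul_re, Complex.smul_im, Complex.mul_re,
      Complex.mul_im, Complex.I_re, Complex.I_im, Complex.ofReal_re, Complex.ofReal_im,
      smul_eq_mul, zero_mul, one_mul, mul_zero, sub_zero, zero_add] at hmem
    obtain ⟨hre, him⟩ := hmem
    rcases mul_eq_zero.1 hre with h0 | h0
    · have ha1 : a = 1 := by linarith
      rw [h0, ha1] at him
      rcases him with h1 | h1 <;> linarith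
    · have e1 : a * μm + b * μm = μm := by rw [← add_mul, hab, one_mul]
      have e2 : a * μp + b * μp = μp := by rw [← add_mul, hab, one_mul]
      have e3 := mul_nonneg ha (by linarith : 0 ≤ (μp - μm) / 2)
      have hz' : μm < z.im ∧ z.im < μp := by
        by_contra hcon
        refine hz ⟨h0, ?_⟩
        by_contra! h2
        exact hcon ⟨h2.1, h2.2⟩
      rcases hb.lt_or_eq with hb' | hb'
      · rcases him with h1 | h1
        · nlinarith [mul_lt_mul_of_pos_left hz'.1 hb']
        · nlinarith [mul_lt_mul_of_pos_left hz'.2 hb']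
      · have ha1 : a = 1 := by linarith
        rw [← hb', ha1] at him
        rcases him with h1 | h1 <;> linarith
  refine (hs.isPathConnected ?_).isConnected.isPreconnected
  rintro ⟨-, h1⟩
  simp only [Complex.mul_im, Complex.I_re, Complex.I_im, Complex.ofReal_re, Complex.ofReal_im,
    zero_mul, one_mul, zero_add] at h1
  rcases h1 with h1 | h1 <;> linarith

theorem I_mul_mem_cutPlane {μm μp : ℝ} {ξ : ℂ} (h : ξ ∈ slitDomain μm μp) :
    Complex.I * ξ ∈ cutPlane (-μm) := by
  rintro ⟨h1, h2⟩
  simp only [Complex.mul_im, Complex.mul_re, Complex.I_re, Complex.I_im, zero_mul, one_mul,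
    zero_add, zero_sub] at h1 h2
  exact h ⟨h1, Or.inl (by linarith)⟩

theorem neg_I_mul_mem_cutPlane {μm μp : ℝ} {ξ : ℂ} (h : ξ ∈ slitDomain μm μp) :
    -(Complex.I * ξ) ∈ cutPlane μp := by
  rintro ⟨h1, h2⟩
  simp only [Complex.neg_im, Complex.neg_re, Complex.mul_im, Complex.mul_re, Complex.I_re,
    Complex.I_im, zero_mul, one_mul, zero_add, zero_sub, neg_neg, neg_eq_zero] at h1 h2
  exact h ⟨h1, Or.inr h2⟩

theorem ofReal_mem_slitDomain {μm μp : ℝ} {x : ℝ} (hx : x ≠ 0) :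
    (x : ℂ) ∈ slitDomain μm μp := fun h => hx (by simpa using h.1)

/-! ### The Stieltjes representation of the characteristic exponent -/

/-- For a single t the exponential determines tψ only modulo 2πi. Taking t to be the reciprocal of
the modulus of the discrepancy makes the ambiguity a number of modulus 1, which is not a multiple of
2πi. -/
theorem HasCharExponent.eq_ofReal {Ω : Type*} [MeasurableSpace Ω] {X : ℝ≥0 → Ω → ℝ} {P : Measure Ω}
    {ψ ψ' : ℂ → ℂ} (h : HasCharExponent X P ψ) (h' : HasCharExponent X P ψ') (ξ : ℝ) :
    ψ ξ = ψ' ξ := by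
  by_contra hne
  set d : ℂ := ψ' ξ - ψ ξ with hd
  have hd0 : 0 < ‖d‖ := norm_pos_iff.2 (sub_ne_zero.2 (Ne.symm hne))
  have h1 := (h ⟨1 / ‖d‖, by positivity⟩ ξ).symm.trans (h' ⟨1 / ‖d‖, by positivity⟩ ξ)
  obtain ⟨n, hn⟩ := Complex.exp_eq_exp_iff_exists_int.1 h1
  have h2 : ((1 / ‖d‖ : ℝ) : ℂ) * d = n * (2 * Real.pi * Complex.I) := by
    rw [hd]
    have hn' : -(((1 / ‖d‖ : ℝ) : ℂ) * ψ ξ) =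
        -(((1 / ‖d‖ : ℝ) : ℂ) * ψ' ξ) + n * (2 * Real.pi * Complex.I) := hn
    linear_combination hn'
  have h3 := congrArg norm h2
  rw [norm_mul, Complex.norm_real, Real.norm_of_nonneg (by positivity), norm_mul, norm_mul,
    norm_mul, Complex.norm_I, Complex.norm_real, Real.norm_of_nonneg Real.pi_pos.le,
    Complex.norm_intCast] at h3
  simp only [one_div, Complex.norm_ofNat, mul_one] at h3
  rw [inv_mul_cancel₀ hd0.ne'] at h3
  rcases eq_or_ne n 0 with h0 | h0
  · simp [h0] at h3
  · have : (1 : ℝ) ≤ |(n : ℝ)| := by exact_mod_cast Int.one_le_abs h0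
    nlinarith [Real.pi_gt_three]

theorem charExponent_eq {Ω : Type*} [MeasurableSpace Ω] {P : Measure Ω}
    {X : ℝ≥0 → Ω → ℝ} {ψ : ℂ → ℂ} {μm μp v b : ℝ} {F : Measure ℝ}
    (hμm : μm ≤ 0) (hμp : 0 ≤ μp) (hμ : μm < μp)
    (hX : HasLevyTriplet X P v b F) (hF : IsSSLLevyMeasure μm μp F)
    (hψ : HasCharExponent X P ψ) (han : AnalyticOnNhd ℂ ψ (slitDomain μm μp)) :
    ∃ Gm₁ Gm₂ Gp₁ Gp₂ : Measure ℝ, IsSSLMeasure μp Gm₁ Gm₂ ∧ IsSSLMeasure (-μm) Gp₁ Gp₂ ∧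
      ∃ c : ℝ, ∀ ξ ∈ slitDomain μm μp, ψ ξ = v / 2 * ξ ^ 2 - Complex.I * c * ξ +
        stieltjesTransform Gp₁ Gp₂ (Complex.I * ξ) +
        stieltjesTransform Gm₁ Gm₂ (-(Complex.I * ξ)) := by
  obtain ⟨Gm₁, Gm₂, Gp₁, Gp₂, hm, hp, rfl⟩ := hF
  obtain ⟨c, hc⟩ := exists_levyKhintchine_eq (v := v) (b := b) hm hp
  refine ⟨Gm₁, Gm₂, Gp₁, Gp₂, hm, hp, c, ?_⟩
  -- The base point is 1 and not 0, since 0 is the tip of a cut when μ₋ = 0 or μ₊ = 0.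
  refine eqOn_of_eq_ofReal (isOpen_slitDomain μm μp) (isPreconnected_slitDomain hμ)
    han.differentiableOn ?_ (x₀ := 1) (ofReal_mem_slitDomain one_ne_zero)
    (Eventually.of_forall fun x => (hψ.eq_ofReal hX.charExponent x).trans (hc x))
  have d1 : DifferentiableOn ℂ (fun ξ => stieltjesTransform Gp₁ Gp₂ (Complex.I * ξ))
      (slitDomain μm μp) :=
    (hp.differentiableOn_stieltjesTransform (by linarith)).comp (by fun_prop)
      fun ξ hξ => I_mul_mem_cutPlane hξ
  have d2 : DifferentiableOn ℂ (fun ξ => stieltjesTransform Gm₁ Gm₂ (-(Complex.I * ξ)))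
      (slitDomain μm μp) :=
    (hm.differentiableOn_stieltjesTransform hμp).comp (by fun_prop)
      fun ξ hξ => neg_I_mul_mem_cutPlane hξ
  fun_prop

/-- The condition y ≤ t/2 gives |y| ≤ t - y and t ≤ 2(t - y), so |y|(1 + t)/(t - y) ≤ 1 + 2|y|. The
bound has no singularity when y and the support of G both approach 0. -/
theorem IsSLMeasure.norm_integral_kernel_le (hG : IsSLMeasure μ G) {y : ℝ}
    (hy : ∀ t, μ ≤ t → 0 < t → y ≤ t / 2) :
    ‖∫ t, stieltjesKernel y t ∂G‖ ≤ (|y| + 3) * (1 + 2 * |y|) * ∫ t, slWeight t ∂G := by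
  rw [← integral_const_mul]
  refine norm_integral_le_of_norm_le (hG.integrable_slWeight.const_mul _) ?_
  filter_upwards [hG.ae_pos, hG.ae_ge] with t h0 ht
  have hyt := hy t ht h0
  have hpos : 0 < t - y := by linarith
  have hn : ‖(t : ℂ) - (y : ℂ)‖ = t - y := by
    rw [← Complex.ofReal_sub, Complex.norm_real, Real.norm_of_nonneg hpos.le]
  refine (norm_stieltjesKernel_le h0 (norm_pos_iff.1 (hn ▸ hpos))).trans ?_
  refine mul_le_mul_of_nonneg_right ?_ (slWeight_pos h0).le
  rw [hn, Complex.norm_real, Real.norm_eq_abs]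
  refine mul_le_mul_of_nonneg_left ?_ (by positivity)
  rw [div_le_iff₀ hpos]
  have h1 : |y| ≤ t - y := by
    rw [abs_le]; constructor <;> linarith
  nlinarith [abs_nonneg y, mul_nonneg (abs_nonneg y) (by linarith : 0 ≤ t - y - t / 2)]

/-- Because μ₋ ≤ 0 ≤ μ₊, one has lβ ≤ -μ₋/2 and -lβ ≤ μ₊/2, so every kernel integral is bounded
uniformly in l. This matters as l → 0 when 0 is the tip of a cut: it is the bound that Fatou's lemma
needs in the Esscher argument. -/
theorem exists_bound_charExponent_segment {ψ : ℂ → ℂ} {μm μp v c β : ℝ} {Gm₁ Gm₂ Gp₁ Gp₂ : Measure ℝ}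
    (hμm : μm ≤ 0) (hμp : 0 ≤ μp) (hβ : β = -(μm + μp) / 2)
    (hm : IsSSLMeasure μp Gm₁ Gm₂) (hp : IsSSLMeasure (-μm) Gp₁ Gp₂)
    (h : ∀ ξ ∈ slitDomain μm μp, ψ ξ = v / 2 * ξ ^ 2 - Complex.I * c * ξ +
        stieltjesTransform Gp₁ Gp₂ (Complex.I * ξ) +
        stieltjesTransform Gm₁ Gm₂ (-(Complex.I * ξ))) :
    ∃ C : ℝ, ∀ l : ℝ, 0 < l → l ≤ 1 → -(Complex.I * (l * β : ℝ)) ∈ slitDomain μm μp →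
      ‖ψ (-(Complex.I * (l * β : ℝ)))‖ ≤ C := by
  let K : ℝ := (|β| + 3) * (1 + 2 * |β|)
  have hker : ∀ (ν : ℝ) (H : Measure ℝ), IsSLMeasure ν H → ∀ y : ℝ, |y| ≤ |β| →
      (∀ t, ν ≤ t → 0 < t → y ≤ t / 2) →
      ‖∫ t, stieltjesKernel y t ∂H‖ ≤ K * ∫ t, slWeight t ∂H := by
    intro ν H hH y hyb hy
    refine (hH.norm_integral_kernel_le hy).trans (mul_le_mul_of_nonneg_right ?_ ?_)
    · have := abs_nonneg y
      exact mul_le_mul (by linarith) (by linarith) (by positivity) (by positivity)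
    · exact integral_nonneg_of_ae (hH.ae_pos.mono fun t ht => (slWeight_pos ht).le)
  refine ⟨|v| / 2 * |β| ^ 2 + |c| * |β| +
    (K * ∫ t, slWeight t ∂Gp₁) + (K * ∫ t, slWeight t ∂Gp₂) + (K * ∫ t, slWeight t ∂Gm₁) +
    (K * ∫ t, slWeight t ∂Gm₂), fun l hl0 hl1 hmem => ?_⟩
  have e1 : Complex.I * -(Complex.I * ((l * β : ℝ) : ℂ)) = ((l * β : ℝ) : ℂ) := by
    linear_combination (-((l * β : ℝ) : ℂ)) * Complex.I_sq
  have hlb : |l * β| ≤ |β| := by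
    rw [abs_mul, abs_of_pos hl0]
    exact mul_le_of_le_one_left (abs_nonneg β) hl1
  have hyp : ∀ t : ℝ, -μm ≤ t → 0 < t → l * β ≤ t / 2 := fun t ht h0 => by
    rcases le_total β 0 with hb | hb
    · nlinarith
    · nlinarith
  have hym : ∀ t : ℝ, μp ≤ t → 0 < t → -(l * β) ≤ t / 2 := fun t ht h0 => by
    rcases le_total β 0 with hb | hb
    · nlinarith
    · nlinarith
  have kp1 := hker _ _ hp.pos_part (l * β) hlb hyp
  have kp2 := hker _ _ hp.neg_part (l * β) hlb hyp
  have km1 := hker _ _ hm.pos_part (-(l * β)) (by rwa [abs_neg]) hym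
  have km2 := hker _ _ hm.neg_part (-(l * β)) (by rwa [abs_neg]) hym
  rw [h _ hmem, e1, stieltjesTransform, stieltjesTransform]
  rw [Complex.ofReal_neg] at km1 km2
  have hnz : ‖-(Complex.I * ((l * β : ℝ) : ℂ))‖ ≤ |β| := by
    rw [norm_neg, norm_mul, Complex.norm_I, one_mul, Complex.norm_real, Real.norm_eq_abs]
    exact hlb
  have q1 : ‖(v : ℂ) / 2 * (-(Complex.I * ((l * β : ℝ) : ℂ))) ^ 2‖ ≤ |v| / 2 * |β| ^ 2 := by
    rw [norm_mul, norm_pow, norm_div, Complex.norm_real, Complex.norm_ofNat, Real.norm_eq_abs]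
    gcongr
  have q2 : ‖Complex.I * c * -(Complex.I * ((l * β : ℝ) : ℂ))‖ ≤ |c| * |β| := by
    rw [norm_mul, norm_mul, Complex.norm_I, one_mul, Complex.norm_real, Real.norm_eq_abs]
    gcongr
  refine (norm_add_le _ _).trans ((add_le_add (norm_add_le _ _) (norm_sub_le _ _)).trans ?_)
  have q3 := norm_sub_le ((v : ℂ) / 2 * (-(Complex.I * ((l * β : ℝ) : ℂ))) ^ 2)
    (Complex.I * c * -(Complex.I * ((l * β : ℝ) : ℂ)))
  have q4 := norm_sub_le (∫ t, stieltjesKernel ((l * β : ℝ) : ℂ) t ∂Gp₁)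
    (∫ t, stieltjesKernel ((l * β : ℝ) : ℂ) t ∂Gp₂)
  linarith

/-! ### The even part of the shifted exponent -/

/-- The terms linear in z cancel on averaging over ±ξ and subtracting the value at a; the remaining
pair of poles combines by partial fractions. -/
theorem symmetrized_stieltjesKernel {a t : ℝ} {ξ : ℂ} (ha : a < t)
    (h1 : (t : ℂ) - (Complex.I * ξ + a) ≠ 0) (h2 : (t : ℂ) - (-(Complex.I * ξ) + a) ≠ 0) :
    (stieltjesKernel (Complex.I * ξ + a) t + stieltjesKernel (-(Complex.I * ξ) + a) t) / 2 -
      stieltjesKernel a t =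
      1 / ((t - a : ℝ) : ℂ) - ((t - a : ℝ) : ℂ) / (((t - a : ℝ) : ℂ) ^ 2 + ξ ^ 2) := by
  have h0 : ((t : ℂ) - a) ≠ 0 := by
    rw [← Complex.ofReal_sub]; exact_mod_cast (sub_pos.2 ha).ne'
  have h3 : ((t : ℂ) - a) ^ 2 + ξ ^ 2 =
      ((t : ℂ) - (Complex.I * ξ + a)) * ((t : ℂ) - (-(Complex.I * ξ) + a)) := by
    linear_combination (ξ ^ 2) * Complex.I_sq
  have h4 : (t : ℂ) - a = (((t : ℂ) - (Complex.I * ξ + a)) +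
      ((t : ℂ) - (-(Complex.I * ξ) + a))) / 2 := by ring
  have h5 : ((t : ℂ) - a) / (((t : ℂ) - a) ^ 2 + ξ ^ 2) =
      (1 / ((t : ℂ) - (Complex.I * ξ + a)) + 1 / ((t : ℂ) - (-(Complex.I * ξ) + a))) / 2 := by
    rw [h3]
    nth_rewrite 1 [h4]
    field_simp
    ring
  push_cast
  rw [h5, stieltjesKernel, stieltjesKernel, stieltjesKernel]
  ring

theorem IsSLMeasure.integral_symmetrized (hμ : 0 ≤ μ) (hG : IsSLMeasure μ G) {a : ℝ} (ha : a < μ)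
    {ξ : ℂ} (h1 : Complex.I * ξ + a ∈ cutPlane μ) (h2 : -(Complex.I * ξ) + a ∈ cutPlane μ) :
    Integrable (fun s : ℝ => 1 / (s : ℂ) - s / ((s : ℂ) ^ 2 + ξ ^ 2)) (G.map (· - a)) ∧
    ∫ s : ℝ, (1 / (s : ℂ) - s / ((s : ℂ) ^ 2 + ξ ^ 2)) ∂(G.map (· - a)) =
      ((∫ t, stieltjesKernel (Complex.I * ξ + a) t ∂G) +
        ∫ t, stieltjesKernel (-(Complex.I * ξ) + a) t ∂G) / 2 - ∫ t, stieltjesKernel a t ∂G := by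
  have h3 : (a : ℂ) ∈ cutPlane μ := fun h => by
    have := h.2
    simp at this
    linarith
  have i1 := hG.integrable_stieltjesKernel hμ h1
  have i2 := hG.integrable_stieltjesKernel hμ h2
  have i3 := hG.integrable_stieltjesKernel hμ h3
  have hm : Measurable fun s : ℝ => 1 / (s : ℂ) - s / ((s : ℂ) ^ 2 + ξ ^ 2) := by fun_prop
  have hae : (fun t => (stieltjesKernel (Complex.I * ξ + a) t +
      stieltjesKernel (-(Complex.I * ξ) + a) t) / 2 - stieltjesKernel a t) =ᵐ[G]
      fun t => 1 / ((t - a : ℝ) : ℂ) - ((t - a : ℝ) : ℂ) / (((t - a : ℝ) : ℂ) ^ 2 + ξ ^ 2) := by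
    filter_upwards [hG.ae_ge] with t ht
    exact symmetrized_stieltjesKernel (by linarith) (sub_ne_zero_of_mem_cutPlane h1 ht)
      (sub_ne_zero_of_mem_cutPlane h2 ht)
  have i12 : Integrable (fun t => (stieltjesKernel (Complex.I * ξ + a) t +
      stieltjesKernel (-(Complex.I * ξ) + a) t) / 2) G := (i1.add i2).div_const 2
  constructor
  · rw [integrable_map_measure hm.aestronglyMeasurable (by fun_prop)]
    exact (i12.sub i3).congr hae
  · rw [integral_map (by fun_prop) hm.aestronglyMeasurable, ← integral_congr_ae hae,
      integral_sub i12 i3, integral_div, integral_add i1 i2]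

/-- As a < μ, the shifted variable t - a stays above μ - a > 0 and 1 + t ≤ K(t - a), so s⁻³ is
dominated by `slWeight`. -/
theorem IsSLMeasure.integrable_inv_cube (hG : IsSLMeasure μ G) {a : ℝ} (ha : a < μ) :
    Integrable (fun s : ℝ => (s ^ 3)⁻¹) (G.map (· - a)) := by
  rw [integrable_map_measure (by fun_prop) (by fun_prop)]
  obtain ⟨K, hK⟩ : ∃ K, K = 1 + (1 + |a|) / (μ - a) := ⟨_, rfl⟩
  have hd : 0 < μ - a := by linarith
  have hK1 : 1 ≤ K := by rw [hK]; have : 0 ≤ (1 + |a|) / (μ - a) := by positivity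
                         linarith
  refine (hG.integrable_slWeight.const_mul (K ^ 3)).mono' (by fun_prop) ?_
  filter_upwards [hG.ae_pos, hG.ae_ge] with t h0 ht
  have hs : 0 < t - a := by linarith
  simp only [Function.comp_apply]
  rw [Real.norm_of_nonneg (by positivity), slWeight, ← div_eq_mul_inv, inv_eq_one_div,
    div_le_div_iff₀ (by positivity) (by positivity), one_mul, ← mul_pow]
  have h1 : 1 + t ≤ K * (t - a) := by
    have : 1 + |a| ≤ (1 + |a|) / (μ - a) * (t - a) := by
      rw [div_mul_eq_mul_div, le_div_iff₀ hd]
      have := abs_nonneg a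
      exact mul_le_mul_of_nonneg_left (by linarith) (by linarith)
    rw [hK, add_mul, one_mul]
    linarith [le_abs_self a]
  calc t * (1 + t) ^ 2 ≤ (1 + t) * (1 + t) ^ 2 := by gcongr; linarith
    _ = (1 + t) ^ 3 := by ring
    _ ≤ (K * (t - a)) ^ 3 := by gcongr

theorem mem_slitDomain_shift {μm μp β : ℝ} (hβ : β = -(μm + μp) / 2) {ξ : ℂ} :
    ξ - Complex.I * β ∈ slitDomain μm μp ↔ ¬ (ξ.re = 0 ∧ (μp - μm) / 2 ≤ |ξ.im|) := by
  have e1 : (ξ - Complex.I * β).re = ξ.re := by simp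
  have e2 : (ξ - Complex.I * β).im = ξ.im - β := by simp
  show ¬ (_ ∧ _) ↔ _
  rw [e1, e2, le_abs, hβ]
  refine not_congr (and_congr_right fun _ => ⟨fun h => ?_, fun h => ?_⟩)
  · rcases h with h | h
    · right; linarith
    · left; linarith
  · rcases h with h | h
    · right; linarith
    · left; linarith

/-- Shifting by β for G₊ and by -β for G₋ moves both supports to the same half-line [(μ₊ - μ₋)/2,
∞). The positive parts are then added to form H₁, the negative parts to form H₂. -/
theorem exists_even_representation {ψ : ℂ → ℂ} {μm μp v c β : ℝ} {Gm₁ Gm₂ Gp₁ Gp₂ : Measure ℝ}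
    (hμm : μm ≤ 0) (hμp : 0 ≤ μp) (hμ : μm < μp) (hβ : β = -(μm + μp) / 2)
    (hm : IsSSLMeasure μp Gm₁ Gm₂) (hp : IsSSLMeasure (-μm) Gp₁ Gp₂)
    (h : ∀ ξ ∈ slitDomain μm μp, ψ ξ = v / 2 * ξ ^ 2 - Complex.I * c * ξ +
        stieltjesTransform Gp₁ Gp₂ (Complex.I * ξ) +
        stieltjesTransform Gm₁ Gm₂ (-(Complex.I * ξ)))
    (hsym : ∀ ξ : ℂ, ξ - Complex.I * β ∈ slitDomain μm μp →
      ψ (ξ - Complex.I * β) = ψ (-ξ - Complex.I * β)) :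
    ∃ H₁ H₂ : Measure ℝ, H₁ (Iio ((μp - μm) / 2)) = 0 ∧ H₂ (Iio ((μp - μm) / 2)) = 0 ∧
      Integrable (fun s : ℝ => (s ^ 3)⁻¹) H₁ ∧ Integrable (fun s : ℝ => (s ^ 3)⁻¹) H₂ ∧
      ∀ ξ : ℂ, ξ - Complex.I * β ∈ slitDomain μm μp →
        Integrable (fun s : ℝ => 1 / (s : ℂ) - s / ((s : ℂ) ^ 2 + ξ ^ 2)) H₁ ∧
        Integrable (fun s : ℝ => 1 / (s : ℂ) - s / ((s : ℂ) ^ 2 + ξ ^ 2)) H₂ ∧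
        ψ (ξ - Complex.I * β) - ψ (-(Complex.I * β)) = v / 2 * ξ ^ 2 +
          ((∫ s : ℝ, (1 / (s : ℂ) - s / ((s : ℂ) ^ 2 + ξ ^ 2)) ∂H₁) -
          ∫ s : ℝ, (1 / (s : ℂ) - s / ((s : ℂ) ^ 2 + ξ ^ 2)) ∂H₂) := by
  have hbp : β < -μm := by linarith
  have hbm : -β < μp := by linarith
  have hsupp : ∀ Gp Gm : Measure ℝ, IsSLMeasure (-μm) Gp → IsSLMeasure μp Gm →
      (Gp.map (· - β) + Gm.map (· - (-β))) (Iio ((μp - μm) / 2)) = 0 := by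
    intro Gp Gm hGp hGm
    rw [Measure.add_apply, Measure.map_apply (by fun_prop) measurableSet_Iio,
      Measure.map_apply (by fun_prop) measurableSet_Iio, add_eq_zero]
    constructor
    · refine measure_mono_null (fun t (ht : t - β < _) => ?_) hGp.support
      show t < -μm
      linarith
    · refine measure_mono_null (fun t (ht : t - (-β) < _) => ?_) hGm.support
      show t < μp
      linarith
  have hint : ∀ Gp Gm : Measure ℝ, IsSLMeasure (-μm) Gp → IsSLMeasure μp Gm →
      Integrable (fun s : ℝ => (s ^ 3)⁻¹) (Gp.map (· - β) + Gm.map (· - (-β))) :=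
    fun Gp Gm hGp hGm => (hGp.integrable_inv_cube hbp).add_measure
      (hGm.integrable_inv_cube hbm)
  refine ⟨_, _, hsupp _ _ hp.pos_part hm.pos_part, hsupp _ _ hp.neg_part hm.neg_part,
    hint _ _ hp.pos_part hm.pos_part, hint _ _ hp.neg_part hm.neg_part, fun ξ hξ => ?_⟩
  have hξ' : -ξ - Complex.I * β ∈ slitDomain μm μp := by
    rw [mem_slitDomain_shift hβ] at hξ ⊢
    simpa using hξ
  have h0 : -(Complex.I * (β : ℂ)) ∈ slitDomain μm μp := by
    have := (mem_slitDomain_shift hβ (ξ := 0)).2 (by simp; linarith)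
    simpa using this
  have e1 : Complex.I * (ξ - Complex.I * β) = Complex.I * ξ + β := by
    linear_combination (-β : ℂ) * Complex.I_sq
  have e2 : Complex.I * (-ξ - Complex.I * β) = -(Complex.I * ξ) + β := by
    linear_combination (-β : ℂ) * Complex.I_sq
  have e3 : Complex.I * (-(Complex.I * β)) = (β : ℂ) := by
    linear_combination (-β : ℂ) * Complex.I_sq
  have c1 := I_mul_mem_cutPlane hξ
  have c2 := I_mul_mem_cutPlane hξ'
  have d1 := neg_I_mul_mem_cutPlane hξ
  have d2 := neg_I_mul_mem_cutPlane hξ'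
  have f1 : -(Complex.I * ξ + β) = -(Complex.I * ξ) + ((-β : ℝ) : ℂ) := by push_cast; ring
  have f2 : -(-(Complex.I * ξ) + β) = Complex.I * ξ + ((-β : ℝ) : ℂ) := by push_cast; ring
  have f3 : -(β : ℂ) = ((-β : ℝ) : ℂ) := by push_cast; ring
  rw [e1] at c1 d1
  rw [e2] at c2 d2
  rw [f1] at d1
  rw [f2] at d2
  -- The only use of the symmetry here: ψ(· - iβ) equals its even part, so the drift drops out on
  -- subtracting the value at ξ = 0.
  have hhalf : ψ (ξ - Complex.I * β) =
      (ψ (ξ - Complex.I * β) + ψ (-ξ - Complex.I * β)) / 2 := by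
    rw [← hsym ξ hξ]; ring
  have A1 := hp.pos_part.integral_symmetrized (by linarith) hbp c1 c2
  have A2 := hp.neg_part.integral_symmetrized (by linarith) hbp c1 c2
  have B1 := hm.pos_part.integral_symmetrized hμp hbm d2 d1
  have B2 := hm.neg_part.integral_symmetrized hμp hbm d2 d1
  refine ⟨A1.1.add_measure B1.1, A2.1.add_measure B2.1, ?_⟩
  rw [hhalf, h _ hξ, h _ hξ', h _ h0, e1, e2, e3, f1, f2, f3,
    integral_add_measure A1.1 B1.1, integral_add_measure A2.1 B2.1, A1.2, A2.2, B1.2, B2.2]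
  simp only [stieltjesTransform]
  ring

end

/-! ### Stieltjes inversion on the positive imaginary half-axis -/

/-- The imaginary part of `1 / σ - σ / (σ² + ξ²)` at `ξ = i s + ε`. -/
def halfLinePoisson (ε s σ : ℝ) : ℝ :=
  (ε / ((s - σ) ^ 2 + ε ^ 2) - ε / ((s + σ) ^ 2 + ε ^ 2)) / 2

theorem measurable_halfLinePoisson (ε : ℝ) :
    Measurable fun p : ℝ × ℝ => halfLinePoisson ε p.1 p.2 := by
  unfold halfLinePoisson; fun_prop

theorem im_inv_sub_div {ε s σ : ℝ} (hε : 0 < ε) :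
    (1 / (σ : ℂ) - σ / ((σ : ℂ) ^ 2 + (Complex.I * s + ε) ^ 2)).im = halfLinePoisson ε s σ := by
  have h1 : ((σ - s : ℝ) : ℂ) + (ε : ℝ) * Complex.I ≠ 0 := fun h => by
    have := congrArg Complex.im h
    simp at this
    exact hε.ne' this
  have h2 : ((σ + s : ℝ) : ℂ) + (-ε : ℝ) * Complex.I ≠ 0 := fun h => by
    have := congrArg Complex.im h
    simp at this
    exact hε.ne' this
  have h3 : (σ : ℂ) ^ 2 + (Complex.I * s + ε) ^ 2 =
      (((σ - s : ℝ) : ℂ) + (ε : ℝ) * Complex.I) * (((σ + s : ℝ) : ℂ) + (-ε : ℝ) * Complex.I) := by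
    push_cast
    linear_combination ((s : ℂ) ^ 2 + (ε : ℂ) ^ 2) * Complex.I_sq
  have h4 : (σ : ℂ) / ((σ : ℂ) ^ 2 + (Complex.I * s + ε) ^ 2) =
      ((1 / 2 : ℝ) : ℂ) * ((((σ - s : ℝ) : ℂ) + (ε : ℝ) * Complex.I)⁻¹ +
        (((σ + s : ℝ) : ℂ) + (-ε : ℝ) * Complex.I)⁻¹) := by
    have aux : ∀ u w : ℂ, u ≠ 0 → w ≠ 0 → ((1 / 2 : ℝ) : ℂ) * (u + w) / (u * w) =
        ((1 / 2 : ℝ) : ℂ) * (u⁻¹ + w⁻¹) := fun u w hu hw => by field_simp; ring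
    have : (σ : ℂ) = ((1 / 2 : ℝ) : ℂ) * ((((σ - s : ℝ) : ℂ) + (ε : ℝ) * Complex.I) +
      (((σ + s : ℝ) : ℂ) + (-ε : ℝ) * Complex.I)) := by push_cast; ring
    rw [← aux _ _ h1 h2, ← this, h3]
  have h5 : (1 / (σ : ℂ)).im = 0 := by
    rw [← Complex.ofReal_one, ← Complex.ofReal_div, Complex.ofReal_im]
  rw [Complex.sub_im, h4, h5, Complex.im_ofReal_mul, Complex.add_im, Complex.inv_im, Complex.inv_im,
    Complex.normSq_add_mul_I, Complex.normSq_add_mul_I, halfLinePoisson]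
  simp only [Complex.add_im, Complex.ofReal_im, Complex.mul_im, Complex.ofReal_re, Complex.I_im,
    Complex.I_re, mul_one, mul_zero, add_zero, zero_add]
  rw [show (σ - s) ^ 2 = (s - σ) ^ 2 by ring, show (σ + s) ^ 2 = (s + σ) ^ 2 by ring]
  ring

theorem halfLinePoisson_eq {ε s σ : ℝ} (hε : 0 < ε) : halfLinePoisson ε s σ =
    2 * ε * s * σ / (((s - σ) ^ 2 + ε ^ 2) * ((s + σ) ^ 2 + ε ^ 2)) := by
  have : 0 < ε ^ 2 := by positivity
  have h1 : (s - σ) ^ 2 + ε ^ 2 ≠ 0 := by positivity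
  have h2 : (s + σ) ^ 2 + ε ^ 2 ≠ 0 := by positivity
  rw [halfLinePoisson]
  field_simp
  ring

theorem halfLinePoisson_nonneg {ε s σ : ℝ} (hε : 0 < ε) (hs : 0 < s) (hσ : 0 < σ) :
    0 ≤ halfLinePoisson ε s σ := by
  rw [halfLinePoisson_eq hε]; positivity

/-- Far from [0, b] one has |s - σ| ≥ σ/2, and the difference of the two Poisson kernels decays like
σ⁻³, which H integrates. -/
theorem halfLinePoisson_le_of_ge {ε s σ b : ℝ} (hε : 0 < ε) (hs : 0 < s) (hsb : s ≤ b)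
    (hσ : 2 * b ≤ σ) : halfLinePoisson ε s σ ≤ 8 * b * ε * (σ ^ 3)⁻¹ := by
  have hσ0 : 0 < σ := by linarith
  rw [halfLinePoisson_eq hε, ← div_eq_mul_inv, div_le_div_iff₀ (by positivity) (by positivity)]
  have h1 : σ ^ 2 / 4 ≤ (s - σ) ^ 2 + ε ^ 2 := by nlinarith [sq_nonneg ε]
  have h2 : σ ^ 2 ≤ (s + σ) ^ 2 + ε ^ 2 := by nlinarith [sq_nonneg ε, mul_pos hs hσ0]
  have h3 : σ ^ 2 / 4 * σ ^ 2 ≤ ((s - σ) ^ 2 + ε ^ 2) * ((s + σ) ^ 2 + ε ^ 2) :=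
    mul_le_mul h1 h2 (by positivity) (by positivity)
  have hb : 0 < b := by linarith
  calc 2 * ε * s * σ * σ ^ 3 ≤ 2 * ε * b * σ * σ ^ 3 := by gcongr
    _ = 8 * b * ε * (σ ^ 2 / 4 * σ ^ 2) := by ring
    _ ≤ _ := by gcongr

/-- For σ ≤ 2b the kernel is at most 1/(2ε), and (2b/σ)³ ≥ 1 converts this into a multiple of σ⁻³.
The constant blows up as ε → 0; the bound is meant for Fubini at fixed ε. -/
theorem halfLinePoisson_le {ε s σ b : ℝ} (hε : 0 < ε) (hs : 0 < s) (hsb : s ≤ b) (hσ : 0 < σ) :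
    halfLinePoisson ε s σ ≤ (8 * b * ε + 4 * b ^ 3 / ε) * (σ ^ 3)⁻¹ := by
  have hb : 0 < b := by linarith
  have hσ3 : 0 < (σ ^ 3)⁻¹ := by positivity
  rcases le_total (2 * b) σ with h | h
  · refine (halfLinePoisson_le_of_ge hε hs hsb h).trans (mul_le_mul_of_nonneg_right ?_ hσ3.le)
    have : 0 ≤ 4 * b ^ 3 / ε := by positivity
    linarith
  · have h1 : halfLinePoisson ε s σ ≤ 1 / (2 * ε) := by
      have h2 : ε / ((s - σ) ^ 2 + ε ^ 2) ≤ ε / ε ^ 2 :=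
        div_le_div_of_nonneg_left hε.le (by positivity) (by nlinarith [sq_nonneg (s - σ)])
      have h3 : 0 ≤ ε / ((s + σ) ^ 2 + ε ^ 2) := by positivity
      have h4 : ε / ε ^ 2 = 1 / ε := by field_simp
      rw [halfLinePoisson, show 1 / (2 * ε) = 1 / ε / 2 by field_simp]
      linarith
    have h2 : (1 : ℝ) ≤ (2 * b) ^ 3 * (σ ^ 3)⁻¹ := by
      rw [← div_eq_mul_inv, one_le_div (by positivity)]
      gcongr
    calc halfLinePoisson ε s σ ≤ 1 / (2 * ε) * ((2 * b) ^ 3 * (σ ^ 3)⁻¹) :=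
          h1.trans (le_mul_of_one_le_right (by positivity) h2)
      _ = 4 * b ^ 3 / ε * (σ ^ 3)⁻¹ := by ring
      _ ≤ _ := by
          refine mul_le_mul_of_nonneg_right ?_ hσ3.le
          have : 0 ≤ 8 * b * ε := by positivity
          linarith

theorem integral_halfLinePoisson {ε σ a b : ℝ} (hε : 0 < ε) :
    ∫ s in a..b, halfLinePoisson ε s σ =
      ((Real.arctan ((b - σ) / ε) - Real.arctan ((a - σ) / ε)) -
        (Real.arctan ((b + σ) / ε) - Real.arctan ((a + σ) / ε))) / 2 := by
  have hd : ∀ s c : ℝ, HasDerivAt (fun s => Real.arctan ((s + c) / ε))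
      (ε / ((s + c) ^ 2 + ε ^ 2)) s := fun s c => by
    have h1 : HasDerivAt (fun s : ℝ => (s + c) / ε) (1 / ε) s :=
      ((hasDerivAt_id s).add_const c).div_const ε
    convert h1.arctan using 1
    field_simp
    ring
  have h : ∀ s ∈ uIcc a b, HasDerivAt (fun s => (Real.arctan ((s + -σ) / ε) -
      Real.arctan ((s + σ) / ε)) / 2) (halfLinePoisson ε s σ) s := fun s _ => by
    rw [halfLinePoisson, sub_eq_add_neg s σ]
    exact ((hd s (-σ)).sub (hd s σ)).div_const 2
  have hpos : ∀ x : ℝ, x ^ 2 + ε ^ 2 ≠ 0 := fun x => by positivity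
  rw [intervalIntegral.integral_eq_sub_of_hasDerivAt h]
  · simp only [← sub_eq_add_neg]; ring
  · apply Continuous.intervalIntegrable
    unfold halfLinePoisson
    have := hpos
    fun_prop (disch := intro x; exact hpos _)

/-- After integration in s the arctangents bound the near part by π, so this majorant is uniform in
ε and serves for dominated convergence. -/
theorem abs_integral_halfLinePoisson_le {ε σ a b : ℝ} (hε : 0 < ε) (hε1 : ε ≤ 1) (ha : 0 < a)
    (hab : a ≤ b) (hσ : 0 < σ) :
    |∫ s in a..b, halfLinePoisson ε s σ| ≤ (8 * b ^ 2 + 8 * Real.pi * b ^ 3) * (σ ^ 3)⁻¹ := by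
  have hb : 0 < b := by linarith
  have hσ3 : 0 < (σ ^ 3)⁻¹ := by positivity
  have hpi := Real.pi_pos
  rcases le_total (2 * b) σ with h | h
  · have h1 : ‖∫ s in a..b, halfLinePoisson ε s σ‖ ≤ 8 * b * (σ ^ 3)⁻¹ * |b - a| := by
      refine intervalIntegral.norm_integral_le_of_norm_le_const fun s hs => ?_
      rw [uIoc_of_le hab] at hs
      have hs0 : 0 < s := ha.trans hs.1
      rw [Real.norm_of_nonneg (halfLinePoisson_nonneg hε hs0 hσ)]
      refine (halfLinePoisson_le_of_ge hε hs0 hs.2 h).trans ?_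
      refine mul_le_mul_of_nonneg_right ?_ hσ3.le
      exact mul_le_of_le_one_right (by positivity) hε1
    rw [Real.norm_eq_abs] at h1
    refine h1.trans ?_
    rw [abs_of_nonneg (by linarith)]
    have h2 : 8 * b * (σ ^ 3)⁻¹ * (b - a) ≤ 8 * b * (σ ^ 3)⁻¹ * b :=
      mul_le_mul_of_nonneg_left (by linarith) (by positivity)
    have h3 : 0 ≤ 8 * Real.pi * b ^ 3 * (σ ^ 3)⁻¹ := by positivity
    nlinarith
  · have h2 : (1 : ℝ) ≤ (2 * b) ^ 3 * (σ ^ 3)⁻¹ := by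
      rw [← div_eq_mul_inv, one_le_div (by positivity)]
      gcongr
    have h1 : |∫ s in a..b, halfLinePoisson ε s σ| ≤ Real.pi := by
      rw [integral_halfLinePoisson hε]
      have b1 := Real.arctan_lt_pi_div_two ((b - σ) / ε)
      have b2 := Real.arctan_lt_pi_div_two ((a - σ) / ε)
      have b3 := Real.arctan_lt_pi_div_two ((b + σ) / ε)
      have b4 := Real.arctan_lt_pi_div_two ((a + σ) / ε)
      have c1 := Real.neg_pi_div_two_lt_arctan ((b - σ) / ε)
      have c2 := Real.neg_pi_div_two_lt_arctan ((a - σ) / ε)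
      have c3 := Real.neg_pi_div_two_lt_arctan ((b + σ) / ε)
      have c4 := Real.neg_pi_div_two_lt_arctan ((a + σ) / ε)
      rw [abs_le]
      constructor <;> linarith
    calc |∫ s in a..b, halfLinePoisson ε s σ| ≤ Real.pi * ((2 * b) ^ 3 * (σ ^ 3)⁻¹) :=
          h1.trans (le_mul_of_one_le_right hpi.le h2)
      _ = 8 * Real.pi * b ^ 3 * (σ ^ 3)⁻¹ := by ring
      _ ≤ _ := mul_le_mul_of_nonneg_right (by nlinarith [sq_nonneg b]) hσ3.le

theorem tendsto_arctan_div_pos {c : ℝ} (hc : 0 < c) :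
    Tendsto (fun ε : ℝ => Real.arctan (c / ε)) (𝓝[>] 0) (𝓝 (Real.pi / 2)) := by
  have h1 : Tendsto (fun ε : ℝ => c / ε) (𝓝[>] 0) atTop :=
    tendsto_inv_nhdsGT_zero.const_mul_atTop hc
  exact (tendsto_nhds_of_tendsto_nhdsWithin Real.tendsto_arctan_atTop).comp h1

theorem tendsto_arctan_div_neg {c : ℝ} (hc : c < 0) :
    Tendsto (fun ε : ℝ => Real.arctan (c / ε)) (𝓝[>] 0) (𝓝 (-(Real.pi / 2))) := by
  have := (tendsto_arctan_div_pos (neg_pos.2 hc)).neg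
  refine this.congr fun ε => ?_
  rw [neg_div, Real.arctan_neg, neg_neg]

/-- The arctangents centred at -σ cancel in the limit. Those centred at σ leave π/2 inside the
interval, π/4 at an endpoint and 0 outside, written as the sum of an open and a closed indicator. -/
theorem tendsto_integral_halfLinePoisson {σ a b : ℝ} (ha : 0 < a) (hab : a < b) (hσ : 0 < σ) :
    Tendsto (fun ε => ∫ s in a..b, halfLinePoisson ε s σ) (𝓝[>] 0)
      (𝓝 ((Ioo a b).indicator (fun _ => Real.pi / 4) σ +
        (Icc a b).indicator (fun _ => Real.pi / 4) σ)) := by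
  have hev : (fun ε => ((Real.arctan ((b - σ) / ε) - Real.arctan ((a - σ) / ε)) -
        (Real.arctan ((b + σ) / ε) - Real.arctan ((a + σ) / ε))) / 2) =ᶠ[𝓝[>] 0]
      fun ε => ∫ s in a..b, halfLinePoisson ε s σ := by
    filter_upwards [self_mem_nhdsWithin] with ε hε using (integral_halfLinePoisson hε).symm
  refine Tendsto.congr' hev ?_
  have t3 := tendsto_arctan_div_pos (show 0 < b + σ by linarith)
  have t4 := tendsto_arctan_div_pos (show 0 < a + σ by linarith)
  have t0 : Tendsto (fun ε : ℝ => Real.arctan ((0 : ℝ) / ε)) (𝓝[>] 0) (𝓝 0) := by simp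
  have comb : ∀ {l₁ l₂ : ℝ}, Tendsto (fun ε : ℝ => Real.arctan ((b - σ) / ε)) (𝓝[>] 0) (𝓝 l₁) →
      Tendsto (fun ε : ℝ => Real.arctan ((a - σ) / ε)) (𝓝[>] 0) (𝓝 l₂) →
      Tendsto (fun ε => ((Real.arctan ((b - σ) / ε) - Real.arctan ((a - σ) / ε)) -
        (Real.arctan ((b + σ) / ε) - Real.arctan ((a + σ) / ε))) / 2) (𝓝[>] 0)
        (𝓝 (((l₁ - l₂) - (Real.pi / 2 - Real.pi / 2)) / 2)) := fun h1 h2 =>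
    ((h1.sub h2).sub (t3.sub t4)).div_const 2
  rcases lt_trichotomy σ a with h | h | h
  · convert comb (tendsto_arctan_div_pos (by linarith)) (tendsto_arctan_div_pos (by linarith))
      using 2
    rw [indicator_of_notMem (fun h' => by linarith [h'.1]),
      indicator_of_notMem (fun h' => by linarith [h'.1])]
    ring
  · subst h
    rw [sub_self] at comb
    convert comb (tendsto_arctan_div_pos (by linarith)) t0 using 2
    · rw [sub_self]
    rw [indicator_of_notMem (fun h' => by linarith [h'.1]),
      indicator_of_mem (by constructor <;> linarith)]
    ring
  rcases lt_trichotomy σ b with h' | h' | h'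
  · convert comb (tendsto_arctan_div_pos (by linarith)) (tendsto_arctan_div_neg (by linarith))
      using 2
    rw [indicator_of_mem (by constructor <;> linarith),
      indicator_of_mem (by constructor <;> linarith)]
    ring
  · subst h'
    rw [sub_self] at comb
    convert comb t0 (tendsto_arctan_div_neg (by linarith)) using 2
    · rw [sub_self]
    rw [indicator_of_notMem (fun h' => by linarith [h'.2]),
      indicator_of_mem (by constructor <;> linarith)]
    ring
  · convert comb (tendsto_arctan_div_neg (by linarith)) (tendsto_arctan_div_neg (by linarith))
      using 2
    rw [indicator_of_notMem (fun h'' => by linarith [h''.2]),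
      indicator_of_notMem (fun h'' => by linarith [h''.2])]
    ring

/-! ### Limits of Poisson integrals against a measure -/

section

variable {H : Measure ℝ} (hpos : ∀ᵐ s ∂H, 0 < s) (hi : Integrable (fun s : ℝ => (s ^ 3)⁻¹) H)

include hpos hi

theorem sFinite_of_integrable_inv_cube : SFinite H :=
  sFinite_of_integrable_pos (w := fun s => (s ^ 3)⁻¹) (by fun_prop) hi
    (hpos.mono fun s hs => by positivity)

theorem measure_Icc_lt_top_of_integrable_inv_cube (a b : ℝ) : H (Icc a b) < ∞ := by
  rcases le_or_gt b 0 with hb | hb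
  · refine (measure_mono_null ?_ (ae_iff.1 hpos)).trans_lt ENNReal.zero_lt_top
    intro s hs
    exact not_lt.2 (hs.2.trans hb)
  · refine (measure_mono_ae ?_).trans_lt
      (hi.measure_norm_ge_lt_top (ε := (b ^ 3)⁻¹) (by positivity))
    filter_upwards [hpos] with s h0 hs
    show (b ^ 3)⁻¹ ≤ ‖(s ^ 3)⁻¹‖
    rw [Real.norm_of_nonneg (by positivity)]
    have := hs.2
    gcongr

theorem integrable_prod_halfLinePoisson {ε a b : ℝ} (hε : 0 < ε) (ha : 0 < a) :
    Integrable (fun p : ℝ × ℝ => halfLinePoisson ε p.1 p.2)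
      ((volume.restrict (Ioc a b)).prod H) := by
  have := sFinite_of_integrable_inv_cube hpos hi
  have h1 : Integrable (fun p : ℝ × ℝ => (1 : ℝ) * ((8 * b * ε + 4 * b ^ 3 / ε) * (p.2 ^ 3)⁻¹))
      ((volume.restrict (Ioc a b)).prod H) :=
    (integrable_const (1 : ℝ)).mul_prod (hi.const_mul (8 * b * ε + 4 * b ^ 3 / ε))
  refine h1.mono' (measurable_halfLinePoisson ε).aestronglyMeasurable ?_
  have hs : ∀ᵐ p : ℝ × ℝ ∂((volume.restrict (Ioc a b)).prod H), p.1 ∈ Ioc a b :=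
    Measure.quasiMeasurePreserving_fst.ae (ae_restrict_mem measurableSet_Ioc)
  have hσ : ∀ᵐ p : ℝ × ℝ ∂((volume.restrict (Ioc a b)).prod H), 0 < p.2 :=
    Measure.quasiMeasurePreserving_snd.ae hpos
  filter_upwards [hs, hσ] with p hp hp2
  have h0 : 0 < p.1 := ha.trans hp.1
  rw [Real.norm_of_nonneg (halfLinePoisson_nonneg hε h0 hp2), one_mul]
  exact halfLinePoisson_le hε h0 hp.2 hp2

theorem intervalIntegrable_integral_halfLinePoisson {ε a b : ℝ} (hε : 0 < ε) (ha : 0 < a)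
    (hab : a ≤ b) :
    IntervalIntegrable (fun s => ∫ σ, halfLinePoisson ε s σ ∂H) volume a b := by
  have := sFinite_of_integrable_inv_cube hpos hi
  rw [intervalIntegrable_iff_integrableOn_Ioc_of_le hab]
  exact (integrable_prod_halfLinePoisson hpos hi hε ha).integral_prod_left

theorem tendsto_integral_integral_halfLinePoisson {a b : ℝ} (ha : 0 < a) (hab : a < b) :
    Tendsto (fun ε => ∫ s in a..b, ∫ σ, halfLinePoisson ε s σ ∂H) (𝓝[>] 0)
      (𝓝 (Real.pi / 4 * (H.real (Ioo a b) + H.real (Icc a b)))) := by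
  have := sFinite_of_integrable_inv_cube hpos hi
  have hfin := measure_Icc_lt_top_of_integrable_inv_cube hpos hi a b
  have hfin' : H (Ioo a b) < ∞ := (measure_mono Ioo_subset_Icc_self).trans_lt hfin
  have hev : (fun ε => ∫ σ, (∫ s in a..b, halfLinePoisson ε s σ) ∂H) =ᶠ[𝓝[>] 0]
      fun ε => ∫ s in a..b, ∫ σ, halfLinePoisson ε s σ ∂H := by
    filter_upwards [self_mem_nhdsWithin] with ε hε
    simp_rw [intervalIntegral.integral_of_le hab.le]
    exact (integral_integral_swap (f := fun s σ => halfLinePoisson ε s σ)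
      (integrable_prod_halfLinePoisson hpos hi hε ha)).symm
  refine Tendsto.congr' hev ?_
  have hlim : ∫ σ, ((Ioo a b).indicator (fun _ => Real.pi / 4) σ +
      (Icc a b).indicator (fun _ => Real.pi / 4) σ) ∂H =
      Real.pi / 4 * (H.real (Ioo a b) + H.real (Icc a b)) := by
    rw [integral_add ((integrable_indicator_iff measurableSet_Ioo).2
        (integrableOn_const hfin'.ne)) ((integrable_indicator_iff measurableSet_Icc).2
        (integrableOn_const hfin.ne)), integral_indicator_const _ measurableSet_Ioo,
      integral_indicator_const _ measurableSet_Icc, smul_eq_mul, smul_eq_mul]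
    ring
  rw [← hlim]
  refine tendsto_integral_filter_of_dominated_convergence
    (fun σ => (8 * b ^ 2 + 8 * Real.pi * b ^ 3) * (σ ^ 3)⁻¹) ?_ ?_ (hi.const_mul _) ?_
  · filter_upwards [self_mem_nhdsWithin] with ε hε
    simp_rw [integral_halfLinePoisson hε]
    exact Measurable.aestronglyMeasurable (by fun_prop)
  · filter_upwards [self_mem_nhdsWithin, Ioc_mem_nhdsGT (show (0 : ℝ) < 1 by norm_num)] with ε hε hε1
    filter_upwards [hpos] with σ hσ
    exact abs_integral_halfLinePoisson_le hε hε1.2 ha hab.le hσ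
  · filter_upwards [hpos] with σ hσ using tendsto_integral_halfLinePoisson ha hab hσ

end

/-! ### Boundary values of the shifted exponent -/

theorem im_stieltjesTransform_ofReal (G₁ G₂ : Measure ℝ) (y : ℝ) :
    (stieltjesTransform G₁ G₂ y).im = 0 := by
  have h : ∀ t : ℝ, stieltjesKernel y t =
      ((1 / t - 1 / (t - y) + y * (1 / (t + 1) - 1 / (t + 2)) : ℝ) : ℂ) := fun t => by
    rw [stieltjesKernel]; push_cast; rfl
  simp_rw [stieltjesTransform, h, integral_complex_ofReal]
  rw [← Complex.ofReal_sub, Complex.ofReal_im]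

/-- The representation of `ψ(ξ - iβ)` by a difference of measures on `(0, ∞)`. -/
structure ShiftedRepresentation (ψ : ℂ → ℂ) (μm μp v β : ℝ) (H₁ H₂ : Measure ℝ) : Prop where
  null₁ : H₁ (Iio ((μp - μm) / 2)) = 0
  null₂ : H₂ (Iio ((μp - μm) / 2)) = 0
  integrable₁ : Integrable (fun s : ℝ => (s ^ 3)⁻¹) H₁
  integrable₂ : Integrable (fun s : ℝ => (s ^ 3)⁻¹) H₂
  integrable_kernel₁ : ∀ ξ : ℂ, ξ - Complex.I * β ∈ slitDomain μm μp →
    Integrable (fun s : ℝ => 1 / (s : ℂ) - s / ((s : ℂ) ^ 2 + ξ ^ 2)) H₁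
  integrable_kernel₂ : ∀ ξ : ℂ, ξ - Complex.I * β ∈ slitDomain μm μp →
    Integrable (fun s : ℝ => 1 / (s : ℂ) - s / ((s : ℂ) ^ 2 + ξ ^ 2)) H₂
  im_eq : (ψ (-(Complex.I * β))).im = 0
  eq : ∀ ξ : ℂ, ξ - Complex.I * β ∈ slitDomain μm μp →
    ψ (ξ - Complex.I * β) - ψ (-(Complex.I * β)) = v / 2 * ξ ^ 2 +
      ((∫ s : ℝ, (1 / (s : ℂ) - s / ((s : ℂ) ^ 2 + ξ ^ 2)) ∂H₁) -
      ∫ s : ℝ, (1 / (s : ℂ) - s / ((s : ℂ) ^ 2 + ξ ^ 2)) ∂H₂)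

section

variable {ψ : ℂ → ℂ} {μm μp v β : ℝ} {H₁ H₂ : Measure ℝ}

theorem continuous_boundary_point (s β : ℝ) :
    Continuous fun ε : ℝ => Complex.I * s + ε - Complex.I * (β : ℂ) := by fun_prop

theorem boundary_point_mem (hβ : β = -(μm + μp) / 2) {ε : ℝ} (hε : 0 < ε) (s : ℝ) :
    Complex.I * s + ε - Complex.I * (β : ℂ) ∈ slitDomain μm μp := by
  rw [mem_slitDomain_shift hβ]
  rintro ⟨h, -⟩
  simp at h
  exact hε.ne' h

theorem gap_point_mem (hβ : β = -(μm + μp) / 2) {s : ℝ} (h0 : 0 < s) (hs : s < (μp - μm) / 2) :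
    Complex.I * s - Complex.I * (β : ℂ) ∈ slitDomain μm μp := by
  rw [mem_slitDomain_shift hβ]
  rintro ⟨-, h⟩
  simp only [Complex.mul_im, Complex.I_re, Complex.I_im, Complex.ofReal_re, Complex.ofReal_im,
    zero_mul, one_mul, zero_add, abs_of_pos h0] at h
  linarith

theorem boundary_point_eq (s β ε : ℝ) : Complex.I * ((s - β : ℝ) : ℂ) + ε =
    Complex.I * s + ε - Complex.I * (β : ℂ) := by push_cast; ring

theorem tendsto_gap (hβ : β = -(μm + μp) / 2) (han : AnalyticOnNhd ℂ ψ (slitDomain μm μp)) {s : ℝ}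
    (h0 : 0 < s) (hs : s < (μp - μm) / 2) :
    Tendsto (fun ε : ℝ => (ψ (Complex.I * s + ε - Complex.I * β)).im) (𝓝[>] 0)
      (𝓝 (ψ (Complex.I * s - Complex.I * β)).im) := by
  have h1 := (han _ (gap_point_mem hβ h0 hs)).continuousAt
  have h2 : Tendsto (fun ε : ℝ => Complex.I * s + ε - Complex.I * (β : ℂ)) (𝓝[>] 0)
      (𝓝 (Complex.I * s - Complex.I * (β : ℂ))) := by
    have := ((continuous_boundary_point s β).tendsto 0).mono_left
      (nhdsWithin_le_nhds (s := Ioi (0 : ℝ)))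
    simpa using this
  exact (Complex.continuous_im.tendsto _).comp (h1.tendsto.comp h2)

/-- Beyond the tip the limit exists by the verification conditions, inside the gap by continuity of
ψ; the tip itself is a null set. -/
theorem ae_tendsto_imBoundary (hβ : β = -(μm + μp) / 2)
    (han : AnalyticOnNhd ℂ ψ (slitDomain μm μp))
    (hlim : ∀ᵐ t : ℝ, t < μm ∨ μp < t →
      ∃ l : ℝ, Tendsto (fun ε : ℝ => (ψ (Complex.I * t + ε)).im) (𝓝[>] 0) (𝓝 l)) :
    ∀ᵐ s : ℝ, 0 < s → Tendsto (fun ε : ℝ => (ψ (Complex.I * s + ε - Complex.I * β)).im) (𝓝[>] 0)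
      (𝓝 (imBoundary ψ (s - β))) := by
  have h1 := (measurePreserving_sub_right (volume : Measure ℝ) β).quasiMeasurePreserving.ae hlim
  have h2 : ∀ᵐ s : ℝ, s ≠ (μp - μm) / 2 := by
    rw [ae_iff]; simp
  filter_upwards [h1, h2] with s hs hne h0
  suffices ∃ l : ℝ, Tendsto (fun ε : ℝ => (ψ (Complex.I * ((s - β : ℝ) : ℂ) + ε)).im)
      (𝓝[>] 0) (𝓝 l) by
    have := tendsto_nhds_limUnder this
    simp_rw [boundary_point_eq] at this
    refine this.congr' ?_ |>.trans (le_of_eq ?_)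
    · rfl
    · rw [imBoundary]; simp_rw [boundary_point_eq]
  rcases lt_or_gt_of_ne hne with h | h
  · simp_rw [boundary_point_eq]
    exact ⟨_, tendsto_gap hβ han h0 h⟩
  · exact hs (Or.inr (by linarith))

/-- On the gap ξ = is and ξ² = -s² is real, so every term of the representation is real. This puts
the support of G in [μ, ∞). -/
theorem imBoundary_gap (hβ : β = -(μm + μp) / 2) (han : AnalyticOnNhd ℂ ψ (slitDomain μm μp))
    (hR : ShiftedRepresentation ψ μm μp v β H₁ H₂) {s : ℝ}
    (h0 : 0 < s) (hs : s < (μp - μm) / 2) : imBoundary ψ (s - β) = 0 := by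
  have h1 := hR.eq _ (gap_point_mem hβ h0 hs)
  have h2 : (Complex.I * (s : ℂ)) ^ 2 = ((-s ^ 2 : ℝ) : ℂ) := by
    push_cast
    rw [mul_pow, Complex.I_sq]; ring
  have h3 : ∀ σ : ℝ, 1 / (σ : ℂ) - σ / ((σ : ℂ) ^ 2 + ((-s ^ 2 : ℝ) : ℂ)) =
      ((1 / σ - σ / (σ ^ 2 + -s ^ 2) : ℝ) : ℂ) := fun σ => by push_cast; rfl
  rw [h2] at h1
  simp_rw [h3, integral_complex_ofReal] at h1
  have h4 := congrArg Complex.im h1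
  have h5 : (v : ℂ) / 2 * ((-s ^ 2 : ℝ) : ℂ) = ((v / 2 * -s ^ 2 : ℝ) : ℂ) := by push_cast; rfl
  rw [Complex.sub_im, hR.im_eq, sub_zero, h5, ← Complex.ofReal_sub, ← Complex.ofReal_add,
    Complex.ofReal_im] at h4
  have h6 := tendsto_gap hβ han h0 hs
  rw [h4] at h6
  have := h6.limUnder_eq
  rw [imBoundary]
  simp_rw [boundary_point_eq]
  exact this

theorem rpow_le_rpow_add_rpow {x r R p : ℝ} (hr : 0 < r) (hrx : r ≤ x) (hxR : x ≤ R) :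
    x ^ p ≤ r ^ p + R ^ p := by
  have hx : 0 < x := hr.trans_le hrx
  rcases le_total 0 p with h | h
  · have := Real.rpow_le_rpow hx.le hxR h
    have := Real.rpow_nonneg hr.le p
    linarith
  · have := Real.rpow_le_rpow_of_nonpos hr hrx h
    have := Real.rpow_nonneg (hx.le.trans hxR) p
    linarith

theorem intervalIntegrable_abs_sub_rpow {p m : ℝ} (hp : -1 < p) (a b : ℝ) :
    IntervalIntegrable (fun s => |s - m| ^ p) volume a b := by
  have hpos : ∀ c, 0 ≤ c → IntervalIntegrable (fun s : ℝ => |s| ^ p) volume 0 c := fun c hc => by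
    refine (intervalIntegral.intervalIntegrable_rpow' hp).congr fun s hs => ?_
    rw [uIoc_of_le hc] at hs
    simp only [abs_of_pos hs.1]
  have hall : ∀ c, IntervalIntegrable (fun s : ℝ => |s| ^ p) volume 0 c := fun c => by
    rcases le_total 0 c with h | h
    · exact hpos c h
    · have := (hpos (-c) (by linarith)).comp_mul_left (c := -1)
      simpa using this
  have h2 : IntervalIntegrable (fun s : ℝ => |s| ^ p) volume (a - m) (b - m) :=
    (hall _).symm.trans (hall _)
  have h3 := h2.comp_sub_right m
  simpa using h3

/-- The only singularity allowed on [a, b] is |s - m|^{-1+δ} at the half-gap m, and δ > 0 makes it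
integrable. The term ‖ξ‖^ν must be kept away from ξ = 0, since ν may be negative. -/
theorem exists_boundary_bound {c : ℝ} (hμm : μm ≤ 0) (hμp : 0 ≤ μp) (hμ : μm < μp)
    (hβ : β = -(μm + μp) / 2)
    (hb : ∃ ν δ C : ℝ, ν < 2 ∧ 0 < δ ∧ 0 < C ∧ ∀ ξ ∈ slitDomain μm μp,
      ‖ψ ξ - v / 2 * ξ ^ 2 + Complex.I * c * ξ‖ ≤
        C * (‖ξ‖ ^ ν + ‖ξ - Complex.I * μm‖ ^ (-1 + δ) + ‖ξ - Complex.I * μp‖ ^ (-1 + δ)))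
    (hsym : ∀ ξ : ℂ, ξ - Complex.I * β ∈ slitDomain μm μp →
      ψ (ξ - Complex.I * β) = ψ (-ξ - Complex.I * β)) {a b : ℝ} (ha : 0 < a) :
    ∃ g : ℝ → ℝ, IntervalIntegrable g volume a b ∧ ∀ ε s : ℝ, 0 < ε → ε ≤ 1 → a < s → s ≤ b →
      s ≠ (μp - μm) / 2 → ‖ψ (Complex.I * s + ε - Complex.I * β)‖ ≤ g s := by
  obtain ⟨ν, δ, C, -, hδ, hC, hbd⟩ := hb
  obtain ⟨m, hm⟩ : ∃ m, m = (μp - μm) / 2 := ⟨_, rfl⟩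
  have hm0 : 0 < m := by rw [hm]; linarith
  obtain ⟨R, hR⟩ : ∃ R, R = |b| + |β| + m + 1 := ⟨_, rfl⟩
  let g : ℝ → ℝ := fun s => (C * ((a ^ ν + R ^ ν) + (m ^ (-1 + δ) + R ^ (-1 + δ)) + R ^ (-1 + δ)) +
    |v| / 2 * R ^ 2 + |c| * R) + C * |s - m| ^ (-1 + δ)
  refine ⟨g, intervalIntegrable_const.add
    ((intervalIntegrable_abs_sub_rpow (by linarith) a b).const_mul C), ?_⟩
  intro ε s hε hε1 has hsb hsm
  rw [← hm] at hsm
  have hs0 : 0 < s := ha.trans has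
  have hsb' : s ≤ |b| := hsb.trans (le_abs_self b)
  have hnorm : ∀ {z : ℂ} {d : ℝ}, |z.re| ≤ 1 → |z.im| = d → d ≤ |b| + |β| + m →
      d ≤ ‖z‖ ∧ ‖z‖ ≤ R := fun {z d} h1 h2 h3 => by
    refine ⟨h2 ▸ Complex.abs_im_le_norm z, (Complex.norm_le_abs_re_add_abs_im z).trans ?_⟩
    rw [hR, h2]; linarith
  -- Where |Im z| = s + |β|, the modulus of z is at least a. Vertically, one tip is at distance s +
  -- m and the other at |s - m|; the alternative only records which is which.
  have main : ∀ z ∈ slitDomain μm μp, |z.re| ≤ 1 → |z.im| = s + |β| →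
      ((|z.im - μm| = s + m ∧ |z.im - μp| = |s - m|) ∨
        (|z.im - μm| = |s - m| ∧ |z.im - μp| = s + m)) → ‖ψ z‖ ≤ g s := by
    intro z hz hre him hor
    have hsmabs : |s - m| ≤ |b| + |β| + m := by
      rw [abs_le]
      have := abs_nonneg β
      constructor <;> linarith
    have hspabs : s + m ≤ |b| + |β| + m := by
      have := abs_nonneg β
      linarith
    have hsm0 : 0 < |s - m| := abs_pos.2 (sub_ne_zero.2 hsm)
    obtain ⟨n1, n2⟩ := hnorm hre him (by linarith)
    have r1 : ‖z‖ ^ ν ≤ a ^ ν + R ^ ν :=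
      rpow_le_rpow_add_rpow ha (by have := abs_nonneg β; linarith) n2
    have e1 : ∀ y : ℝ, (z - Complex.I * y).re = z.re := fun y => by simp
    have e2 : ∀ y : ℝ, (z - Complex.I * y).im = z.im - y := fun y => by simp
    have r2 : ‖z - Complex.I * μm‖ ^ (-1 + δ) + ‖z - Complex.I * μp‖ ^ (-1 + δ) ≤
        (m ^ (-1 + δ) + R ^ (-1 + δ)) + (|s - m| ^ (-1 + δ) + R ^ (-1 + δ)) := by
      rcases hor with ⟨h1, h2⟩ | ⟨h1, h2⟩
      · obtain ⟨p1, p2⟩ := hnorm (z := z - Complex.I * μm) (by rwa [e1]) (by rw [e2, h1]) hspabs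
        obtain ⟨q1, q2⟩ := hnorm (z := z - Complex.I * μp) (by rwa [e1]) (by rw [e2, h2]) hsmabs
        exact add_le_add (rpow_le_rpow_add_rpow hm0 (by linarith) p2)
          (rpow_le_rpow_add_rpow hsm0 q1 q2)
      · obtain ⟨p1, p2⟩ := hnorm (z := z - Complex.I * μm) (by rwa [e1]) (by rw [e2, h1]) hsmabs
        obtain ⟨q1, q2⟩ := hnorm (z := z - Complex.I * μp) (by rwa [e1]) (by rw [e2, h2]) hspabs
        rw [add_comm]
        exact add_le_add (rpow_le_rpow_add_rpow hm0 (by linarith) q2)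
          (rpow_le_rpow_add_rpow hsm0 p1 p2)
    have r3 := (hbd z hz).trans (mul_le_mul_of_nonneg_left
      (show _ ≤ (a ^ ν + R ^ ν) + ((m ^ (-1 + δ) + R ^ (-1 + δ)) +
        (|s - m| ^ (-1 + δ) + R ^ (-1 + δ))) by linarith) hC.le)
    have r4 : ‖(v : ℂ) / 2 * z ^ 2‖ ≤ |v| / 2 * R ^ 2 := by
      rw [norm_mul, norm_pow, norm_div, Complex.norm_real, Complex.norm_ofNat, Real.norm_eq_abs]
      gcongr
    have r5 : ‖Complex.I * c * z‖ ≤ |c| * R := by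
      rw [norm_mul, norm_mul, Complex.norm_I, one_mul, Complex.norm_real, Real.norm_eq_abs]
      gcongr
    have e3 : ψ z = (ψ z - v / 2 * z ^ 2 + Complex.I * c * z) + (v / 2 * z ^ 2 -
      Complex.I * c * z) := by ring
    rw [e3]
    refine (norm_add_le _ _).trans ?_
    have r6 := norm_sub_le ((v : ℂ) / 2 * z ^ 2) (Complex.I * c * z)
    simp only [g]
    nlinarith
  have hmem := boundary_point_mem (μm := μm) (μp := μp) hβ hε s
  rcases le_total β 0 with h | h
  · refine main _ hmem (by simp [abs_of_pos hε, hε1]) ?_ (Or.inl ⟨?_, ?_⟩)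
    · simp only [Complex.sub_im, Complex.add_im, Complex.mul_im, Complex.I_re, Complex.I_im,
        Complex.ofReal_re, Complex.ofReal_im, zero_mul, one_mul, zero_add, add_zero]
      rw [abs_of_nonpos h, abs_of_nonneg (by linarith)]; ring
    · simp only [Complex.sub_im, Complex.add_im, Complex.mul_im, Complex.I_re, Complex.I_im,
        Complex.ofReal_re, Complex.ofReal_im, zero_mul, one_mul, zero_add, add_zero]
      rw [abs_of_nonneg (by linarith)]; linarith
    · simp only [Complex.sub_im, Complex.add_im, Complex.mul_im, Complex.I_re, Complex.I_im,
        Complex.ofReal_re, Complex.ofReal_im, zero_mul, one_mul, zero_add, add_zero]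
      congr 1; linarith
  -- For β > 0 the height s - β may vanish. The symmetry replaces the point by its mirror image,
  -- whose imaginary part is -(s + β).
  · rw [hsym _ hmem]
    have hmem' : -(Complex.I * s + ε) - Complex.I * (β : ℂ) ∈ slitDomain μm μp := by
      rw [mem_slitDomain_shift hβ] at hmem ⊢
      rwa [Complex.neg_re, Complex.neg_im, abs_neg, neg_eq_zero]
    refine main _ hmem' (by simp [abs_of_pos hε, hε1]) ?_ (Or.inr ⟨?_, ?_⟩)
    · simp only [Complex.sub_im, Complex.neg_im, Complex.add_im, Complex.mul_im, Complex.I_re,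
        Complex.I_im, Complex.ofReal_re, Complex.ofReal_im, zero_mul, one_mul, zero_add, add_zero]
      rw [abs_of_nonneg h, abs_of_nonpos (by linarith)]; ring
    · simp only [Complex.sub_im, Complex.neg_im, Complex.add_im, Complex.mul_im, Complex.I_re,
        Complex.I_im, Complex.ofReal_re, Complex.ofReal_im, zero_mul, one_mul, zero_add, add_zero]
      rw [← abs_neg]; congr 1; linarith
    · simp only [Complex.sub_im, Complex.neg_im, Complex.add_im, Complex.mul_im, Complex.I_re,
        Complex.I_im, Complex.ofReal_re, Complex.ofReal_im, zero_mul, one_mul, zero_add, add_zero]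
      rw [abs_of_nonpos (by linarith)]; linarith

theorem ShiftedRepresentation.ae_pos (hμ : μm < μp)
    (hR : ShiftedRepresentation ψ μm μp v β H₁ H₂) :
    (∀ᵐ s ∂H₁, 0 < s) ∧ ∀ᵐ s ∂H₂, 0 < s := by
  constructor
  · rw [ae_iff]
    refine measure_mono_null (fun s hs => ?_) hR.null₁
    have : ¬ 0 < s := hs
    show s < _
    linarith
  · rw [ae_iff]
    refine measure_mono_null (fun s hs => ?_) hR.null₂
    have : ¬ 0 < s := hs
    show s < _
    linarith

theorem ShiftedRepresentation.im_boundary (hβ : β = -(μm + μp) / 2)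
    (hR : ShiftedRepresentation ψ μm μp v β H₁ H₂) {ε s : ℝ} (hε : 0 < ε) :
    (ψ (Complex.I * s + ε - Complex.I * β)).im = v * s * ε +
      ((∫ σ, halfLinePoisson ε s σ ∂H₁) - ∫ σ, halfLinePoisson ε s σ ∂H₂) := by
  have hker : ∀ H : Measure ℝ, Integrable
      (fun σ : ℝ => 1 / (σ : ℂ) - σ / ((σ : ℂ) ^ 2 + (Complex.I * s + ε) ^ 2)) H →
      (∫ σ : ℝ, (1 / (σ : ℂ) - σ / ((σ : ℂ) ^ 2 + (Complex.I * s + ε) ^ 2)) ∂H).im =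
      ∫ σ, halfLinePoisson ε s σ ∂H := by
    intro H hint
    have h1 : (∫ σ : ℝ, (1 / (σ : ℂ) - σ / ((σ : ℂ) ^ 2 + (Complex.I * s + ε) ^ 2)) ∂H).im =
        ∫ σ : ℝ, (1 / (σ : ℂ) - σ / ((σ : ℂ) ^ 2 + (Complex.I * s + ε) ^ 2)).im ∂H :=
      (integral_im hint).symm
    rw [h1]
    simp_rw [im_inv_sub_div hε]
  have hmem := boundary_point_mem (μm := μm) (μp := μp) hβ hε s
  have h2 := congrArg Complex.im (hR.eq _ hmem)
  rw [Complex.sub_im, hR.im_eq, sub_zero, Complex.add_im, Complex.sub_im,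
    hker _ (hR.integrable_kernel₁ _ hmem), hker _ (hR.integrable_kernel₂ _ hmem)] at h2
  rw [h2, show (v : ℂ) / 2 = ((v / 2 : ℝ) : ℂ) by push_cast; rfl, Complex.im_ofReal_mul, sq,
    Complex.mul_im]
  simp
  ring

/-! ### Stieltjes inversion -/

/-- The limit as ε ↓ 0 of the integral of Im ψ over [a, b] is computed twice: by dominated
convergence with the boundary bound, and through the Poisson integrals of H₁ and H₂. -/
theorem intervalIntegrable_and_integral_imBoundary {c : ℝ} (hμm : μm ≤ 0) (hμp : 0 ≤ μp)
    (hμ : μm < μp) (hβ : β = -(μm + μp) / 2)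
    (hver : VerificationConditions ψ (fun ξ => ψ ξ - v / 2 * ξ ^ 2 + Complex.I * c * ξ) μm μp)
    (hsym : ∀ ξ : ℂ, ξ - Complex.I * β ∈ slitDomain μm μp →
      ψ (ξ - Complex.I * β) = ψ (-ξ - Complex.I * β))
    (hR : ShiftedRepresentation ψ μm μp v β H₁ H₂) {a b : ℝ} (ha : 0 < a) (hab : a < b) :
    IntervalIntegrable (fun s => imBoundary ψ (s - β)) volume a b ∧
    ∫ s in a..b, imBoundary ψ (s - β) =
      Real.pi / 4 * (H₁.real (Ioo a b) + H₁.real (Icc a b)) -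
      Real.pi / 4 * (H₂.real (Ioo a b) + H₂.real (Icc a b)) := by
  obtain ⟨hp1, hp2⟩ := hR.ae_pos hμ
  obtain ⟨g, hg, hgb⟩ := exists_boundary_bound (b := b) hμm hμp hμ hβ hver.bound hsym ha
  have hae := ae_tendsto_imBoundary hβ hver.analytic hver.boundary_limit
  have hne : ∀ᵐ s : ℝ, s ≠ (μp - μm) / 2 := by rw [ae_iff]; simp
  have hsmall : ∀ᶠ ε : ℝ in 𝓝[>] 0, 0 < ε ∧ ε ≤ 1 := by
    filter_upwards [Ioc_mem_nhdsGT one_pos] with ε hε using hε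
  have hmeas : ∀ ε : ℝ, 0 < ε → AEStronglyMeasurable
      (fun s : ℝ => (ψ (Complex.I * s + ε - Complex.I * β)).im) (volume.restrict (uIoc a b)) := by
    intro ε hε
    refine Continuous.aestronglyMeasurable ?_
    refine Complex.continuous_im.comp ?_
    rw [continuous_iff_continuousAt]
    intro s
    exact ContinuousAt.comp (f := fun s : ℝ => Complex.I * s + ε - Complex.I * β)
      (hver.analytic _ (boundary_point_mem hβ hε s)).continuousAt
      (by fun_prop : Continuous _).continuousAt
  have hbd : ∀ ε : ℝ, 0 < ε → ε ≤ 1 → ∀ᵐ s : ℝ, s ∈ uIoc a b →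
      ‖(ψ (Complex.I * s + ε - Complex.I * β)).im‖ ≤ g s := by
    intro ε h0 h1
    filter_upwards [hne] with s hs hs'
    rw [uIoc_of_le hab.le] at hs'
    exact (Complex.abs_im_le_norm _).trans (hgb ε s h0 h1 hs'.1 hs'.2 hs)
  have hlim : ∀ᵐ s : ℝ, s ∈ uIoc a b →
      Tendsto (fun ε : ℝ => (ψ (Complex.I * s + ε - Complex.I * β)).im) (𝓝[>] 0)
        (𝓝 (imBoundary ψ (s - β))) := by
    filter_upwards [hae] with s hs hs'
    rw [uIoc_of_le hab.le] at hs'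
    exact hs (ha.trans hs'.1)
  have hconv := intervalIntegral.tendsto_integral_filter_of_dominated_convergence
    (F := fun (ε : ℝ) (s : ℝ) => (ψ (Complex.I * s + ε - Complex.I * β)).im) (l := 𝓝[>] 0) g
    (hsmall.mono fun ε hε => hmeas ε hε.1) (hsmall.mono fun ε hε => hbd ε hε.1 hε.2) hg hlim
  have hlimR : ∀ᵐ s : ℝ ∂(volume.restrict (uIoc a b)),
      Tendsto (fun ε : ℝ => (ψ (Complex.I * s + ε - Complex.I * β)).im) (𝓝[>] 0)
        (𝓝 (imBoundary ψ (s - β))) := (ae_restrict_iff' measurableSet_uIoc).2 hlim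
  have hseq : Tendsto (fun n : ℕ => 1 / ((n : ℝ) + 1)) atTop (𝓝[>] 0) :=
    tendsto_nhdsWithin_iff.2 ⟨tendsto_one_div_add_atTop_nhds_zero_nat,
      Eventually.of_forall fun n => by simp only [mem_Ioi]; positivity⟩
  refine ⟨?_, ?_⟩
  · rw [intervalIntegrable_iff] at hg ⊢
    refine hg.mono' (aestronglyMeasurable_of_tendsto_ae atTop
      (fun n : ℕ => hmeas (1 / ((n : ℝ) + 1)) (by positivity))
      (hlimR.mono fun s hs => hs.comp hseq)) ?_
    have hb' : ∀ᵐ s : ℝ ∂(volume.restrict (uIoc a b)), ∀ n : ℕ,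
        ‖(ψ (Complex.I * s + ((1 / ((n : ℝ) + 1) : ℝ) : ℂ) - Complex.I * β)).im‖ ≤ g s :=
      ae_all_iff.2 fun n => (ae_restrict_iff' measurableSet_uIoc).2
        (hbd _ (by positivity) (by rw [div_le_one (by positivity)]; linarith [n.cast_nonneg (α := ℝ)]))
    filter_upwards [hb', hlimR] with s h1 h2
    exact le_of_tendsto (h2.comp hseq).norm (Eventually.of_forall h1)
  · have h1 := (tendsto_integral_integral_halfLinePoisson hp1 hR.integrable₁ ha hab).sub
      (tendsto_integral_integral_halfLinePoisson hp2 hR.integrable₂ ha hab)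
    -- The Gaussian term contributes vsε to the imaginary part and vanishes in the limit.
    have h2 : Tendsto (fun ε : ℝ => v * ε * ∫ s in a..b, s) (𝓝[>] 0) (𝓝 0) := by
      have : Tendsto (fun ε : ℝ => v * ε * ∫ s in a..b, s) (𝓝 0) (𝓝 (v * 0 * ∫ s in a..b, s)) :=
        Continuous.tendsto (by fun_prop) 0
      simp only [mul_zero, zero_mul] at this
      exact this.mono_left nhdsWithin_le_nhds
    have h3 := h2.add h1
    rw [zero_add] at h3
    refine tendsto_nhds_unique hconv (h3.congr' ?_)
    filter_upwards [hsmall] with ε hε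
    have i1 := intervalIntegrable_integral_halfLinePoisson hp1 hR.integrable₁ hε.1 ha hab.le
    have i2 := intervalIntegrable_integral_halfLinePoisson hp2 hR.integrable₂ hε.1 ha hab.le
    simp_rw [hR.im_boundary hβ hε.1]
    rw [intervalIntegral.integral_add (Continuous.intervalIntegrable (by fun_prop) _ _)
      (i1.sub i2), intervalIntegral.integral_sub i1 i2]
    congr 1
    rw [← intervalIntegral.integral_const_mul]
    congr 1
    ext s; ring

end

/-! ### Identification of a signed measure on the half-line by its values on intervals -/

/-- The measure on `(0, ∞)` whose density is the positive part of `k`. -/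
def halfLineMeasure (k : ℝ → ℝ) : Measure ℝ :=
  (volume.restrict (Ioi (0 : ℝ))).withDensity fun s => ENNReal.ofReal (k s)

section

variable {k : ℝ → ℝ}

theorem halfLineMeasure_apply {S : Set ℝ} (hS : MeasurableSet S) (h0 : S ⊆ Ioi 0) :
    halfLineMeasure k S = ∫⁻ s in S, ENNReal.ofReal (k s) := by
  rw [halfLineMeasure, withDensity_apply _ hS, Measure.restrict_restrict hS,
    inter_eq_self_of_subset_left h0]

theorem halfLineMeasure_lt_top {S : Set ℝ} (hS : MeasurableSet S) (h0 : S ⊆ Ioi 0)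
    (hk : IntegrableOn k S) : halfLineMeasure k S < ∞ := by
  rw [halfLineMeasure_apply hS h0]
  exact hk.lintegral_lt_top

theorem halfLineMeasure_real_sub {S : Set ℝ} (hS : MeasurableSet S) (h0 : S ⊆ Ioi 0)
    (hk : IntegrableOn k S) :
    (halfLineMeasure k).real S - (halfLineMeasure fun s => -k s).real S = ∫ s in S, k s := by
  rw [integral_eq_lintegral_pos_part_sub_lintegral_neg_part hk, measureReal_def, measureReal_def,
    halfLineMeasure_apply hS h0, halfLineMeasure_apply hS h0]

theorem halfLineMeasure_Iic_zero : halfLineMeasure k (Iic 0) = 0 := by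
  refine withDensity_absolutelyContinuous _ _ ?_
  rw [Measure.restrict_apply measurableSet_Iic, Iic_inter_Ioi, Ioc_self, measure_empty]

theorem halfLineMeasure_Iio_eq_zero {m : ℝ} (hk : ∀ᵐ s, 0 < s → s < m → k s = 0) :
    halfLineMeasure k (Iio m) = 0 := by
  rw [halfLineMeasure, withDensity_apply _ measurableSet_Iio,
    Measure.restrict_restrict measurableSet_Iio, setLIntegral_congr_fun_ae (g := fun _ => 0)
    (measurableSet_Iio.inter measurableSet_Ioi), lintegral_zero]
  filter_upwards [hk] with s hs hs'
  rw [hs hs'.2 hs'.1, ENNReal.ofReal_zero]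

theorem aemeasurable_Ioi_of_intervalIntegrable
    (hk : ∀ a b : ℝ, 0 < a → a < b → IntervalIntegrable k volume a b) :
    AEMeasurable k (volume.restrict (Ioi 0)) := by
  have hU : Ioi (0 : ℝ) = ⋃ n : ℕ, Ioc (1 / ((n : ℝ) + 1)) ((n : ℝ) + 2) := by
    ext s
    simp only [mem_Ioi, mem_iUnion, mem_Ioc]
    refine ⟨fun hs => ?_, fun ⟨n, hn, _⟩ => lt_trans (by positivity) hn⟩
    obtain ⟨n, hn⟩ := exists_nat_gt (max s (1 / s))
    refine ⟨n, ?_, ?_⟩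
    · rw [div_lt_comm₀ (by positivity) hs]
      linarith [le_max_right s (1 / s)]
    · linarith [le_max_left s (1 / s)]
  rw [hU, aemeasurable_iUnion_iff]
  intro n
  have h1 : 1 / ((n : ℝ) + 1) < (n : ℝ) + 2 := by
    rw [div_lt_iff₀ (by positivity)]
    nlinarith [n.cast_nonneg (α := ℝ)]
  have := hk _ _ (by positivity) h1
  rw [intervalIntegrable_iff_integrableOn_Ioc_of_le h1.le] at this
  exact this.aestronglyMeasurable.aemeasurable

/-- If u_n ↓ a and w_n ↑ b strictly, both the open and the closed intervals between u_n and w_n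
exhaust (a, b). In the limit the half-counted endpoints disappear, so atoms need no separate
treatment. -/
theorem measure_ext_of_Ioo_add_Icc {K₁ K₂ : Measure ℝ} {m : ℝ} (hm : 0 < m)
    (h1 : K₁ (Iio m) = 0) (h2 : K₂ (Iio m) = 0) (hfin : ∀ a b : ℝ, 0 < a → K₁ (Icc a b) < ∞)
    (h : ∀ a b : ℝ, 0 < a → a < b → K₁ (Ioo a b) + K₁ (Icc a b) = K₂ (Ioo a b) + K₂ (Icc a b)) :
    K₁ = K₂ := by
  have key : ∀ a b : ℝ, 0 < a → a < b → K₁ (Ioo a b) = K₂ (Ioo a b) := by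
    intro a b ha hab
    obtain ⟨u, hu, hua, hul⟩ := exists_seq_strictAnti_tendsto' hab
    obtain ⟨w, hw, hwa, hwl⟩ := exists_seq_strictMono_tendsto' (hua 0).2
    have hlt : ∀ n, u n < w n := fun n =>
      (hu.antitone (Nat.zero_le n)).trans_lt (hwa n).1
    have hmono : ∀ {i j : ℕ}, i ≤ j → u j ≤ u i ∧ w i ≤ w j := fun hij =>
      ⟨hu.antitone hij, hw.monotone hij⟩
    have hev : ∀ x ∈ Ioo a b, ∃ n, u n < x ∧ x < w n := fun x hx =>
      ((hul.eventually_lt_const hx.1).and (hwl.eventually_const_lt hx.2)).exists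
    have hU1 : (⋃ n, Ioo (u n) (w n)) = Ioo a b := by
      ext x
      simp only [mem_iUnion, mem_Ioo]
      exact ⟨fun ⟨n, h3, h4⟩ => ⟨(hua n).1.trans h3, h4.trans (hwa n).2⟩, fun hx => hev x hx⟩
    have hU2 : (⋃ n, Icc (u n) (w n)) = Ioo a b := by
      ext x
      simp only [mem_iUnion, mem_Ioo, mem_Icc]
      refine ⟨fun ⟨n, h3, h4⟩ => ⟨(hua n).1.trans_le h3, h4.trans_lt (hwa n).2⟩, fun hx => ?_⟩
      obtain ⟨n, h3, h4⟩ := hev x hx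
      exact ⟨n, h3.le, h4.le⟩
    have hlim : ∀ K : Measure ℝ, Tendsto (fun n => K (Ioo (u n) (w n)) + K (Icc (u n) (w n)))
        atTop (𝓝 (K (Ioo a b) + K (Ioo a b))) := by
      intro K
      have t1 := tendsto_measure_iUnion_atTop (μ := K) (s := fun n => Ioo (u n) (w n))
        fun i j hij => Ioo_subset_Ioo (hmono hij).1 (hmono hij).2
      have t2 := tendsto_measure_iUnion_atTop (μ := K) (s := fun n => Icc (u n) (w n))
        fun i j hij => Icc_subset_Icc (hmono hij).1 (hmono hij).2
      rw [hU1] at t1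
      rw [hU2] at t2
      exact t1.add t2
    have h5 := tendsto_nhds_unique (hlim K₁) ((hlim K₂).congr fun n =>
      (h _ _ (ha.trans (hua n).1) (hlt n)).symm)
    rw [← two_mul, ← two_mul] at h5
    exact (ENNReal.mul_right_inj (by simp) (by simp)).1 h5
  -- There is no mass below m, so any left endpoint can be raised to at least m/2 > 0, where the
  -- hypothesis applies.
  have hzero : ∀ {K : Measure ℝ}, K (Iio m) = 0 → ∀ a b : ℝ,
      K (Ioo a b) = K (Ioo (max a (m / 2)) b) := by
    intro K hK a b
    refine le_antisymm ?_ (measure_mono (Ioo_subset_Ioo_left (le_max_left _ _)))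
    have hsub : Ioo a b ⊆ Ioo (max a (m / 2)) b ∪ Iio m := fun x hx => by
      rcases lt_or_ge x m with h' | h'
      · exact Or.inr h'
      · exact Or.inl ⟨max_lt hx.1 (by linarith), hx.2⟩
    refine (measure_mono hsub).trans ((measure_union_le _ _).trans ?_)
    rw [hK, add_zero]
  have hall : ∀ a b : ℝ, K₁ (Ioo a b) = K₂ (Ioo a b) := by
    intro a b
    rw [hzero h1, hzero h2]
    rcases lt_or_ge (max a (m / 2)) b with h' | h'
    · exact key _ _ (lt_max_of_lt_right (by linarith)) h'
    · rw [Ioo_eq_empty (not_lt.2 h'), measure_empty, measure_empty]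
  have : IsLocallyFiniteMeasure K₁ := by
    refine ⟨fun x => ⟨Ioo (x - 1) (x + 1), Ioo_mem_nhds (by linarith) (by linarith), ?_⟩⟩
    rw [hzero h1]
    exact (measure_mono Ioo_subset_Icc_self).trans_lt
      (hfin _ _ (lt_max_of_lt_right (by linarith)))
  exact Real.measure_ext_Ioo_rat fun a b => hall a b

/-- This is H₁ - H₂ = k ds, with negative terms moved across: all four measures may be infinite, and
the additive form avoids ∞ - ∞. -/
theorem halfLineMeasure_add_eq {H₁ H₂ : Measure ℝ} {m : ℝ} (hm : 0 < m)
    (h1 : H₁ (Iio m) = 0) (h2 : H₂ (Iio m) = 0) (hf1 : ∀ a b : ℝ, H₁ (Icc a b) < ∞)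
    (hf2 : ∀ a b : ℝ, H₂ (Icc a b) < ∞) (hk0 : ∀ᵐ s, 0 < s → s < m → k s = 0)
    (hk : ∀ a b : ℝ, 0 < a → a < b → IntervalIntegrable k volume a b ∧
      ∫ s in a..b, k s = 1 / 2 * (H₁.real (Ioo a b) + H₁.real (Icc a b)) -
        1 / 2 * (H₂.real (Ioo a b) + H₂.real (Icc a b))) :
    H₁ + halfLineMeasure (fun s => -k s) = H₂ + halfLineMeasure k := by
  have hIcc : ∀ a b : ℝ, 0 < a → IntegrableOn k (Icc a b) := fun a b ha => by
    rcases lt_or_ge a b with h | h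
    · exact (integrableOn_Icc_iff_integrableOn_Ioc).2
        ((intervalIntegrable_iff_integrableOn_Ioc_of_le h.le).1 (hk a b ha h).1)
    · refine IntegrableOn.of_measure_zero ?_
      rw [Real.volume_Icc, ENNReal.ofReal_of_nonpos (by linarith)]
  have hsub : ∀ a b : ℝ, 0 < a → Icc a b ⊆ Ioi 0 := fun a b ha x hx => ha.trans_le hx.1
  have hsub' : ∀ a b : ℝ, 0 < a → Ioo a b ⊆ Ioi 0 := fun a b ha x hx => ha.trans hx.1
  have hfp : ∀ a b : ℝ, 0 < a → halfLineMeasure k (Icc a b) < ∞ := fun a b ha =>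
    halfLineMeasure_lt_top measurableSet_Icc (hsub a b ha) (hIcc a b ha)
  have hfn : ∀ a b : ℝ, 0 < a → halfLineMeasure (fun s => -k s) (Icc a b) < ∞ := fun a b ha =>
    halfLineMeasure_lt_top measurableSet_Icc (hsub a b ha) (hIcc a b ha).neg
  have hk0' : ∀ᵐ s, 0 < s → s < m → -k s = 0 := by
    filter_upwards [hk0] with s hs h h' using by rw [hs h h', neg_zero]
  refine measure_ext_of_Ioo_add_Icc hm ?_ ?_ ?_ ?_
  · rw [Measure.add_apply, h1, halfLineMeasure_Iio_eq_zero hk0', add_zero]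
  · rw [Measure.add_apply, h2, halfLineMeasure_Iio_eq_zero hk0, add_zero]
  · intro a b ha
    exact ENNReal.add_lt_top.2 ⟨hf1 a b, hfn a b ha⟩
  · intro a b ha hab
    have f1 := hf1 a b
    have f2 := hf2 a b
    have f3 := hfp a b ha
    have f4 := hfn a b ha
    have mono : ∀ K : Measure ℝ, K (Icc a b) < ∞ → K (Ioo a b) < ∞ := fun K hK =>
      (measure_mono Ioo_subset_Icc_self).trans_lt hK
    have g1 := mono _ f1
    have g2 := mono _ f2
    have g3 := mono _ f3
    have g4 := mono _ f4
    have e1 := halfLineMeasure_real_sub measurableSet_Icc (hsub a b ha) (hIcc a b ha)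
    have e2 := halfLineMeasure_real_sub measurableSet_Ioo (hsub' a b ha)
      ((hIcc a b ha).mono_set Ioo_subset_Icc_self)
    have e3 := (hk a b ha hab).2
    rw [intervalIntegral.integral_of_le hab.le] at e3
    rw [integral_Icc_eq_integral_Ioc] at e1
    rw [← integral_Ioc_eq_integral_Ioo] at e2
    simp only [Measure.add_apply]
    rw [← ENNReal.toReal_eq_toReal_iff' (by simp [*, ne_of_lt]) (by simp [*, ne_of_lt])]
    rw [ENNReal.toReal_add (by simp [*, ne_of_lt]) (by simp [*, ne_of_lt]),
      ENNReal.toReal_add g1.ne g4.ne, ENNReal.toReal_add f1.ne f4.ne,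
      ENNReal.toReal_add (by simp [*, ne_of_lt]) (by simp [*, ne_of_lt]),
      ENNReal.toReal_add g2.ne g3.ne, ENNReal.toReal_add f2.ne f3.ne]
    simp only [measureReal_def] at e1 e2 e3
    linarith

/-- The negative part of k does not charge {k > 0}, so restricting the identity to that set bounds
the positive part by H₁. Minimality of the positive part is what transfers integrability from H₁ to
the density. -/
theorem halfLineMeasure_le_of_add_eq {H₁ H₂ : Measure ℝ}
    (hk : AEMeasurable k (volume.restrict (Ioi 0)))
    (h : H₁ + halfLineMeasure (fun s => -k s) = H₂ + halfLineMeasure k) :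
    halfLineMeasure k ≤ H₁ := by
  obtain ⟨k', hk', hkk⟩ : ∃ k' : ℝ → ℝ, Measurable k' ∧ k =ᵐ[volume.restrict (Ioi 0)] k' :=
    ⟨hk.mk k, hk.measurable_mk, hk.ae_eq_mk⟩
  have e1 : halfLineMeasure k = halfLineMeasure k' :=
    withDensity_congr_ae (hkk.mono fun s hs => by simp only [hs])
  have e2 : halfLineMeasure (fun s => -k s) = halfLineMeasure fun s => -k' s :=
    withDensity_congr_ae (hkk.mono fun s hs => by simp only [hs])
  rw [e1, e2] at h
  rw [e1]
  have hE : MeasurableSet {s | 0 < k' s} := measurableSet_lt measurable_const hk'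
  refine Measure.le_iff.2 fun A hA => ?_
  have z1 : halfLineMeasure k' (A \ {s | 0 < k' s}) = 0 := by
    rw [halfLineMeasure, withDensity_apply _ (hA.diff hE), setLIntegral_congr_fun (g := fun _ => 0)
      (hA.diff hE) fun s hs => ENNReal.ofReal_of_nonpos (not_lt.1 hs.2), lintegral_zero]
  have z2 : halfLineMeasure (fun s => -k' s) (A ∩ {s | 0 < k' s}) = 0 := by
    rw [halfLineMeasure, withDensity_apply _ (hA.inter hE), setLIntegral_congr_fun (g := fun _ => 0)
      (hA.inter hE) fun s hs => ENNReal.ofReal_of_nonpos (neg_nonpos.2 (le_of_lt hs.2)),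
      lintegral_zero]
  have h3 := congrArg (fun K : Measure ℝ => K (A ∩ {s | 0 < k' s})) h
  simp only [Measure.add_apply, z2, add_zero] at h3
  calc halfLineMeasure k' A ≤ halfLineMeasure k' (A ∩ {s | 0 < k' s}) +
        halfLineMeasure k' (A \ {s | 0 < k' s}) := by
        rw [measure_inter_add_sdiff _ hE]
    _ ≤ H₁ (A ∩ {s | 0 < k' s}) := by rw [z1, add_zero, h3]; exact le_add_self
    _ ≤ H₁ A := measure_mono inter_subset_left

theorem integral_sub_eq_of_add_eq {H₁ H₂ : Measure ℝ}
    (hk : AEMeasurable k (volume.restrict (Ioi 0)))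
    (h : H₁ + halfLineMeasure (fun s => -k s) = H₂ + halfLineMeasure k) {g : ℝ → ℂ}
    (h1 : Integrable g H₁) (h2 : Integrable g H₂) :
    Integrable g (halfLineMeasure k) ∧ Integrable g (halfLineMeasure fun s => -k s) ∧
    (∫ s, g s ∂H₁) - ∫ s, g s ∂H₂ =
      (∫ s, g s ∂halfLineMeasure k) - ∫ s, g s ∂halfLineMeasure fun s => -k s := by
  have i1 := h1.mono_measure (halfLineMeasure_le_of_add_eq hk h)
  have h' : H₂ + halfLineMeasure (fun s => - -k s) = H₁ + halfLineMeasure (fun s => -k s) := by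
    simp only [neg_neg]; exact h.symm
  have i2 : Integrable g (halfLineMeasure fun s => -k s) :=
    h2.mono_measure (halfLineMeasure_le_of_add_eq hk.neg h')
  refine ⟨i1, i2, ?_⟩
  have := congrArg (fun K : Measure ℝ => ∫ s, g s ∂K) h
  rw [integral_add_measure h1 i2, integral_add_measure h2 i1] at this
  linear_combination this

/-! ### The change of variables `q = s²` -/

/-- The Jacobian is dq = 2s ds, hence the factor 1/2 on one side and the density s on the other. -/
theorem halfLineMeasure_comp_sqrt (hk : AEMeasurable k (volume.restrict (Ioi 0))) :
    halfLineMeasure (fun q => k √q / 2) =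
      ((halfLineMeasure k).withDensity fun s => ENNReal.ofReal s).map (· ^ 2) := by
  have e1 : (halfLineMeasure k).withDensity (fun s => ENNReal.ofReal s) =
      (volume.restrict (Ioi (0 : ℝ))).withDensity
        ((fun s => ENNReal.ofReal (k s)) * fun s => ENNReal.ofReal s) :=
    (withDensity_mul₀ hk.ennreal_ofReal (by fun_prop)).symm
  have himg : (fun x : ℝ => x ^ 2) '' Ioi 0 = Ioi 0 := by
    ext q
    simp only [mem_image, mem_Ioi]
    exact ⟨fun ⟨x, hx, h⟩ => h ▸ by positivity, fun hq => ⟨√q, Real.sqrt_pos.2 hq,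
      Real.sq_sqrt hq.le⟩⟩
  ext A hA
  have hA2 : MeasurableSet ((fun x : ℝ => x ^ 2) ⁻¹' A) := (measurable_id.pow_const 2) hA
  rw [Measure.map_apply (by fun_prop) hA, e1, withDensity_apply _ hA2, halfLineMeasure,
    withDensity_apply _ hA, ← lintegral_indicator hA, ← lintegral_indicator hA2]
  nth_rewrite 1 [← himg]
  rw [lintegral_image_eq_lintegral_abs_deriv_mul (f' := fun x => 2 * x) measurableSet_Ioi]
  · refine setLIntegral_congr_fun measurableSet_Ioi fun s (hs : 0 < s) => ?_
    by_cases hsA : s ^ 2 ∈ A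
    · rw [indicator_of_mem hsA, indicator_of_mem (show s ∈ (fun x : ℝ => x ^ 2) ⁻¹' A from hsA),
        Real.sqrt_sq hs.le, ← ENNReal.ofReal_mul (abs_nonneg _), Pi.mul_apply,
        ← ENNReal.ofReal_mul' hs.le, abs_of_pos (by positivity)]
      congr 1; ring
    · rw [indicator_of_notMem hsA,
        indicator_of_notMem (show s ∉ (fun x : ℝ => x ^ 2) ⁻¹' A from hsA), mul_zero]
  · intro x _
    have := (hasDerivAt_pow 2 x).hasDerivWithinAt (s := Ioi 0)
    simpa using this
  · intro x hx y hy hxy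
    exact (pow_left_inj₀ (le_of_lt hx) (le_of_lt hy) two_ne_zero).1 hxy

theorem integral_halfLineMeasure_comp_sqrt (hk : AEMeasurable k (volume.restrict (Ioi 0)))
    {E : Type*} [NormedAddCommGroup E] [NormedSpace ℝ E] {g : ℝ → E} (hg : StronglyMeasurable g) :
    (Integrable g (halfLineMeasure fun q => k √q / 2) ↔
      Integrable (fun s => s • g (s ^ 2)) (halfLineMeasure k)) ∧
    ∫ q, g q ∂(halfLineMeasure fun q => k √q / 2) = ∫ s, s • g (s ^ 2) ∂halfLineMeasure k := by
  have hae : ∀ᵐ s ∂halfLineMeasure k, 0 < s := by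
    rw [ae_iff]
    convert halfLineMeasure_Iic_zero (k := k) using 2
    ext s; simp
  have hm : Measurable fun s : ℝ => ENNReal.ofReal s := ENNReal.measurable_ofReal
  have hlt : ∀ᵐ s : ℝ ∂halfLineMeasure k, ENNReal.ofReal s < ∞ := by simp
  have hcongr : (fun s => (ENNReal.ofReal s).toReal • g (s ^ 2)) =ᵐ[halfLineMeasure k]
      fun s => s • g (s ^ 2) := hae.mono fun s hs => by
    simp only [ENNReal.toReal_ofReal hs.le]
  rw [halfLineMeasure_comp_sqrt hk, integrable_map_measure hg.aestronglyMeasurable (by fun_prop),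
    integral_map (by fun_prop) hg.aestronglyMeasurable,
    integrable_withDensity_iff_integrable_smul' hm hlt,
    integral_withDensity_eq_integral_toReal_smul hm hlt]
  exact ⟨integrable_congr hcongr, integral_congr_ae hcongr⟩

end

section

/-! ### The representation of the exponent by `G` -/

/-- `φ(ξ) = ψ(ξ - iβ) - ψ(-iβ)` is represented by `G₁ - G₂` as a function of `ξ²`. -/
structure SquareRepresentation (ψ : ℂ → ℂ) (μm μp v β : ℝ) (G₁ G₂ : Measure ℝ) : Prop where
  null_nonpos₁ : G₁ (Iic 0) = 0
  null_nonpos₂ : G₂ (Iic 0) = 0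
  support₁ : G₁ (Iio ((μp - μm) ^ 2 / 4)) = 0
  support₂ : G₂ (Iio ((μp - μm) ^ 2 / 4)) = 0
  integrable₁ : Integrable (fun q : ℝ => (q ^ 2)⁻¹) G₁
  integrable₂ : Integrable (fun q : ℝ => (q ^ 2)⁻¹) G₂
  eq : ∀ ξ : ℂ, ξ - Complex.I * β ∈ slitDomain μm μp →
    ψ (ξ - Complex.I * β) - ψ (-(Complex.I * β)) = v / 2 * ξ ^ 2 +
      ((∫ q : ℝ, (1 / (q : ℂ) - 1 / ((q : ℂ) + ξ ^ 2)) ∂G₁) -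
      ∫ q : ℝ, (1 / (q : ℂ) - 1 / ((q : ℂ) + ξ ^ 2)) ∂G₂)

variable {ψ : ℂ → ℂ} {μm μp v β : ℝ}

theorem ShiftedRepresentation.squareRepresentation {H₁ H₂ : Measure ℝ} {c : ℝ} (hμm : μm ≤ 0)
    (hμp : 0 ≤ μp) (hμ : μm < μp) (hβ : β = -(μm + μp) / 2)
    (hver : VerificationConditions ψ (fun ξ => ψ ξ - v / 2 * ξ ^ 2 + Complex.I * c * ξ) μm μp)
    (hsym : ∀ ξ : ℂ, ξ - Complex.I * β ∈ slitDomain μm μp →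
      ψ (ξ - Complex.I * β) = ψ (-ξ - Complex.I * β))
    (hR : ShiftedRepresentation ψ μm μp v β H₁ H₂) :
    SquareRepresentation ψ μm μp v β (subMeasurePos ψ β) (subMeasureNeg ψ β) := by
  obtain ⟨hp1, hp2⟩ := hR.ae_pos hμ
  -- The factor 2/π turns the constant π/4 of the inversion formula into 1/2, and makes k(√q)/2 the
  -- density π⁻¹ Im ψ(i(√q - β) + 0) of G.
  obtain ⟨k, hkdef⟩ : ∃ k : ℝ → ℝ, k = fun s => 2 / Real.pi * imBoundary ψ (s - β) := ⟨_, rfl⟩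
  have hm : 0 < (μp - μm) / 2 := by linarith
  have hk : ∀ a b : ℝ, 0 < a → a < b → IntervalIntegrable k volume a b ∧
      ∫ s in a..b, k s = 1 / 2 * (H₁.real (Ioo a b) + H₁.real (Icc a b)) -
        1 / 2 * (H₂.real (Ioo a b) + H₂.real (Icc a b)) := by
    intro a b ha hab
    obtain ⟨h1, h2⟩ :=
      intervalIntegrable_and_integral_imBoundary hμm hμp hμ hβ hver hsym hR ha hab
    rw [hkdef]
    refine ⟨h1.const_mul _, ?_⟩
    rw [intervalIntegral.integral_const_mul, h2]
    field_simp
    ring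
  have hk0 : ∀ᵐ s : ℝ, 0 < s → s < (μp - μm) / 2 → k s = 0 := Eventually.of_forall fun s h0 hs => by
    simp only [hkdef, imBoundary_gap hβ hver.analytic hR h0 hs, mul_zero]
  have hsub : ∀ q, subDensity ψ β q = k √q / 2 := fun q => by
    rw [subDensity, hkdef]; field_simp
  have ePos : subMeasurePos ψ β = halfLineMeasure fun q => k √q / 2 := by
    rw [subMeasurePos, halfLineMeasure]; simp_rw [hsub]
  have eNeg : subMeasureNeg ψ β = halfLineMeasure fun q => (-k √q) / 2 := by
    rw [subMeasureNeg, halfLineMeasure]; simp_rw [hsub, neg_div]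
  have hadd := halfLineMeasure_add_eq hm hR.null₁ hR.null₂
    (measure_Icc_lt_top_of_integrable_inv_cube hp1 hR.integrable₁)
    (measure_Icc_lt_top_of_integrable_inv_cube hp2 hR.integrable₂) hk0 hk
  have hkm : AEMeasurable k (volume.restrict (Ioi 0)) :=
    aemeasurable_Ioi_of_intervalIntegrable fun a b ha hab => (hk a b ha hab).1
  have hadd' : H₂ + halfLineMeasure (fun s => - -k s) = H₁ + halfLineMeasure (fun s => -k s) := by
    simp only [neg_neg]; exact hadd.symm
  have le1 := halfLineMeasure_le_of_add_eq hkm hadd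
  have le2 : halfLineMeasure (fun s => -k s) ≤ H₂ := halfLineMeasure_le_of_add_eq hkm.neg hadd'
  have hgap : ∀ q, q < (μp - μm) ^ 2 / 4 → √q < (μp - μm) / 2 := fun q hq => by
    rw [Real.sqrt_lt' hm]; linarith
  have hgap0 : ∀ q, 0 < q → q < (μp - μm) ^ 2 / 4 → k √q = 0 := fun q h0 hq => by
    simp only [hkdef, imBoundary_gap hβ hver.analytic hR (Real.sqrt_pos.2 h0) (hgap q hq), mul_zero]
  -- Under q = s² the weight q⁻² dq-part becomes s · s⁻⁴ = s⁻³, so integrability of the inverse cube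
  -- passes to the inverse square.
  have hint : ∀ j : ℝ → ℝ, AEMeasurable j (volume.restrict (Ioi 0)) → ∀ H : Measure ℝ,
      Integrable (fun s : ℝ => (s ^ 3)⁻¹) H → halfLineMeasure j ≤ H →
      Integrable (fun q : ℝ => (q ^ 2)⁻¹) (halfLineMeasure fun q => j √q / 2) := by
    intro j hj H hH hle
    refine ((integral_halfLineMeasure_comp_sqrt hj
      (Measurable.stronglyMeasurable (by fun_prop))).1).2 ?_
    refine (hH.mono_measure hle).congr ?_
    filter_upwards with s
    rcases eq_or_ne s 0 with h | h
    · simp [h]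
    · rw [smul_eq_mul]; field_simp
  rw [ePos, eNeg]
  refine ⟨halfLineMeasure_Iic_zero, halfLineMeasure_Iic_zero, ?_, ?_,
    hint k hkm _ hR.integrable₁ le1, hint (fun s => -k s) hkm.neg _ hR.integrable₂ le2, ?_⟩
  · exact halfLineMeasure_Iio_eq_zero (Eventually.of_forall fun q h0 hq => by simp [hgap0 q h0 hq])
  · exact halfLineMeasure_Iio_eq_zero (Eventually.of_forall fun q h0 hq => by simp [hgap0 q h0 hq])
  · intro ξ hξ
    have e : ∀ s : ℝ, 1 / (s : ℂ) - s / ((s : ℂ) ^ 2 + ξ ^ 2) =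
        s • (1 / ((s ^ 2 : ℝ) : ℂ) - 1 / (((s ^ 2 : ℝ) : ℂ) + ξ ^ 2)) := fun s => by
      rw [Complex.real_smul, mul_sub]
      congr 1
      · rcases eq_or_ne s 0 with h | h
        · simp [h]
        · have : (s : ℂ) ≠ 0 := by exact_mod_cast h
          push_cast; field_simp
      · push_cast; ring
    have hsm : StronglyMeasurable fun q : ℝ => 1 / (q : ℂ) - 1 / ((q : ℂ) + ξ ^ 2) :=
      Measurable.stronglyMeasurable (by fun_prop)
    have h3 := integral_sub_eq_of_add_eq hkm hadd (hR.integrable_kernel₁ ξ hξ)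
      (hR.integrable_kernel₂ ξ hξ)
    have e1 := (integral_halfLineMeasure_comp_sqrt hkm hsm).2
    have e2 := (integral_halfLineMeasure_comp_sqrt hkm.neg hsm).2
    simp only [← e] at e1 e2
    rw [hR.eq ξ hξ, h3.2.2, e1]
    exact congrArg _ (congrArg _ e2.symm)

theorem squareRepresentation {Ω : Type*} [MeasurableSpace Ω] {P : Measure Ω}
    [IsProbabilityMeasure P] {X : ℝ≥0 → Ω → ℝ} {b c : ℝ} {F : Measure ℝ} (hμm : μm ≤ 0)
    (hμp : 0 ≤ μp) (hμ : μm < μp) (hX : HasLevyTriplet X P v b F) (hF : IsSSLLevyMeasure μm μp F)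
    (hψ : HasCharExponent X P ψ)
    (hver : VerificationConditions ψ (fun ξ => ψ ξ - v / 2 * ξ ^ 2 + Complex.I * c * ξ) μm μp)
    (hβ : β = -(μm + μp) / 2)
    (hsym : ∀ ξ : ℂ, ξ - Complex.I * β ∈ slitDomain μm μp →
      ψ (ξ - Complex.I * β) = ψ (-ξ - Complex.I * β)) :
    SquareRepresentation ψ μm μp v β (subMeasurePos ψ β) (subMeasureNeg ψ β) := by
  obtain ⟨Gm₁, Gm₂, Gp₁, Gp₂, hm, hp, d, h⟩ :=
    charExponent_eq hμm hμp hμ hX hF hψ hver.analytic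
  obtain ⟨H₁, H₂, n1, n2, i1, i2, h3⟩ := exists_even_representation hμm hμp hμ hβ hm hp h hsym
  have h0 : -(Complex.I * (β : ℂ)) ∈ slitDomain μm μp := by
    have := (mem_slitDomain_shift hβ (ξ := 0)).2 (by simp; linarith)
    simpa using this
  have him : (ψ (-(Complex.I * β))).im = 0 := by
    have e3 : Complex.I * (-(Complex.I * β)) = (β : ℂ) := by
      linear_combination (-β : ℂ) * Complex.I_sq
    have e4 : (v : ℂ) / 2 * (-(Complex.I * β)) ^ 2 - Complex.I * d * -(Complex.I * β) =
        ((-(v / 2 * β ^ 2) - d * β : ℝ) : ℂ) := by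
      push_cast
      linear_combination (v / 2 * β ^ 2 + d * β : ℂ) * Complex.I_sq
    rw [h _ h0, e3, e4, ← Complex.ofReal_neg, Complex.add_im, Complex.add_im,
      im_stieltjesTransform_ofReal, im_stieltjesTransform_ofReal, Complex.ofReal_im]
    norm_num
  exact ShiftedRepresentation.squareRepresentation hμm hμp hμ hβ hver hsym
    ⟨n1, n2, i1, i2, fun ξ hξ => (h3 ξ hξ).1, fun ξ hξ => (h3 ξ hξ).2.1, him,
      fun ξ hξ => (h3 ξ hξ).2.2⟩

theorem isSLMeasure_of_integrable_inv_sq {G : Measure ℝ} {μ : ℝ} (h0 : G (Iic 0) = 0)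
    (hs : G (Iio μ) = 0) (hi : Integrable (fun q : ℝ => (q ^ 2)⁻¹) G) : IsSLMeasure μ G := by
  -- With a₂ = 1 and a₁ = 0 the requirement is integrability of q⁻²(1 + q)⁻¹, which is weaker than
  -- that of q⁻².
  refine ⟨h0, hs, 1, 0, zero_le_one, le_rfl, by norm_num,
    withDensity_absolutelyContinuous _ _ h0, withDensity_absolutelyContinuous _ _ hs, ?_⟩
  rw [lintegral_withDensity_eq_lintegral_mul _ (by fun_prop) (by fun_prop)]
  refine lt_of_le_of_lt (lintegral_mono_ae ?_) hi.lintegral_lt_top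
  have hpos : ∀ᵐ q ∂G, 0 < q := by
    rw [ae_iff]
    convert h0 using 2
    ext s; simp
  filter_upwards [hpos] with q hq
  simp only [Pi.mul_apply]
  rw [← ENNReal.ofReal_mul (by positivity)]
  refine ENNReal.ofReal_le_ofReal ?_
  rw [one_mul, zero_mul, add_zero]
  refine mul_le_of_le_one_right (by positivity) (inv_le_one_of_one_le₀ (by linarith))

theorem SquareRepresentation.isSSLMeasure {G₁ G₂ : Measure ℝ}
    (hS : SquareRepresentation ψ μm μp v β G₁ G₂)
    (hLap : ∀ x : ℝ, 0 < x → 0 ≤ laplaceDiff G₁ G₂ x) :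
    IsSSLMeasure ((μp - μm) ^ 2 / 4) G₁ G₂ :=
  ⟨isSLMeasure_of_integrable_inv_sq hS.null_nonpos₁ hS.support₁ hS.integrable₁,
    isSLMeasure_of_integrable_inv_sq hS.null_nonpos₂ hS.support₂ hS.integrable₂, hLap⟩

end

section

/-! ### The Laplace exponent -/

/-- The function `Ψ(z) = (v / 2) z + ∫ (1 / q - 1 / (q + z)) (G₁ - G₂)(dq)`. -/
def laplaceExponent (v : ℝ) (G₁ G₂ : Measure ℝ) (z : ℂ) : ℂ :=
  v / 2 * z + ((∫ q : ℝ, (1 / (q : ℂ) - 1 / ((q : ℂ) + z)) ∂G₁) -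
    ∫ q : ℝ, (1 / (q : ℂ) - 1 / ((q : ℂ) + z)) ∂G₂)

section

variable {M : ℝ} {G : Measure ℝ}

theorem differentiableOn_integral_inv_sub_inv (hM : 0 < M) (hG : ∀ᵐ q ∂G, M ≤ q)
    (hi : Integrable (fun q : ℝ => (q ^ 2)⁻¹) G) :
    DifferentiableOn ℂ (fun z : ℂ => ∫ q : ℝ, (1 / (q : ℂ) - 1 / ((q : ℂ) + z)) ∂G)
      {z | -M < z.re} := by
  have hne : ∀ z : ℂ, -M < z.re → ∀ q : ℝ, M ≤ q → (q : ℂ) + z ≠ 0 := fun z hz q hq h => by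
    have := congrArg Complex.re h
    simp at this
    linarith
  refine differentiableOn_integral_of_dominated (fun z _ => ?_) ?_ ?_
  · exact Measurable.aestronglyMeasurable (by fun_prop)
  · filter_upwards [hG] with q hq z hz
    have := hne z hz q hq
    have : DifferentiableAt ℂ (fun z : ℂ => 1 / (q : ℂ) - 1 / ((q : ℂ) + z)) z := by
      fun_prop (disch := exact this)
    exact this.differentiableWithinAt
  · intro z hz
    have hz' : -M < z.re := hz
    have hcut : -z ∈ cutPlane M := fun h => by
      have := h.2
      simp at this
      linarith
    obtain ⟨r, hr, c, hc, -, hb⟩ := exists_ball_norm_sub_ge hM.le hcut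
    obtain ⟨r', hr', hsub⟩ := Metric.isOpen_iff.1
      (isOpen_lt continuous_const Complex.continuous_re : IsOpen {z : ℂ | -M < z.re}) z hz
    refine ⟨min r r', lt_min hr hr', (Metric.ball_subset_ball (min_le_right _ _)).trans hsub,
      fun q => (‖z‖ + r) / c * (q ^ 2)⁻¹, hi.const_mul _, ?_⟩
    filter_upwards [hG] with q hq w hw
    have hq0 : 0 < q := hM.trans_le hq
    have hw1 : w ∈ Metric.ball z r := Metric.ball_subset_ball (min_le_left _ _) hw
    have hw2 : -w ∈ Metric.ball (-z) r := by
      rw [Metric.mem_ball, dist_neg_neg]; exact hw1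
    have h1 := hb _ hw2 q hq
    rw [sub_neg_eq_add] at h1
    have hwre : -M < w.re := hsub (Metric.ball_subset_ball (min_le_right _ _) hw)
    have h2 := hne w hwre q hq
    have hqc : (q : ℂ) ≠ 0 := by exact_mod_cast hq0.ne'
    have h3 : ‖w‖ ≤ ‖z‖ + r := by
      rw [Metric.mem_ball, dist_eq_norm] at hw1
      linarith [norm_sub_norm_le w z]
    have e : 1 / (q : ℂ) - 1 / ((q : ℂ) + w) = w / (q * (q + w)) := by
      field_simp; ring
    have h4 : c * q ≤ ‖(q : ℂ) + w‖ := le_trans (by nlinarith) h1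
    rw [e, norm_div, norm_mul, Complex.norm_real, Real.norm_of_nonneg hq0.le]
    calc ‖w‖ / (q * ‖(q : ℂ) + w‖) ≤ (‖z‖ + r) / (q * (c * q)) := by gcongr
      _ = (‖z‖ + r) / c * (q ^ 2)⁻¹ := by field_simp

theorem norm_one_sub_cexp_le {z : ℂ} (hz : 0 ≤ z.re) {x : ℝ} (hx : 0 < x) :
    ‖1 - Complex.exp (-(z * x))‖ ≤ 2 * (‖z‖ + 2) * (1 - Real.exp (-x)) := by
  have h1 : ‖1 - Complex.exp (-(z * x))‖ ≤ (‖z‖ + 2) * min x 1 := by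
    have hre : (-(z * x)).re ≤ 0 := by
      simp only [Complex.neg_re, Complex.mul_re, Complex.ofReal_re, Complex.ofReal_im, mul_zero,
        sub_zero]
      exact neg_nonpos.2 (mul_nonneg hz hx.le)
    have hn : ‖Complex.exp (-(z * x))‖ ≤ 1 := by
      rw [Complex.norm_exp]; exact Real.exp_le_one_iff.2 hre
    have hnz := norm_nonneg z
    rcases le_total x 1 with h | h
    · rw [min_eq_left h]
      have h2 : ‖1 - Complex.exp (-(z * x))‖ ≤ ‖z‖ * x := by
        have hconv : Convex ℝ {w : ℂ | w.re ≤ 0} := convex_halfSpace_re_le 0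
        have h3 := hconv.norm_image_sub_le_of_norm_deriv_le (𝕜 := ℂ) (f := Complex.exp) (C := 1)
          (x := -(z * x)) (y := 0) (fun w _ => Complex.differentiableAt_exp) (fun w hw => by
            rw [Complex.deriv_exp, Complex.norm_exp]
            exact Real.exp_le_one_iff.2 hw) hre (by simp)
        rw [Complex.exp_zero, one_mul, zero_sub, neg_neg, norm_mul, Complex.norm_real,
          Real.norm_of_nonneg hx.le] at h3
        exact h3
      nlinarith
    · rw [min_eq_right h]
      have := norm_sub_le 1 (Complex.exp (-(z * x)))
      rw [norm_one] at this
      linarith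
  refine h1.trans ?_
  have := min_le_two_mul_one_sub_exp hx
  have hnz := norm_nonneg z
  nlinarith

/-- First-order compensation is enough here: up to a constant the inner integral is bounded by 1/t -
1/(t + 1) ≤ t⁻², and q⁻² is G-integrable. -/
theorem integral_one_sub_exp_mul_laplace (hM : 0 < M) (hG : ∀ᵐ q ∂G, M ≤ q)
    (hi : Integrable (fun q : ℝ => (q ^ 2)⁻¹) G) {z : ℂ} (hz : 0 ≤ z.re) :
    IntegrableOn (fun x : ℝ => (1 - Complex.exp (-(z * x))) *
      ((∫ t, Real.exp (-(t * x)) ∂G : ℝ) : ℂ)) (Ioi 0) ∧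
    ∫ x in Ioi (0 : ℝ), (1 - Complex.exp (-(z * x))) *
      ((∫ t, Real.exp (-(t * x)) ∂G : ℝ) : ℂ) = ∫ q : ℝ, (1 / (q : ℂ) - 1 / ((q : ℂ) + z)) ∂G := by
  have : SFinite G := sFinite_of_integrable_pos (w := fun q => (q ^ 2)⁻¹) (by fun_prop) hi
    (hG.mono fun q hq => by have := hM.trans_le hq; positivity)
  have e : ∀ t x : ℝ, (1 - Complex.exp (-(z * x))) * ((Real.exp (-(t * x)) : ℝ) : ℂ) =
      Complex.exp (-(t * x)) - Complex.exp (-((t + z) * x)) := fun t x => by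
    rw [show -((t + z : ℂ) * x) = -(z * x) + -(t * x) by ring, Complex.exp_add]
    push_cast; ring
  have hre : ∀ t : ℝ, 0 < t → 0 < (t : ℂ).re ∧ 0 < ((t : ℂ) + z).re := fun t ht => by
    simp; constructor <;> linarith
  have key := laplace_fubini (G := G) (m := fun x => 1 - Complex.exp (-(z * x))) (by fun_prop)
    (N := fun q => 2 * (‖z‖ + 2) * (q ^ 2)⁻¹) (hi.const_mul _) (by
      filter_upwards [hG] with t ht
      have ht0 : 0 < t := hM.trans_le ht
      have hint : IntegrableOn (fun x : ℝ => (1 - Complex.exp (-(z * x))) *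
          ((Real.exp (-(t * x)) : ℝ) : ℂ)) (Ioi 0) := by
        simp_rw [e]
        exact (integrableOn_cexp_neg_mul (hre t ht0).1).sub (integrableOn_cexp_neg_mul (hre t ht0).2)
      refine ⟨hint, ?_⟩
      have e2 : ∀ x : ℝ, (1 - Real.exp (-x)) * Real.exp (-(t * x)) =
          Real.exp (-(t * x)) - Real.exp (-((t + 1) * x)) := fun x => by
        rw [show -((t + 1) * x) = -x + -(t * x) by ring, Real.exp_add]; ring
      have i1 := integrableOn_exp_neg_mul ht0
      have i2 := integrableOn_exp_neg_mul (a := t + 1) (by linarith)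
      have hint2 : IntegrableOn (fun x : ℝ => 2 * (‖z‖ + 2) *
          ((1 - Real.exp (-x)) * Real.exp (-(t * x)))) (Ioi 0) := by
        simp_rw [e2]
        exact (i1.sub i2).const_mul _
      refine (setIntegral_mono_on hint.norm hint2 measurableSet_Ioi fun x hx => ?_).trans ?_
      · rw [norm_mul, Complex.norm_real, Real.norm_eq_abs, Real.abs_exp, ← mul_assoc]
        exact mul_le_mul_of_nonneg_right (norm_one_sub_cexp_le hz hx) (Real.exp_pos _).le
      · simp_rw [e2]
        rw [integral_const_mul, integral_sub i1 i2, integral_exp_neg_mul ht0,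
          integral_exp_neg_mul (by linarith)]
        refine mul_le_mul_of_nonneg_left ?_ (by positivity)
        rw [div_sub_div _ _ (by positivity) (by positivity), ← one_div,
          div_le_div_iff₀ (by positivity) (by positivity)]
        nlinarith)
  refine ⟨key.1, key.2.2.trans (integral_congr_ae ?_)⟩
  filter_upwards [hG] with t ht
  have ht0 : 0 < t := hM.trans_le ht
  simp_rw [e]
  rw [integral_sub (integrableOn_cexp_neg_mul (hre t ht0).1)
    (integrableOn_cexp_neg_mul (hre t ht0).2), integral_cexp_neg_mul (hre t ht0).1,
    integral_cexp_neg_mul (hre t ht0).2]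

end

theorem sslLevyMeasure_zero (G₁ G₂ : Measure ℝ) : sslLevyMeasure 0 0 G₁ G₂ =
    (volume.restrict (Ioi (0 : ℝ))).withDensity
      (fun x => ENNReal.ofReal (laplaceDiff G₁ G₂ x)) := by
  have : (fun x => ENNReal.ofReal (laplaceDiff 0 0 (-x))) = 0 := by
    ext x; simp [laplaceDiff]
  rw [sslLevyMeasure, this, withDensity_zero, zero_add]

theorem sslLevyMeasure_zero_Iic (G₁ G₂ : Measure ℝ) : sslLevyMeasure 0 0 G₁ G₂ (Iic 0) = 0 := by
  rw [sslLevyMeasure_zero]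
  refine withDensity_absolutelyContinuous _ _ ?_
  rw [Measure.restrict_apply measurableSet_Iic, Iic_inter_Ioi, Ioc_self, measure_empty]

variable {ψ : ℂ → ℂ} {μm μp v β : ℝ} {G₁ G₂ : Measure ℝ}

namespace SquareRepresentation

theorem ae_ge (hS : SquareRepresentation ψ μm μp v β G₁ G₂) :
    (∀ᵐ q ∂G₁, (μp - μm) ^ 2 / 4 ≤ q) ∧ ∀ᵐ q ∂G₂, (μp - μm) ^ 2 / 4 ≤ q := by
  constructor
  · rw [ae_iff]
    convert hS.support₁ using 2
    ext s; simp
  · rw [ae_iff]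
    convert hS.support₂ using 2
    ext s; simp

theorem differentiableOn (hμ : μm < μp) (hS : SquareRepresentation ψ μm μp v β G₁ G₂) :
    DifferentiableOn ℂ (laplaceExponent v G₁ G₂) {z | -((μp - μm) ^ 2 / 4) < z.re} := by
  have hM : 0 < (μp - μm) ^ 2 / 4 := by have := sub_pos.2 hμ; positivity
  refine DifferentiableOn.add (by fun_prop) ?_
  exact (differentiableOn_integral_inv_sub_inv hM hS.ae_ge.1 hS.integrable₁).sub
    (differentiableOn_integral_inv_sub_inv hM hS.ae_ge.2 hS.integrable₂)

theorem subLaplaceExponent_eq (hμ : μm < μp) (hβ : β = -(μm + μp) / 2)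
    (hS : SquareRepresentation ψ μm μp v β G₁ G₂) {q : ℝ} (hq : 0 ≤ q) :
    subLaplaceExponent ψ β q = laplaceExponent v G₁ G₂ q := by
  have hmem : ((√q : ℝ) : ℂ) - Complex.I * β ∈ slitDomain μm μp := by
    rw [mem_slitDomain_shift hβ]
    rintro ⟨-, h⟩
    simp at h
    linarith
  rw [subLaplaceExponent, hS.eq _ hmem, laplaceExponent, ← Complex.ofReal_pow, Real.sq_sqrt hq]

/-- The Lévy measure of `Z` integrates `1 - exp(-zx)` to the jump part of `Ψ(z)`. -/
theorem integral_one_sub_exp (hμ : μm < μp) (hS : SquareRepresentation ψ μm μp v β G₁ G₂)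
    (hLap : ∀ x : ℝ, 0 < x → 0 ≤ laplaceDiff G₁ G₂ x) {z : ℂ} (hz : 0 ≤ z.re) :
    Integrable (fun x : ℝ => 1 - Complex.exp (-(z * x))) (sslLevyMeasure 0 0 G₁ G₂) ∧
    ∫ x : ℝ, (1 - Complex.exp (-(z * x))) ∂(sslLevyMeasure 0 0 G₁ G₂) =
      laplaceExponent v G₁ G₂ z - v / 2 * z := by
  have hM : 0 < (μp - μm) ^ 2 / 4 := by have := sub_pos.2 hμ; positivity
  have hSS := hS.isSSLMeasure hLap
  have := hSS.pos_part.sFinite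
  have := hSS.neg_part.sFinite
  obtain ⟨i1, e1⟩ := integral_one_sub_exp_mul_laplace hM hS.ae_ge.1 hS.integrable₁ hz
  obtain ⟨i2, e2⟩ := integral_one_sub_exp_mul_laplace hM hS.ae_ge.2 hS.integrable₂ hz
  have e : ∀ x : ℝ, (1 - Complex.exp (-(z * x))) * (laplaceDiff G₁ G₂ x : ℂ) =
      (1 - Complex.exp (-(z * x))) * ((∫ t, Real.exp (-(t * x)) ∂G₁ : ℝ) : ℂ) -
      (1 - Complex.exp (-(z * x))) * ((∫ t, Real.exp (-(t * x)) ∂G₂ : ℝ) : ℂ) := fun x => by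
    rw [laplaceDiff]; push_cast; ring
  have h := integrable_withDensity_ofReal (S := Ioi 0) measurableSet_Ioi
    (measurable_laplaceDiff (G₁ := G₁) (G₂ := G₂)) (fun x hx => hLap x hx)
    (g := fun x : ℝ => 1 - Complex.exp (-(z * x)))
  rw [sslLevyMeasure_zero, h.1, h.2]
  simp_rw [e]
  refine ⟨i1.sub i2, ?_⟩
  rw [integral_sub i1 i2, e1, e2, laplaceExponent]
  ring

theorem ae_pos_sslLevyMeasure (G₁ G₂ : Measure ℝ) : ∀ᵐ x ∂(sslLevyMeasure 0 0 G₁ G₂), 0 < x := by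
  rw [ae_iff]
  convert sslLevyMeasure_zero_Iic G₁ G₂ using 2
  ext s; simp

/-- The case z = 1 of the Bernstein representation, since min(x, 1) ≤ 2(1 - e^{-x}). Jumps are
therefore summable and no compensation is needed. -/
theorem integrable_min (hμ : μm < μp) (hS : SquareRepresentation ψ μm μp v β G₁ G₂)
    (hLap : ∀ x : ℝ, 0 < x → 0 ≤ laplaceDiff G₁ G₂ x) :
    Integrable (fun x : ℝ => min x 1) (sslLevyMeasure 0 0 G₁ G₂) := by
  have h := (hS.integral_one_sub_exp hμ hLap (z := 1) (by simp)).1.norm.const_mul 2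
  refine h.mono' (by fun_prop) ?_
  filter_upwards [ae_pos_sslLevyMeasure G₁ G₂] with x hx
  have h1 := min_le_two_mul_one_sub_exp hx
  have h2 : ‖(1 : ℂ) - Complex.exp (-(1 * x))‖ = 1 - Real.exp (-x) := by
    rw [one_mul, show (1 : ℂ) - Complex.exp (-x) = ((1 - Real.exp (-x) : ℝ) : ℂ) by push_cast; rfl,
      Complex.norm_real, Real.norm_of_nonneg]
    linarith [Real.exp_le_one_iff.2 (neg_nonpos.2 hx.le)]
  rw [h2, Real.norm_of_nonneg (le_min hx.le zero_le_one)]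
  exact h1

/-- The Laplace exponent is given on q ≥ 0, but the right-hand side is analytic for Re z < μ.
`landau` extends the equality, together with integrability, across the imaginary axis. -/
theorem complexMGF_eq (hμ : μm < μp) (hβ : β = -(μm + μp) / 2)
    (hS : SquareRepresentation ψ μm μp v β G₁ G₂) {Ω₁ : Type*} [MeasurableSpace Ω₁]
    {P₁ : Measure Ω₁} [IsProbabilityMeasure P₁] {Z : ℝ≥0 → Ω₁ → ℝ≥0} (hZ : IsSubordinator Z P₁)
    (hL : HasLaplaceExponent Z P₁ (subLaplaceExponent ψ β)) (t : ℝ≥0) :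
    (∀ a < (μp - μm) ^ 2 / 4, Integrable (fun ω => Real.exp (a * (Z t ω : ℝ))) P₁) ∧
      ∀ z : ℂ, z.re < (μp - μm) ^ 2 / 4 → complexMGF (fun ω => (Z t ω : ℝ)) P₁ z =
        Complex.exp (-((t : ℝ) * laplaceExponent v G₁ G₂ (-z))) := by
  have hM : 0 < (μp - μm) ^ 2 / 4 := by have := sub_pos.2 hμ; positivity
  refine landau (F := fun z => Complex.exp (-((t : ℝ) * laplaceExponent v G₁ G₂ (-z))))
    (hZ.measurable t) (Eventually.of_forall fun ω => (Z t ω).2) hM ?_ ?_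
  · have h1 : DifferentiableOn ℂ (fun z => laplaceExponent v G₁ G₂ (-z))
        {z | z.re < (μp - μm) ^ 2 / 4} :=
      (hS.differentiableOn hμ).comp (by fun_prop) fun z (hz : z.re < _) => by
        simp only [mem_ofPred_eq, Complex.neg_re]; linarith
    fun_prop
  · intro q hq
    rw [hL t q hq, hS.subLaplaceExponent_eq hμ hβ hq, neg_neg]

theorem isSSLPlusProcess (hμ : μm < μp) (hβ : β = -(μm + μp) / 2)
    (hS : SquareRepresentation ψ μm μp v β G₁ G₂)
    (hLap : ∀ x : ℝ, 0 < x → 0 ≤ laplaceDiff G₁ G₂ x) {Ω₁ : Type*} [MeasurableSpace Ω₁]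
    {P₁ : Measure Ω₁} [IsProbabilityMeasure P₁] {Z : ℝ≥0 → Ω₁ → ℝ≥0} (hZ : IsSubordinator Z P₁)
    (hL : HasLaplaceExponent Z P₁ (subLaplaceExponent ψ β)) :
    IsSSLPlusProcess (fun t ω => (Z t ω : ℝ)) P₁ ((μp - μm) ^ 2 / 4) G₁ G₂ := by
  have hM : 0 < (μp - μm) ^ 2 / 4 := by have := sub_pos.2 hμ; positivity
  have hpos := ae_pos_sslLevyMeasure G₁ G₂
  have hmin := hS.integrable_min hμ hLap
  -- The genuine drift is v/2; the integral of the small jumps undoes the truncation in the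
  -- Lévy–Khintchine formula.
  refine ⟨hS.isSSLMeasure hLap, v / 2 + ∫ x, (Ioo (-1 : ℝ) 1).indicator (fun x => x) x
    ∂(sslLevyMeasure 0 0 G₁ G₂), hZ, le_rfl, ?_, ?_, ?_⟩
  · exact measure_mono_null (by simp) (sslLevyMeasure_zero_Iic G₁ G₂)
  · refine lt_of_le_of_lt (lintegral_mono_ae ?_) hmin.lintegral_lt_top
    filter_upwards [hpos] with x hx
    refine ENNReal.ofReal_le_ofReal ?_
    rcases le_total x 1 with h | h
    · rw [min_eq_left h]
      exact (min_le_left _ _).trans (by nlinarith)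
    · rw [min_eq_right h]
      exact min_le_right _ _
  · intro t ξ
    have h1 := (hS.complexMGF_eq hμ hβ hZ hL t).2 (Complex.I * ξ) (by simpa using hM)
    rw [complexMGF] at h1
    rw [h1]
    have hz : (0 : ℝ) ≤ (-(Complex.I * (ξ : ℂ))).re := by simp
    obtain ⟨i1, e1⟩ := hS.integral_one_sub_exp hμ hLap hz
    have hind : Integrable (fun x => (Ioo (-1 : ℝ) 1).indicator (fun x => x) x)
        (sslLevyMeasure 0 0 G₁ G₂) := by
      refine hmin.mono' (measurable_id.indicator measurableSet_Ioo).aestronglyMeasurable ?_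
      filter_upwards [hpos] with x hx
      by_cases h : x ∈ Ioo (-1 : ℝ) 1
      · rw [indicator_of_mem h, Real.norm_of_nonneg hx.le, min_eq_left h.2.le]
      · rw [indicator_of_notMem h, norm_zero]
        exact le_min hx.le zero_le_one
    have e2 : ∀ x : ℝ, 1 - Complex.exp (Complex.I * x * ξ) +
        (Ioo (-1 : ℝ) 1).indicator (fun _ => (1 : ℂ)) x * (Complex.I * x * ξ) =
        (1 - Complex.exp (-(-(Complex.I * ξ) * x))) +
          Complex.I * ξ * (((Ioo (-1 : ℝ) 1).indicator (fun x => x) x : ℝ) : ℂ) := fun x => by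
      rw [show -(-(Complex.I * ξ) * (x : ℂ)) = Complex.I * x * ξ by ring]
      by_cases h : x ∈ Ioo (-1 : ℝ) 1
      · rw [indicator_of_mem h, indicator_of_mem h]; ring
      · rw [indicator_of_notMem h, indicator_of_notMem h]; simp
    congr 2
    congr 1
    rw [levyKhintchine]
    simp_rw [e2]
    have hind' : Integrable (fun x : ℝ => Complex.I * ξ *
        (((Ioo (-1 : ℝ) 1).indicator (fun x => x) x : ℝ) : ℂ)) (sslLevyMeasure 0 0 G₁ G₂) :=
      hind.ofReal.const_mul _
    rw [integral_add i1 hind', e1, integral_const_mul, integral_complex_ofReal]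
    push_cast
    ring

end SquareRepresentation

end

/-! ### Gaussian mixtures -/

theorem cexp_gaussianReal (w : ℂ) :
    Integrable (fun x : ℝ => Complex.exp (w * x)) (gaussianReal 0 1) ∧
    ∫ x : ℝ, Complex.exp (w * x) ∂gaussianReal 0 1 = Complex.exp (w ^ 2 / 2) := by
  constructor
  · have h := integrable_exp_mul_gaussianReal (μ := 0) (v := 1) w.re
    refine h.mono' (Measurable.aestronglyMeasurable (by fun_prop)) ?_
    filter_upwards with x
    rw [Complex.norm_exp]
    simp
  · have := complexMGF_id_gaussianReal (μ := 0) (v := 1) w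
    rw [complexMGF] at this
    simpa using this

/-- The law of `√(2Z) g` for a standard Gaussian `g` independent of `Z`. -/
def gaussianMixture {Ω₁ : Type*} [MeasurableSpace Ω₁] (P₁ : Measure Ω₁) (Z : Ω₁ → ℝ≥0) :
    Measure ℝ :=
  (P₁.prod (gaussianReal 0 1)).map fun p : Ω₁ × ℝ => √(2 * Z p.1) * p.2

/-- Given Z, the Gaussian integral of exp(w√(2Z) g) is exp(w²Z). In modulus only Re w counts, so
integrability reduces to the exponential moment of Z at (Re w)². -/
theorem integral_cexp_gaussianMixture {Ω₁ : Type*} [MeasurableSpace Ω₁] {P₁ : Measure Ω₁}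
    [IsProbabilityMeasure P₁] {Z : Ω₁ → ℝ≥0} (hZ : Measurable Z) {w : ℂ}
    (hi : Integrable (fun ω => Real.exp (w.re ^ 2 * (Z ω : ℝ))) P₁) :
    Integrable (fun y : ℝ => Complex.exp (w * y)) (gaussianMixture P₁ Z) ∧
    ∫ y : ℝ, Complex.exp (w * y) ∂gaussianMixture P₁ Z =
      complexMGF (fun ω => (Z ω : ℝ)) P₁ (w ^ 2) := by
  have hmeas : Measurable fun p : Ω₁ × ℝ => √(2 * Z p.1) * p.2 := by fun_prop
  have e : ∀ (ω : Ω₁) (x : ℝ), Complex.exp (w * ((√(2 * Z ω) * x : ℝ) : ℂ)) =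
      Complex.exp (w * (√(2 * Z ω) : ℝ) * x) := fun ω x => by push_cast; ring_nf
  have hsq : ∀ ω, (√(2 * Z ω : ℝ)) ^ 2 = 2 * Z ω := fun ω => Real.sq_sqrt (by positivity)
  have hsqc : ∀ (w : ℂ) ω, (w * (√(2 * Z ω : ℝ) : ℝ)) ^ 2 / 2 = w ^ 2 * ((Z ω : ℝ) : ℂ) :=
    fun w ω => by
      rw [mul_pow, ← Complex.ofReal_pow, hsq]; push_cast; ring
  have hint : Integrable (fun p : Ω₁ × ℝ => Complex.exp (w * ((√(2 * Z p.1) * p.2 : ℝ) : ℂ)))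
      (P₁.prod (gaussianReal 0 1)) := by
    rw [integrable_prod_iff (Measurable.aestronglyMeasurable (by fun_prop))]
    constructor
    · filter_upwards with ω
      simp_rw [e]
      exact (cexp_gaussianReal _).1
    · refine hi.congr (Eventually.of_forall fun ω => ?_)
      have e2 : ∀ x : ℝ, ((‖Complex.exp (w * ((√(2 * Z ω) * x : ℝ) : ℂ))‖ : ℝ) : ℂ) =
          Complex.exp ((w.re : ℂ) * (√(2 * Z ω) : ℝ) * x) := fun x => by
        rw [Complex.norm_exp, Complex.ofReal_exp]
        congr 1
        simp only [Complex.mul_re, Complex.ofReal_re, Complex.ofReal_im, mul_zero, sub_zero]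
        push_cast
        ring
      apply Complex.ofReal_injective
      dsimp only
      rw [← integral_complex_ofReal]
      simp_rw [e2]
      rw [(cexp_gaussianReal _).2, hsqc]
      push_cast; rfl
  have hsm : Measurable fun y : ℝ => Complex.exp (w * y) := by fun_prop
  rw [gaussianMixture, integrable_map_measure hsm.aestronglyMeasurable hmeas.aemeasurable,
    integral_map hmeas.aemeasurable hsm.aestronglyMeasurable]
  refine ⟨hint, ?_⟩
  rw [integral_prod _ hint, complexMGF]
  refine integral_congr_ae (Eventually.of_forall fun ω => ?_)
  dsimp only
  simp_rw [e]
  rw [(cexp_gaussianReal _).2, hsqc]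

/-! ### Measures with proportional characteristic functions -/

/-- Fatou's lemma along θ = 1 - 1/(n + 1). -/
theorem integrable_exp_of_bound {ρ : Measure ℝ} {β K : ℝ}
    (h : ∀ θ : ℝ, 0 ≤ θ → θ < 1 → Integrable (fun y => Real.exp (θ * β * y)) ρ ∧
      ∫ y, Real.exp (θ * β * y) ∂ρ ≤ K) :
    Integrable (fun y => Real.exp (β * y)) ρ := by
  refine ⟨by fun_prop, ?_⟩
  rw [hasFiniteIntegral_iff_ofReal (Eventually.of_forall fun y => (Real.exp_pos _).le)]
  have hθ : Tendsto (fun n : ℕ => 1 - 1 / ((n : ℝ) + 1)) atTop (𝓝 1) := by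
    have := tendsto_one_div_add_atTop_nhds_zero_nat (𝕜 := ℝ) |>.const_sub 1
    simpa using this
  have hθ1 : ∀ n : ℕ, 0 ≤ 1 - 1 / ((n : ℝ) + 1) ∧ 1 - 1 / ((n : ℝ) + 1) < 1 := fun n => by
    have h1 : 1 / ((n : ℝ) + 1) ≤ 1 := by
      rw [div_le_one (by positivity)]; linarith [n.cast_nonneg (α := ℝ)]
    have h2 : 0 < 1 / ((n : ℝ) + 1) := by positivity
    constructor <;> linarith
  have hlim : ∀ y : ℝ, liminf (fun n : ℕ =>
      ENNReal.ofReal (Real.exp ((1 - 1 / ((n : ℝ) + 1)) * β * y))) atTop =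
      ENNReal.ofReal (Real.exp (β * y)) := fun y => by
    refine Tendsto.liminf_eq ?_
    refine (ENNReal.continuous_ofReal.tendsto _).comp ((Real.continuous_exp.tendsto _).comp ?_)
    have := (hθ.mul_const β).mul_const y
    simpa using this
  calc ∫⁻ y, ENNReal.ofReal (Real.exp (β * y)) ∂ρ
      = ∫⁻ y, liminf (fun n : ℕ =>
          ENNReal.ofReal (Real.exp ((1 - 1 / ((n : ℝ) + 1)) * β * y))) atTop ∂ρ := by
        simp_rw [hlim]
    _ ≤ liminf (fun n : ℕ => ∫⁻ y,
          ENNReal.ofReal (Real.exp ((1 - 1 / ((n : ℝ) + 1)) * β * y)) ∂ρ) atTop :=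
        lintegral_liminf_le fun n => by fun_prop
    _ ≤ ENNReal.ofReal K := by
        refine liminf_le_of_frequently_le' (Frequently.of_forall fun n => ?_)
        obtain ⟨h1, h2⟩ := h _ (hθ1 n).1 (hθ1 n).2
        rw [← ofReal_integral_eq_lintegral_ofReal h1
          (Eventually.of_forall fun y => (Real.exp_pos _).le)]
        exact ENNReal.ofReal_le_ofReal h2
    _ < ∞ := ENNReal.ofReal_lt_top

theorem cexp_withDensity_exp {ρ : Measure ℝ} (β : ℝ) (w : ℂ) :
    (Integrable (fun y : ℝ => Complex.exp (w * y))
      (ρ.withDensity fun y => ENNReal.ofReal (Real.exp (β * y))) ↔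
      Integrable (fun y : ℝ => Complex.exp ((w + β) * y)) ρ) ∧
    ∫ y : ℝ, Complex.exp (w * y) ∂(ρ.withDensity fun y => ENNReal.ofReal (Real.exp (β * y))) =
      ∫ y : ℝ, Complex.exp ((w + β) * y) ∂ρ := by
  have e : ∀ y : ℝ, (ENNReal.ofReal (Real.exp (β * y))).toReal • Complex.exp (w * y) =
      Complex.exp ((w + β) * y) := fun y => by
    rw [ENNReal.toReal_ofReal (Real.exp_pos _).le, Complex.real_smul, add_mul, Complex.exp_add,
      Complex.ofReal_exp]
    push_cast; ring
  rw [integrable_withDensity_iff_integrable_smul' (by fun_prop) (by simp),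
    integral_withDensity_eq_integral_toReal_smul (by fun_prop) (by simp)]
  simp_rw [e]
  exact ⟨trivial, trivial⟩

/-- If `exp(-βy) ρ(dy)` and the probability measure `η` have proportional characteristic functions
off `0`, then `exp(βy) η(dy)` is finite and proportional to `ρ`. -/
theorem integral_cexp_of_charFun_eq {ρ η : Measure ℝ} [IsProbabilityMeasure ρ]
    [IsProbabilityMeasure η] {β : ℝ} (hi : Integrable (fun y => Real.exp (-β * y)) ρ) {κ : ℂ}
    (h : ∀ ξ : ℝ, ξ ≠ 0 → ∫ y : ℝ, Complex.exp ((Complex.I * ξ - β) * y) ∂ρ = κ * charFun η ξ) :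
    Integrable (fun y => Real.exp (β * y)) η ∧
    ∀ ξ : ℝ, ∫ y : ℝ, Complex.exp ((β + Complex.I * ξ) * y) ∂η =
      ((∫ y, Real.exp (β * y) ∂η : ℝ) : ℂ) * charFun ρ ξ := by
  obtain ⟨ρ', hρ'⟩ : ∃ ρ', ρ' = ρ.withDensity fun y => ENNReal.ofReal (Real.exp (-β * y)) :=
    ⟨_, rfl⟩
  have hcf : ∀ (σ : Measure ℝ) (ξ : ℝ), charFun σ ξ = ∫ y : ℝ, Complex.exp (Complex.I * ξ * y) ∂σ :=
    fun σ ξ => by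
      rw [charFun_apply_real]; congr 1; ext y; ring_nf
  have hfin : IsFiniteMeasure ρ' := hρ' ▸ isFiniteMeasure_withDensity_ofReal hi.2
  have hne0 : ρ' ≠ 0 := fun h0 => by
    have h1 : ρ {y | ENNReal.ofReal (Real.exp (-β * y)) ≠ 0} = 0 := by
      have := (withDensity_apply_eq_zero' (μ := ρ) (s := univ)
        (f := fun y => ENNReal.ofReal (Real.exp (-β * y))) (by fun_prop)).1 (by rw [← hρ', h0]; rfl)
      simpa using this
    have h2 : {y : ℝ | ENNReal.ofReal (Real.exp (-β * y)) ≠ 0} = univ := by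
      ext y; simp [Real.exp_pos]
    rw [h2, measure_univ] at h1
    exact one_ne_zero h1
  have hρc : ∀ ξ : ℝ, charFun ρ' ξ = ∫ y : ℝ, Complex.exp ((Complex.I * ξ - β) * y) ∂ρ := fun ξ => by
    rw [hcf, hρ', (cexp_withDensity_exp (-β) _).2]
    congr 1; ext y; push_cast; ring_nf
  -- Both sides are continuous, so agreement off 0 extends to 0; the value there identifies κ as the
  -- total mass of the tilted measure.
  have hall : charFun ρ' = fun ξ => κ * charFun η ξ := by
    refine Continuous.ext_on (dense_compl_singleton (0 : ℝ)) continuous_charFun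
      (continuous_const.mul continuous_charFun) fun ξ hξ => ?_
    exact (hρc ξ).trans (h ξ hξ)
  have hκ : κ = (ρ'.real univ : ℂ) := by
    have := congrFun hall 0
    simpa [charFun_zero] using this.symm
  obtain ⟨k, hk⟩ : ∃ k : ℝ≥0, k = (ρ' univ).toNNReal := ⟨_, rfl⟩
  have hk0 : k ≠ 0 := by
    rw [hk, Ne, ENNReal.toNNReal_eq_zero_iff, not_or]
    exact ⟨by simpa using hne0, measure_ne_top _ _⟩
  have hkκ : κ = ((k : ℝ) : ℂ) := by rw [hκ, hk]; rfl
  -- Uniqueness of characteristic functions gives e^{-βy}ρ(dy) = k η(dy); multiplying by e^{βy} then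
  -- exhibits ρ as a multiple of the tilted η.
  have hmeq : ρ' = k • η := by
    refine Measure.ext_of_charFun ?_
    rw [hall]
    ext ξ
    rw [hcf, hcf, integral_smul_nnreal_measure, hkκ]
    simp [NNReal.smul_def]
  have hI : ∀ ξ : ℝ, Integrable (fun y : ℝ => Complex.exp ((β + Complex.I * ξ) * y)) η ∧
      (k : ℂ) * ∫ y : ℝ, Complex.exp ((β + Complex.I * ξ) * y) ∂η = charFun ρ ξ := by
    intro ξ
    obtain ⟨c1, c2⟩ := cexp_withDensity_exp (ρ := ρ) (-β) (β + Complex.I * ξ)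
    rw [← hρ', hmeq] at c1 c2
    have e : ∀ y : ℝ, Complex.exp ((β + Complex.I * ξ + ((-β : ℝ) : ℂ)) * y) =
        Complex.exp (Complex.I * ξ * y) := fun y => by push_cast; ring_nf
    simp_rw [e] at c1 c2
    constructor
    · have h1 : Integrable (fun y : ℝ => Complex.exp ((β + Complex.I * ξ) * y)) (k • η) := by
        refine c1.2 ((integrable_const (1 : ℝ)).mono' (by fun_prop) ?_)
        filter_upwards with y
        rw [Complex.norm_exp]
        simp
      exact (integrable_smul_measure (c := (k : ℝ≥0∞)) (by simpa using hk0) (by simp)).1 h1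
    · rw [hcf, ← c2, integral_smul_nnreal_measure]
      simp [NNReal.smul_def]
  have h0 := hI 0
  simp only [Complex.ofReal_zero, mul_zero, add_zero, charFun_zero, probReal_univ,
    Complex.ofReal_one] at h0
  have e0 : ∀ y : ℝ, Complex.exp (β * y) = ((Real.exp (β * y) : ℝ) : ℂ) := fun y => by push_cast; rfl
  have hkc : (k : ℂ) ≠ 0 := by exact_mod_cast hk0
  refine ⟨?_, fun ξ => ?_⟩
  · have := h0.1.re
    refine this.congr (Eventually.of_forall fun y => ?_)
    simp only [e0]
    exact Complex.ofReal_re _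
  · have h1 := h0.2
    simp_rw [e0] at h1
    rw [integral_complex_ofReal] at h1
    rw [← (hI ξ).2, ← mul_assoc, mul_comm _ (k : ℂ), h1, one_mul]

/-! ### Exponential moments under the Esscher transform -/

/-- X_t is compared with the Gaussian mixture ρ, the law of √2 W(Z_t). Neither E[e^{βX_t}] < ∞ nor
the ρ-integrability of e^{-βy} is assumed: the second is proved first, and the first follows from
the proportionality of the two laws. -/
theorem SquareRepresentation.integral_cexp_esscher {Ω : Type*} [MeasurableSpace Ω] {P : Measure Ω}
    [IsProbabilityMeasure P] {X : ℝ≥0 → Ω → ℝ} {ψ : ℂ → ℂ} {μm μp v b β : ℝ} {F G₁ G₂ : Measure ℝ}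
    (hμm : μm ≤ 0) (hμp : 0 ≤ μp) (hμ : μm < μp) (hX : HasLevyTriplet X P v b F)
    (hF : IsSSLLevyMeasure μm μp F) (hψ : HasCharExponent X P ψ)
    (han : AnalyticOnNhd ℂ ψ (slitDomain μm μp)) (hβ : β = -(μm + μp) / 2)
    (hS : SquareRepresentation ψ μm μp v β G₁ G₂)
    {Ω₁ : Type*} [MeasurableSpace Ω₁] {P₁ : Measure Ω₁} [IsProbabilityMeasure P₁]
    {Z : ℝ≥0 → Ω₁ → ℝ≥0} (hZ : IsSubordinator Z P₁)
    (hL : HasLaplaceExponent Z P₁ (subLaplaceExponent ψ β)) (t : ℝ≥0) :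
    Integrable (fun ω => Real.exp (β * X t ω)) P ∧
    ∀ ξ : ℝ, ∫ ω, Complex.exp ((β + Complex.I * ξ) * X t ω) ∂P =
      ((∫ ω, Real.exp (β * X t ω) ∂P : ℝ) : ℂ) *
        Complex.exp (-((t : ℝ) * laplaceExponent v G₁ G₂ ((ξ ^ 2 : ℝ) : ℂ))) := by
  have hZm : Measurable (Z t) := by
    have := (hZ.measurable t).real_toNNReal
    simpa using this
  have hXm := hX.isLevy.measurable t
  have hM : 0 < (μp - μm) ^ 2 / 4 := by have := sub_pos.2 hμ; positivity
  have hm : 0 < (μp - μm) / 2 := by linarith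
  have hβm : |β| ≤ (μp - μm) / 2 := by rw [abs_le]; constructor <;> linarith
  obtain ⟨hexp, hmgf⟩ := hS.complexMGF_eq hμ hβ hZ hL t
  obtain ⟨ρ, hρ⟩ : ∃ ρ, ρ = gaussianMixture P₁ (Z t) := ⟨_, rfl⟩
  have : IsProbabilityMeasure ρ := by
    rw [hρ, gaussianMixture]
    exact Measure.isProbabilityMeasure_map (by fun_prop)
  have hw : ∀ w : ℂ, w.re ^ 2 < (μp - μm) ^ 2 / 4 →
      Integrable (fun y : ℝ => Complex.exp (w * y)) ρ ∧ ∫ y : ℝ, Complex.exp (w * y) ∂ρ =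
        Complex.exp (-((t : ℝ) * laplaceExponent v G₁ G₂ (-w ^ 2))) := by
    intro w hwre
    obtain ⟨h1, h2⟩ := integral_cexp_gaussianMixture hZm (w := w) (hexp _ hwre)
    rw [← hρ] at h1 h2
    refine ⟨h1, h2.trans (hmgf _ ?_)⟩
    rw [sq, Complex.mul_re]
    nlinarith [mul_self_nonneg w.im]
  -- The inequality is strict only for θ < 1: |β| equals the half-gap when μ₋ = 0 or μ₊ = 0.
  have hθm : ∀ θ : ℝ, 0 ≤ θ → θ < 1 → |θ * β| < (μp - μm) / 2 := fun θ h0 h1 => by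
    rw [abs_mul, abs_of_nonneg h0]
    rcases eq_or_ne β 0 with h | h
    · simpa [h] using hm
    · nlinarith [abs_pos.2 h]
  have hθM : ∀ θ : ℝ, 0 ≤ θ → θ < 1 → (θ * β) ^ 2 < (μp - μm) ^ 2 / 4 := fun θ h0 h1 => by
    have := hθm θ h0 h1
    rw [← sq_abs (θ * β)]
    nlinarith [abs_nonneg (θ * β)]
  have hθψ : ∀ θ : ℝ, 0 ≤ θ → θ < 1 → ∀ ξ : ℝ,
      ((ξ : ℂ) - Complex.I * (((1 - θ) * β : ℝ) : ℂ)) ∈ slitDomain μm μp ∧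
      Integrable (fun y : ℝ => Complex.exp ((Complex.I * ξ - (θ * β : ℝ)) * y)) ρ ∧
      ∫ y : ℝ, Complex.exp ((Complex.I * ξ - (θ * β : ℝ)) * y) ∂ρ =
        Complex.exp (-((t : ℝ) * (ψ (ξ - Complex.I * (((1 - θ) * β : ℝ) : ℂ)) -
          ψ (-(Complex.I * β))))) := by
    intro θ h0 h1 ξ
    have hmem : (ξ : ℂ) + Complex.I * ((θ * β : ℝ) : ℂ) - Complex.I * β ∈ slitDomain μm μp := by
      rw [mem_slitDomain_shift hβ]
      rintro ⟨-, h⟩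
      simp only [Complex.add_im, Complex.ofReal_im, Complex.mul_im, Complex.I_re, Complex.I_im,
        Complex.ofReal_re, zero_mul, one_mul, zero_add] at h
      linarith [hθm θ h0 h1]
    have e1 : (ξ : ℂ) + Complex.I * ((θ * β : ℝ) : ℂ) - Complex.I * β =
        ξ - Complex.I * (((1 - θ) * β : ℝ) : ℂ) := by push_cast; ring
    obtain ⟨i1, i2⟩ := hw (Complex.I * ξ - (θ * β : ℝ)) (by
      have := hθM θ h0 h1
      simp only [Complex.sub_re, Complex.mul_re, Complex.I_re, Complex.I_im, Complex.ofReal_re,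
        Complex.ofReal_im, zero_mul, sub_zero, mul_zero, zero_sub]
      linarith [neg_sq (θ * β)])
    refine ⟨e1 ▸ hmem, i1, ?_⟩
    have e2 : -(Complex.I * ξ - ((θ * β : ℝ) : ℂ)) ^ 2 =
        ((ξ : ℂ) + Complex.I * ((θ * β : ℝ) : ℂ)) ^ 2 := by
      push_cast
      linear_combination (-(ξ : ℂ) ^ 2 - (θ * β) ^ 2) * Complex.I_sq
    rw [i2, e2, ← e1, hS.eq _ hmem, laplaceExponent]
  obtain ⟨Gm₁, Gm₂, Gp₁, Gp₂, hGm, hGp, c, hrep⟩ := charExponent_eq hμm hμp hμ hX hF hψ han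
  obtain ⟨C, hC⟩ := exists_bound_charExponent_segment hμm hμp hβ hGm hGp hrep
  -- At ξ = 0 the moments for θ < 1 are governed by ψ(-i(1 - θ)β), which the segment bound controls
  -- uniformly.
  have hint : Integrable (fun y => Real.exp (-β * y)) ρ := by
    refine integrable_exp_of_bound
      (K := Real.exp ((t : ℝ) * (C + ‖ψ (-(Complex.I * β))‖))) fun θ h0 h1 => ?_
    obtain ⟨m1, m2, m3⟩ := hθψ θ h0 h1 0
    have e3 : ∀ y : ℝ, Complex.exp ((Complex.I * ((0 : ℝ) : ℂ) - (θ * β : ℝ)) * y) =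
        ((Real.exp (θ * -β * y) : ℝ) : ℂ) := fun y => by push_cast; ring_nf
    simp_rw [e3] at m2 m3
    rw [integral_complex_ofReal] at m3
    refine ⟨?_, ?_⟩
    · exact m2.re.congr (Eventually.of_forall fun y => Complex.ofReal_re _)
    · have h2 := congrArg norm m3
      rw [Complex.norm_real, Complex.norm_exp] at h2
      refine (le_abs_self _).trans (h2.le.trans (Real.exp_le_exp.2 ?_))
      have e4 : ((0 : ℝ) : ℂ) - Complex.I * (((1 - θ) * β : ℝ) : ℂ) =
          -(Complex.I * (((1 - θ) * β : ℝ) : ℂ)) := by simp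
      rw [e4] at m1 ⊢
      have hC' := hC (1 - θ) (by linarith) (by linarith) m1
      refine (Complex.re_le_norm _).trans ?_
      rw [norm_neg, norm_mul, Complex.norm_real, Real.norm_of_nonneg t.coe_nonneg]
      exact mul_le_mul_of_nonneg_left ((norm_sub_le _ _).trans (by linarith)) t.2
  have hθlim : Tendsto (fun n : ℕ => 1 - 1 / ((n : ℝ) + 1)) atTop (𝓝 1) := by
    have := tendsto_one_div_add_atTop_nhds_zero_nat (𝕜 := ℝ) |>.const_sub 1
    simpa using this
  have hθ1 : ∀ n : ℕ, 0 ≤ 1 - 1 / ((n : ℝ) + 1) ∧ 1 - 1 / ((n : ℝ) + 1) < 1 := fun n => by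
    have h1 : 1 / ((n : ℝ) + 1) ≤ 1 := by
      rw [div_le_one (by positivity)]; linarith [n.cast_nonneg (α := ℝ)]
    have h2 : 0 < 1 / ((n : ℝ) + 1) := by positivity
    constructor <;> linarith
  have hmap : IsProbabilityMeasure (P.map (X t)) := Measure.isProbabilityMeasure_map hXm.aemeasurable
  have hcfX : ∀ ξ : ℝ, charFun (P.map (X t)) ξ = Complex.exp (-((t : ℝ) * ψ ξ)) := fun ξ => by
    rw [charFun_apply_real, integral_map hXm.aemeasurable
      (Measurable.aestronglyMeasurable (by fun_prop)), ← hψ t ξ]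
    congr 1; ext ω; ring_nf
  -- Limit θ → 1 at fixed ξ: the left side is dominated by 1 + e^{-βy}, the right side converges
  -- because ψ is continuous at real ξ ≠ 0.
  have hcf : ∀ ξ : ℝ, ξ ≠ 0 → ∫ y : ℝ, Complex.exp ((Complex.I * ξ - β) * y) ∂ρ =
      Complex.exp ((t : ℝ) * ψ (-(Complex.I * β))) * charFun (P.map (X t)) ξ := by
    intro ξ hξ
    have t1 : Tendsto (fun n : ℕ => ∫ y : ℝ, Complex.exp ((Complex.I * ξ -
        ((1 - 1 / ((n : ℝ) + 1)) * β : ℝ)) * y) ∂ρ) atTop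
        (𝓝 (∫ y : ℝ, Complex.exp ((Complex.I * ξ - β) * y) ∂ρ)) := by
      refine tendsto_integral_of_dominated_convergence (fun y => 1 + Real.exp (-β * y))
        (fun n => Measurable.aestronglyMeasurable (by fun_prop)) ((integrable_const _).add hint) ?_ ?_
      · intro n
        filter_upwards with y
        rw [Complex.norm_exp]
        have : ((Complex.I * ξ - ((1 - 1 / ((n : ℝ) + 1)) * β : ℝ)) * (y : ℂ)).re =
            (1 - 1 / ((n : ℝ) + 1)) * (-β * y) := by
          simp only [Complex.mul_re, Complex.sub_re, Complex.I_re, Complex.I_im, Complex.ofReal_re,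
            Complex.ofReal_im, zero_mul, mul_zero, sub_zero, zero_sub]
          ring
        rw [this]
        rcases le_total (-β * y) 0 with h | h
        · have h1 : Real.exp ((1 - 1 / ((n : ℝ) + 1)) * (-β * y)) ≤ 1 :=
            Real.exp_le_one_iff.2 (mul_nonpos_of_nonneg_of_nonpos (hθ1 n).1 h)
          linarith [Real.exp_pos (-β * y)]
        · have h1 : Real.exp ((1 - 1 / ((n : ℝ) + 1)) * (-β * y)) ≤ Real.exp (-β * y) :=
            Real.exp_le_exp.2 (mul_le_of_le_one_left h (hθ1 n).2.le)
          linarith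
      · filter_upwards with y
        refine (Complex.continuous_exp.tendsto _).comp ?_
        have h1 : Tendsto (fun n : ℕ => (1 - 1 / ((n : ℝ) + 1)) * β) atTop (𝓝 β) := by
          simpa using hθlim.mul_const β
        exact (((Complex.continuous_ofReal.tendsto _).comp h1).const_sub _).mul_const _
    have t2 : Tendsto (fun n : ℕ => Complex.exp (-((t : ℝ) * (ψ (ξ - Complex.I *
        (((1 - (1 - 1 / ((n : ℝ) + 1))) * β : ℝ) : ℂ)) - ψ (-(Complex.I * β)))))) atTop
        (𝓝 (Complex.exp (-((t : ℝ) * (ψ ξ - ψ (-(Complex.I * β))))))) := by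
      refine (Complex.continuous_exp.tendsto _).comp (Tendsto.neg (Tendsto.const_mul _
        (Tendsto.sub_const ?_ _)))
      refine ((han _ (ofReal_mem_slitDomain hξ)).continuousAt.tendsto).comp ?_
      have h1 : Tendsto (fun n : ℕ => (1 - (1 - 1 / ((n : ℝ) + 1))) * β) atTop (𝓝 0) := by
        simpa using (hθlim.const_sub 1).mul_const β
      have h2 := (((Complex.continuous_ofReal.tendsto _).comp h1).const_mul Complex.I).const_sub
        (ξ : ℂ)
      simpa using h2
    have t3 := tendsto_nhds_unique t1 (t2.congr fun n =>
      ((hθψ _ (hθ1 n).1 (hθ1 n).2 ξ).2.2).symm)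
    rw [t3, hcfX, ← Complex.exp_add]
    congr 1; ring
  obtain ⟨r1, r2⟩ := integral_cexp_of_charFun_eq hint hcf
  have hexpm : Measurable fun y : ℝ => Real.exp (β * y) := by fun_prop
  rw [integrable_map_measure hexpm.aestronglyMeasurable hXm.aemeasurable] at r1
  rw [integral_map hXm.aemeasurable hexpm.aestronglyMeasurable] at r2
  refine ⟨r1, fun ξ => ?_⟩
  have h3 := r2 ξ
  rw [integral_map hXm.aemeasurable (Measurable.aestronglyMeasurable (by fun_prop))] at h3
  rw [h3]
  congr 1
  have h4 := (hw (Complex.I * ξ) (by simpa using hM)).2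
  rw [charFun_apply_real]
  have e5 : -(Complex.I * (ξ : ℂ)) ^ 2 = ((ξ ^ 2 : ℝ) : ℂ) := by
    push_cast
    rw [mul_pow, Complex.I_sq]; ring
  rw [e5] at h4
  rw [← h4]
  congr 1; ext y; ring_nf

/-! ### Poisson random measures -/

section

variable {E : Type*}

/-- The sum of `g` over the points of a finite configuration `(N, p₀, p₁, …)` of `N` points. -/
def pointSum {M : Type*} [AddCommMonoid M] (g : E → M) (x : ℕ × (ℕ → E)) : M :=
  ∑ i ∈ Finset.range x.1, g (x.2 i)

theorem norm_cexp_pointSum_le {h : E → ℂ} (h0 : ∀ y, (h y).re ≤ 0) (x : ℕ × (ℕ → E)) :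
    ‖Complex.exp (pointSum h x)‖ ≤ 1 := by
  rw [Complex.norm_exp, pointSum, Complex.re_sum]
  exact Real.exp_le_one_iff.2 (Finset.sum_nonpos fun i _ => h0 _)

/-- A summable sequence is eventually below 1, and in a block whose truncated sum is below 1 no
point is truncated; hence only finitely many blocks differ. -/
theorem summable_of_summable_pointSum_min {g : E → ℝ} (hg : ∀ y, 0 ≤ g y)
    {ω : ℕ → ℕ × (ℕ → E)} (h : Summable fun n => pointSum (fun y => min (g y) 1) (ω n)) :
    Summable fun n => pointSum g (ω n) := by
  have h1 := h.tendsto_atTop_zero.eventually_lt_const one_pos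
  rw [← Nat.cofinite_eq_atTop] at h1
  refine h.congr_cofinite (h1.mono fun n hn => ?_)
  refine Finset.sum_congr rfl fun i hi => ?_
  have h2 : min (g ((ω n).2 i)) 1 ≤ pointSum (fun y => min (g y) 1) (ω n) :=
    Finset.single_le_sum (f := fun i => min (g ((ω n).2 i)) 1)
      (fun j _ => le_min (hg _) zero_le_one) hi
  have h3 : min (g ((ω n).2 i)) 1 < 1 := h2.trans_lt hn
  rcases le_total (g ((ω n).2 i)) 1 with h4 | h4
  · exact min_eq_left h4
  · rw [min_eq_right h4] at h3
    exact absurd h3 (lt_irrefl _)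

variable [MeasurableSpace E]

theorem integral_prod_range_infinitePi {B : Type*} [MeasurableSpace B] (μ : ℕ → Measure B)
    [∀ n, IsProbabilityMeasure (μ n)] {f : ℕ → B → ℂ} (hf : ∀ n, Measurable (f n)) (n : ℕ) :
    ∫ x, ∏ i ∈ Finset.range n, f i (x i) ∂Measure.infinitePi μ =
      ∏ i ∈ Finset.range n, ∫ x, f i x ∂μ i := by
  have h := (iIndepFun_infinitePi (P := μ) (X := f) hf).precomp (Fin.val_injective (n := n))
  simp_rw [Finset.prod_range]
  rw [h.integral_fun_prod_eq_prod_integral fun i =>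
    ((hf i).comp (measurable_pi_apply _)).aestronglyMeasurable]
  refine Finset.prod_congr rfl fun i _ => ?_
  rw [← (measurePreserving_eval_infinitePi μ i).map_eq,
    integral_map (measurable_pi_apply _).aemeasurable (hf i).aestronglyMeasurable]

theorem measurable_pointSum {M : Type*} [AddCommMonoid M] [MeasurableSpace M] [MeasurableAdd₂ M]
    {g : E → M} (hg : Measurable g) : Measurable (pointSum g) :=
  measurable_from_prod_countable_right fun n => by
    change Measurable fun p : ℕ → E => ∑ i ∈ Finset.range n, g (p i)
    exact Finset.measurable_fun_sum (f := fun i (p : ℕ → E) => g (p i)) _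
      fun i _ => hg.comp (measurable_pi_apply i)

/-- The law of `N` independent points with law `π`, where `N` is Poisson with parameter `r`. -/
def poissonPoints (r : ℝ≥0) (π : Measure E) : Measure (ℕ × (ℕ → E)) :=
  (poissonMeasure r).prod (Measure.infinitePi fun _ : ℕ => π)

theorem lintegral_natCast_poissonMeasure (r : ℝ≥0) :
    ∫⁻ n : ℕ, (n : ℝ≥0∞) ∂poissonMeasure r = r := by
  have h1 : ∑' n : ℕ, ENNReal.ofReal (Real.exp (-r) * r ^ n / n.factorial) = 1 := by
    have := measure_univ (μ := poissonMeasure r)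
    rw [← lintegral_one, poissonMeasure, lintegral_sum_measure] at this
    simpa using this
  rw [poissonMeasure, lintegral_sum_measure]
  simp only [lintegral_smul_measure, lintegral_dirac, smul_eq_mul]
  rw [tsum_eq_zero_add' ENNReal.summable]
  have h2 : ∀ n : ℕ, ENNReal.ofReal (Real.exp (-r) * r ^ (n + 1) / (n + 1).factorial) *
      ((n + 1 : ℕ) : ℝ≥0∞) = r * ENNReal.ofReal (Real.exp (-r) * r ^ n / n.factorial) := fun n => by
    rw [← ENNReal.ofReal_natCast, ← ENNReal.ofReal_coe_nnreal, ← ENNReal.ofReal_mul (by positivity),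
      ← ENNReal.ofReal_mul (by positivity)]
    congr 1
    rw [Nat.factorial_succ]
    push_cast
    have : ((n : ℝ) + 1) ≠ 0 := by positivity
    have : (n.factorial : ℝ) ≠ 0 := by positivity
    field_simp
    ring
  simp_rw [h2, ENNReal.tsum_mul_left, h1]
  simp

variable (r : ℝ≥0) (π : Measure E) [IsProbabilityMeasure π]

instance : IsProbabilityMeasure (poissonPoints r π) := by
  unfold poissonPoints; infer_instance

/-- Campbell's formula for one block: the mean number of points times the mean contribution of a
point. -/
theorem lintegral_pointSum {G : E → ℝ≥0∞} (hG : Measurable G) :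
    ∫⁻ x, pointSum G x ∂poissonPoints r π = r * ∫⁻ y, G y ∂π := by
  rw [poissonPoints, lintegral_prod _ (measurable_pointSum hG).aemeasurable]
  have h : ∀ n : ℕ, ∫⁻ p, pointSum G (n, p) ∂(Measure.infinitePi fun _ : ℕ => π) =
      n * ∫⁻ y, G y ∂π := fun n => by
    simp only [pointSum]
    rw [lintegral_finsetSum (f := fun i (p : ℕ → E) => G (p i)) _ fun i _ => hG.comp (measurable_pi_apply i)]
    have : ∀ i : ℕ, ∫⁻ p : ℕ → E, G (p i) ∂(Measure.infinitePi fun _ : ℕ => π) = ∫⁻ y, G y ∂π :=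
      fun i => (measurePreserving_eval_infinitePi (fun _ : ℕ => π) i).lintegral_comp hG
    simp [this]
  simp_rw [h]
  rw [lintegral_mul_const _ .of_discrete, lintegral_natCast_poissonMeasure]

/-- Given N = n the expectation is the n-th power of one factor, and the generating function of the
Poisson law sums the powers. The sign condition on Re h keeps the integrand bounded by 1. -/
theorem integral_cexp_pointSum {h : E → ℂ} (hh : Measurable h) (h0 : ∀ y, (h y).re ≤ 0) :
    ∫ x, Complex.exp (pointSum h x) ∂poissonPoints r π =
      Complex.exp (r * (∫ y, Complex.exp (h y) ∂π - 1)) := by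
  have hm : Measurable fun x => Complex.exp (pointSum h x) :=
    Complex.measurable_exp.comp (measurable_pointSum hh)
  have hint : Integrable (fun x => Complex.exp (pointSum h x)) (poissonPoints r π) :=
    (integrable_const (1 : ℝ)).mono' hm.aestronglyMeasurable
      (Eventually.of_forall (norm_cexp_pointSum_le h0))
  rw [poissonPoints] at hint ⊢
  rw [integral_prod _ hint]
  have h1 : ∀ n : ℕ, ∫ p, Complex.exp (pointSum h (n, p)) ∂(Measure.infinitePi fun _ : ℕ => π) =
      (∫ y, Complex.exp (h y) ∂π) ^ n := fun n => by
    simp only [pointSum, Complex.exp_sum]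
    rw [integral_prod_range_infinitePi (fun _ : ℕ => π) (f := fun _ y => Complex.exp (h y))
      fun _ => by fun_prop]
    simp
  simp_rw [h1]
  obtain ⟨c, hc⟩ : ∃ c, c = ∫ y, Complex.exp (h y) ∂π := ⟨_, rfl⟩
  rw [← hc, integral_poissonMeasure]
  have h2 : ∀ n : ℕ, (Real.exp (-r) * r ^ n / n.factorial) • c ^ n =
      Complex.exp (-r) * ((r * c) ^ n / n.factorial) := fun n => by
    rw [Complex.real_smul]
    push_cast
    ring
  simp_rw [h2]
  rw [tsum_mul_left, (NormedSpace.expSeries_div_hasSum_exp ((r : ℂ) * c)).tsum_eq,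
    ← Complex.exp_eq_exp_ℂ, ← Complex.exp_add]
  congr 1; ring

end

section

variable {E : Type*} [MeasurableSpace E]

theorem exists_isProbabilityMeasure_smul [Nonempty E] (m : Measure E) [IsFiniteMeasure m] :
    ∃ (r : ℝ≥0) (π : Measure E), IsProbabilityMeasure π ∧ m = r • π := by
  by_cases h : m univ = 0
  · exact ⟨0, Measure.dirac (Classical.arbitrary E), inferInstance, by
      rw [zero_smul]; exact Measure.measure_univ_eq_zero.1 h⟩
  · refine ⟨(m univ).toNNReal, (m univ)⁻¹ • m, ⟨?_⟩, ?_⟩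
    · rw [Measure.smul_apply, smul_eq_mul, ENNReal.inv_mul_cancel h (measure_ne_top _ _)]
    · ext s _
      rw [Measure.smul_apply, Measure.smul_apply, ENNReal.smul_def, smul_eq_mul, smul_eq_mul,
        ENNReal.coe_toNNReal (measure_ne_top _ _), ← mul_assoc,
        ENNReal.mul_inv_cancel h (measure_ne_top _ _), one_mul]

theorem norm_cexp_sub_one_le {z : ℂ} (hz : z.re ≤ 0) : ‖Complex.exp z - 1‖ ≤ 2 * min ‖z‖ 1 := by
  have hb : ‖Complex.exp z - 1‖ ≤ ‖z‖ := by
    have h3 := (convex_halfSpace_re_le 0).norm_image_sub_le_of_norm_deriv_le (𝕜 := ℂ)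
      (f := Complex.exp) (C := 1) (x := 0) (y := z)
      (fun w _ => Complex.differentiableAt_exp) (fun w hw => by
        rw [Complex.deriv_exp, Complex.norm_exp]
        exact Real.exp_le_one_iff.2 hw) (by simp) hz
    simpa using h3
  have hb2 : ‖Complex.exp z - 1‖ ≤ 2 := by
    refine (norm_sub_le _ _).trans ?_
    rw [norm_one, Complex.norm_exp]
    linarith [Real.exp_le_one_iff.2 hz]
  rcases le_total ‖z‖ 1 with h4 | h4
  · rw [min_eq_left h4]; linarith [norm_nonneg z]
  · rw [min_eq_right h4]; linarith

/-- `P` is the law of a Poisson random measure with intensity `m`, described by its point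
configurations over a countable family of blocks. -/
structure IsPoissonRandomMeasure (m : Measure E) (P : Measure (ℕ → ℕ × (ℕ → E))) : Prop where
  isProbabilityMeasure : IsProbabilityMeasure P
  lintegral_eq : ∀ G : E → ℝ≥0∞, Measurable G →
    ∫⁻ ω, ∑' n, pointSum G (ω n) ∂P = ∫⁻ y, G y ∂m
  ae_summable : ∀ h : E → ℂ, Measurable h → (∀ y, (h y).re ≤ 0) →
    Integrable (fun y => min ‖h y‖ 1) m →
    ∀ᵐ ω ∂P, Summable fun n => pointSum (fun y => ‖h y‖) (ω n)
  integral_cexp : ∀ h : E → ℂ, Measurable h → (∀ y, (h y).re ≤ 0) →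
    Integrable (fun y => min ‖h y‖ 1) m →
    ∫ ω, Complex.exp (∑' n, pointSum h (ω n)) ∂P =
      Complex.exp (∫ y, (Complex.exp (h y) - 1) ∂m)

/-- An s-finite intensity is a sum of multiples r_n π_n of probability measures; independent blocks
with N_n Poisson of parameter r_n are superposed. -/
theorem exists_poissonRandomMeasure [Nonempty E] (m : Measure E) [SFinite m] :
    ∃ P : Measure (ℕ → ℕ × (ℕ → E)), IsPoissonRandomMeasure m P := by
  choose r π hπ hm using fun n => exists_isProbabilityMeasure_smul (sfiniteSeq m n)
  have hsum : Measure.sum (fun n => r n • π n) = m := by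
    simp_rw [← hm]; exact sum_sfiniteSeq m
  obtain ⟨P, hP⟩ : ∃ P, P = Measure.infinitePi fun n => poissonPoints (r n) (π n) := ⟨_, rfl⟩
  have hPp : IsProbabilityMeasure P := hP ▸ inferInstance
  have hcamp : ∀ G : E → ℝ≥0∞, Measurable G →
      ∫⁻ ω, ∑' n, pointSum G (ω n) ∂P = ∫⁻ y, G y ∂m := by
    intro G hG
    rw [lintegral_tsum (f := fun n (ω : ℕ → ℕ × (ℕ → E)) => pointSum G (ω n)) fun n =>
      ((measurable_pointSum hG).comp (measurable_pi_apply n)).aemeasurable,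
      ← hsum, lintegral_sum_measure]
    congr 1; ext n
    rw [lintegral_smul_measure, ENNReal.smul_def, smul_eq_mul, ← lintegral_pointSum _ _ hG, hP]
    exact (measurePreserving_eval_infinitePi (fun n => poissonPoints (r n) (π n)) n).lintegral_comp
      (measurable_pointSum hG)
  have hsummable : ∀ h : E → ℂ, Measurable h → (∀ y, (h y).re ≤ 0) →
      Integrable (fun y => min ‖h y‖ 1) m →
      ∀ᵐ ω ∂P, Summable fun n => pointSum (fun y => ‖h y‖) (ω n) := by
    intro h hh h0 hi
    have h1 := hcamp (fun y => ENNReal.ofReal (min ‖h y‖ 1)) (by fun_prop)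
    have h2 : ∫⁻ ω, ∑' n, pointSum (fun y => ENNReal.ofReal (min ‖h y‖ 1)) (ω n) ∂P ≠ ∞ := by
      rw [h1]; exact hi.lintegral_lt_top.ne
    have h3 := ae_lt_top (Measurable.tsum fun n =>
      (measurable_pointSum (g := fun y => ENNReal.ofReal (min ‖h y‖ 1)) (by fun_prop)).comp
        (measurable_pi_apply n)) h2
    filter_upwards [h3] with ω hω
    refine summable_of_summable_pointSum_min (fun y => norm_nonneg _) ?_
    have h4 : ∀ n, pointSum (fun y => ENNReal.ofReal (min ‖h y‖ 1)) (ω n) =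
        ENNReal.ofReal (pointSum (fun y => min ‖h y‖ 1) (ω n)) := fun n => by
      rw [pointSum, pointSum, ENNReal.ofReal_sum_of_nonneg fun i _ =>
        le_min (norm_nonneg _) zero_le_one]
    have h5 : ∀ n, 0 ≤ pointSum (fun y => min ‖h y‖ 1) (ω n) := fun n =>
      Finset.sum_nonneg fun i _ => le_min (norm_nonneg _) zero_le_one
    simp only [Function.comp_apply, h4] at hω
    refine (ENNReal.summable_toReal hω.ne).congr fun n => ?_
    rw [ENNReal.toReal_ofReal (h5 n)]
  refine ⟨P, hPp, hcamp, hsummable, fun h hh h0 hi => ?_⟩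
  have hcm : ∀ n, Measurable fun ω : ℕ → ℕ × (ℕ → E) => pointSum h (ω n) := fun n =>
    (measurable_pointSum hh).comp (measurable_pi_apply n)
  have hexpint : Integrable (fun y => Complex.exp (h y) - 1) m := by
    exact (hi.const_mul 2).mono' (by fun_prop)
      (Eventually.of_forall fun y => norm_cexp_sub_one_le (h0 y))
  have hS := hasSum_integral_measure (μ := fun n => r n • π n) (by rw [hsum]; exact hexpint)
  rw [hsum] at hS
  have hterm : ∀ n, ∫ y, (Complex.exp (h y) - 1) ∂(r n • π n) =
      r n * (∫ y, Complex.exp (h y) ∂π n - 1) := fun n => by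
    rw [integral_smul_nnreal_measure, integral_sub
      ((integrable_const (1 : ℝ)).mono' (by fun_prop) (Eventually.of_forall fun y => by
        rw [Complex.norm_exp]; exact Real.exp_le_one_iff.2 (h0 y))) (integrable_const _)]
    simp [NNReal.smul_def]
  have hpart : ∀ K : ℕ, ∫ ω, Complex.exp (∑ n ∈ Finset.range K, pointSum h (ω n)) ∂P =
      Complex.exp (∑ n ∈ Finset.range K, ∫ y, (Complex.exp (h y) - 1) ∂(r n • π n)) := fun K => by
    simp_rw [Complex.exp_sum]
    rw [hP, integral_prod_range_infinitePi _ (f := fun _ x => Complex.exp (pointSum h x))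
      fun _ => Complex.measurable_exp.comp (measurable_pointSum hh)]
    refine Finset.prod_congr rfl fun n _ => ?_
    rw [integral_cexp_pointSum _ _ hh h0, hterm]
  have t1 := (Complex.continuous_exp.tendsto _).comp hS.tendsto_sum_nat
  -- The exponential formula for finitely many blocks passes to the limit with the constant majorant
  -- 1, because Re h ≤ 0.
  have t2 : Tendsto (fun K => ∫ ω, Complex.exp (∑ n ∈ Finset.range K, pointSum h (ω n)) ∂P) atTop
      (𝓝 (∫ ω, Complex.exp (∑' n, pointSum h (ω n)) ∂P)) := by
    refine tendsto_integral_of_dominated_convergence (fun _ => 1) (fun K => ?_)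
      (integrable_const _) (fun K => Eventually.of_forall fun ω => ?_) ?_
    · exact (Complex.measurable_exp.comp
        (Finset.measurable_fun_sum _ fun n _ => hcm n)).aestronglyMeasurable
    · rw [Complex.norm_exp, Complex.re_sum]
      refine Real.exp_le_one_iff.2 (Finset.sum_nonpos fun n _ => ?_)
      rw [pointSum, Complex.re_sum]
      exact Finset.sum_nonpos fun i _ => h0 _
    · filter_upwards [hsummable h hh h0 hi] with ω hω
      have h1 : Summable fun n => pointSum h (ω n) :=
        Summable.of_norm_bounded hω fun n => norm_sum_le _ _
      exact (Complex.continuous_exp.tendsto _).comp h1.hasSum.tendsto_sum_nat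
  refine tendsto_nhds_unique t2 (t1.congr fun K => (hpart K).symm)

end

/-! ### Independent increments from characteristic functions -/

theorem charFun_map_eq_integral {Ω : Type*} [MeasurableSpace Ω] {P : Measure Ω} {X : Ω → ℝ}
    (hX : Measurable X) (ξ : ℝ) :
    charFun (P.map X) ξ = ∫ ω, Complex.exp (Complex.I * ξ * X ω) ∂P := by
  rw [charFun_apply_real, integral_map hX.aemeasurable
    (Measurable.aestronglyMeasurable (by fun_prop))]
  congr 1; ext ω; ring_nf

/-- The case n = 1 identifies the characteristic function of each increment; the general case then
says that the joint one factorises. -/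
theorem hasIndepIncrements_of_integral_cexp {Ω : Type*} [MeasurableSpace Ω] {P : Measure Ω}
    [IsProbabilityMeasure P] {X : ℝ≥0 → Ω → ℝ} (hX : ∀ t, Measurable (X t)) {φ : ℝ → ℂ}
    (h : ∀ (n : ℕ) (t : Fin (n + 1) → ℝ≥0), Monotone t → ∀ ξ : Fin n → ℝ,
      ∫ ω, Complex.exp (∑ k, Complex.I * ξ k * ((X (t k.succ) ω - X (t k.castSucc) ω : ℝ) : ℂ)) ∂P =
        ∏ k, Complex.exp (((t k.succ : ℝ) - t k.castSucc) * φ (ξ k))) :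
    HasIndepIncrements X P := by
  intro n t ht
  have hm : ∀ k : Fin n, Measurable fun ω => X (t k.succ) ω - X (t k.castSucc) ω :=
    fun k => (hX _).sub (hX _)
  rw [iIndepFun_iff_charFun_pi fun k => (hm k).aemeasurable]
  intro ξ
  have h1 : ∀ k : Fin n, charFun (P.map fun ω => X (t k.succ) ω - X (t k.castSucc) ω) (ξ k) =
      Complex.exp (((t k.succ : ℝ) - t k.castSucc) * φ (ξ k)) := fun k => by
    rw [charFun_map_eq_integral (hm k)]
    have hmono : Monotone ![t k.castSucc, t k.succ] := by
      intro i j hij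
      have h01 : t k.castSucc ≤ t k.succ := ht (Fin.castSucc_lt_succ).le
      fin_cases i <;> fin_cases j <;> simp_all
    have := h 1 ![t k.castSucc, t k.succ] hmono fun _ => ξ k
    simpa using this
  simp_rw [h1]
  rw [← h n t ht fun k => ξ k, charFun_apply, integral_map (by fun_prop)
    (Measurable.aestronglyMeasurable (by fun_prop))]
  congr 1; ext ω
  congr 1
  rw [PiLp.inner_apply]
  push_cast
  rw [Finset.sum_mul]
  refine Finset.sum_congr rfl fun k _ => ?_
  simp only [RCLike.inner_apply, conj_trivial]
  push_cast
  ring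

/-! ### Telescoping indicators -/

/-- The indicator of `(s, t]` at `u`, for `s ≤ t`. -/
def stepDiff (s t : ℝ≥0) (u : ℝ) : ℝ := (if u ≤ t then 1 else 0) - if u ≤ s then 1 else 0

theorem stepDiff_eq_indicator {s t : ℝ≥0} (hst : s ≤ t) :
    stepDiff s t = (Ioc (s : ℝ) t).indicator fun _ => 1 := by
  have hst' : (s : ℝ) ≤ t := hst
  ext u
  unfold stepDiff
  by_cases h1 : u ≤ t
  · by_cases h2 : u ≤ s
    · rw [indicator_of_notMem fun h => absurd h.1 (not_lt.2 h2)]; simp [h1, h2]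
    · rw [indicator_of_mem (show u ∈ Ioc (s : ℝ) t from ⟨not_le.1 h2, h1⟩)]; simp [h1, h2]
  · have h2 : ¬ u ≤ s := fun h => h1 (h.trans hst')
    rw [indicator_of_notMem fun h => h1 h.2]; simp [h1, h2]

theorem stepDiff_cases {n : ℕ} {t : Fin (n + 1) → ℝ≥0} (ht : Monotone t) (u : ℝ) :
    (∀ k : Fin n, stepDiff (t k.castSucc) (t k.succ) u = 0) ∨
      ∃ k : Fin n, stepDiff (t k.castSucc) (t k.succ) u = 1 ∧
        ∀ l ≠ k, stepDiff (t l.castSucc) (t l.succ) u = 0 := by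
  have hle : ∀ k : Fin n, t k.castSucc ≤ t k.succ := fun k => ht (Fin.castSucc_lt_succ).le
  simp_rw [fun k : Fin n => stepDiff_eq_indicator (hle k)]
  by_cases h : ∃ k : Fin n, u ∈ Ioc (t k.castSucc : ℝ) (t k.succ)
  · obtain ⟨k, hk⟩ := h
    refine Or.inr ⟨k, by rw [indicator_of_mem hk], fun l hl => indicator_of_notMem ?_ _⟩
    intro hl'
    rcases lt_or_gt_of_ne hl with h' | h'
    · have : (t l.succ : ℝ) ≤ t k.castSucc := ht (Fin.succ_le_castSucc_iff.2 h')
      linarith [hl'.2, hk.1]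
    · have : (t k.succ : ℝ) ≤ t l.castSucc := ht (Fin.succ_le_castSucc_iff.2 h')
      linarith [hl'.1, hk.2]
  · push Not at h
    exact Or.inl fun k => indicator_of_notMem (h k) _

/-- The intervals are disjoint, so at most one summand is nonzero and any function vanishing at 0
passes through the sum. -/
theorem apply_sum_stepDiff {n : ℕ} {t : Fin (n + 1) → ℝ≥0} (ht : Monotone t) (u : ℝ) {κ : ℂ → ℂ}
    (hκ : κ 0 = 0) (c : Fin n → ℂ) :
    κ (∑ k, c k * (stepDiff (t k.castSucc) (t k.succ) u : ℂ)) =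
      ∑ k, κ (c k) * (stepDiff (t k.castSucc) (t k.succ) u : ℂ) := by
  rcases stepDiff_cases ht u with h | ⟨k, hk, h⟩
  · simp [h, hκ]
  · rw [Finset.sum_eq_single k (fun l _ hl => by rw [h l hl]; simp) (by simp),
      Finset.sum_eq_single k (fun l _ hl => by rw [h l hl]; simp) (by simp), hk]
    simp

/-! ### Existence of subordinators -/

/-- The subordinator with drift `d` whose jumps `j` at times `u` are the points `(u, j)` of a
configuration. -/
def jumpProcess (d t : ℝ≥0) (ω : ℕ → ℕ × (ℕ → ℝ × ℝ)) : ℝ≥0 :=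
  d * t + ∑' n, pointSum (fun p : ℝ × ℝ => if p.1 ≤ t then p.2.toNNReal else 0) (ω n)

theorem measurable_jumpProcess (d t : ℝ≥0) : Measurable (jumpProcess d t) := by
  unfold jumpProcess
  refine measurable_const.add (Measurable.tsum fun n => ?_)
  refine (measurable_pointSum ?_).comp (measurable_pi_apply n)
  exact Measurable.ite (measurableSet_le (by fun_prop) (by fun_prop)) (by fun_prop) (by fun_prop)

/-- Configurations with summable jumps on bounded time intervals. -/
def SummableJumps (ω : ℕ → ℕ × (ℕ → ℝ × ℝ)) : Prop :=
  ∀ T : ℕ, Summable fun n => pointSum (fun p : ℝ × ℝ => if p.1 ≤ T then p.2.toNNReal else 0) (ω n)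

theorem pointSum_mono_time {s t : ℝ} (hst : s ≤ t) (x : ℕ × (ℕ → ℝ × ℝ)) :
    pointSum (fun p : ℝ × ℝ => if p.1 ≤ s then p.2.toNNReal else 0) x ≤
      pointSum (fun p : ℝ × ℝ => if p.1 ≤ t then p.2.toNNReal else 0) x := by
  refine Finset.sum_le_sum fun i _ => ?_
  by_cases h : (x.2 i).1 ≤ s
  · simp [h, h.trans hst]
  · simp [h]

theorem SummableJumps.summable {ω : ℕ → ℕ × (ℕ → ℝ × ℝ)} (hω : SummableJumps ω) (t : ℝ≥0) :
    Summable fun n => pointSum (fun p : ℝ × ℝ => if p.1 ≤ t then p.2.toNNReal else 0) (ω n) := by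
  obtain ⟨T, hT⟩ := exists_nat_ge (t : ℝ)
  exact NNReal.summable_of_le (fun n => pointSum_mono_time hT (ω n)) (hω T)

theorem SummableJumps.hasSum {ω : ℕ → ℕ × (ℕ → ℝ × ℝ)} (hω : SummableJumps ω) (d t : ℝ≥0) :
    HasSum (fun n => ((pointSum (fun p : ℝ × ℝ => if p.1 ≤ t then p.2.toNNReal else 0) (ω n) :
      ℝ≥0) : ℝ)) (jumpProcess d t ω - d * t) := by
  have := NNReal.hasSum_coe.2 (hω.summable t).hasSum
  convert this using 1
  rw [jumpProcess]; push_cast; ring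

theorem SummableJumps.sum_increments {ω : ℕ → ℕ × (ℕ → ℝ × ℝ)} (hω : SummableJumps ω) (d : ℝ≥0)
    {n : ℕ} (t : Fin (n + 1) → ℝ≥0) (c : Fin n → ℂ) :
    ∑ k, c k * (((jumpProcess d (t k.succ) ω : ℝ) - jumpProcess d (t k.castSucc) ω : ℝ) : ℂ) =
      (∑ k, c k * (d * ((t k.succ : ℝ) - t k.castSucc))) +
      ∑' i, pointSum (fun p : ℝ × ℝ =>
        (∑ k, c k * (stepDiff (t k.castSucc) (t k.succ) p.1 : ℂ)) * (p.2.toNNReal : ℂ)) (ω i) := by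
  have h1 := hasSum_sum (s := Finset.univ) fun k (_ : k ∈ Finset.univ) =>
    ((Complex.hasSum_ofReal.2 ((hω.hasSum d (t k.succ)).sub (hω.hasSum d (t k.castSucc)))).mul_left
      (c k))
  have h2 : ∀ i, ∑ k, c k * (((pointSum (fun p : ℝ × ℝ => if p.1 ≤ t k.succ then p.2.toNNReal else 0)
      (ω i) : ℝ≥0) - (pointSum (fun p : ℝ × ℝ => if p.1 ≤ t k.castSucc then p.2.toNNReal else 0)
      (ω i) : ℝ≥0) : ℝ) : ℂ) = pointSum (fun p : ℝ × ℝ =>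
        (∑ k, c k * (stepDiff (t k.castSucc) (t k.succ) p.1 : ℂ)) * (p.2.toNNReal : ℂ)) (ω i) := by
    intro i
    simp only [pointSum]
    push_cast
    simp_rw [← Finset.sum_sub_distrib, Finset.mul_sum]
    rw [Finset.sum_comm]
    refine Finset.sum_congr rfl fun l _ => ?_
    rw [Finset.sum_mul]
    refine Finset.sum_congr rfl fun k _ => ?_
    rw [stepDiff, mul_assoc]
    congr 1
    split_ifs <;> simp
  simp_rw [h2] at h1
  rw [h1.tsum_eq, ← Finset.sum_add_distrib]
  refine Finset.sum_congr rfl fun k _ => ?_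
  push_cast
  ring

theorem SummableJumps.cadlag {ω : ℕ → ℕ × (ℕ → ℝ × ℝ)} (hω : SummableJumps ω) (d t : ℝ≥0) :
    ContinuousWithinAt (fun s => (jumpProcess d s ω : ℝ)) (Ici t) t ∧
    ∃ l : ℝ, Tendsto (fun s => (jumpProcess d s ω : ℝ)) (𝓝[<] t) (𝓝 l) := by
  obtain ⟨T, hT⟩ := exists_nat_gt t
  have hTω : Summable fun n => ((pointSum (fun p : ℝ × ℝ => if p.1 ≤ T then p.2.toNNReal else 0)
      (ω n) : ℝ≥0) : ℝ) := NNReal.summable_coe.2 (hω T)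
  have hev : ∀ᶠ s : ℝ≥0 in 𝓝 t, s < T := Iio_mem_nhds hT
  have hbd : ∀ s : ℝ≥0, s < T → ∀ n, ‖((pointSum (fun p : ℝ × ℝ => if p.1 ≤ s then p.2.toNNReal
      else 0) (ω n) : ℝ≥0) : ℝ)‖ ≤ ((pointSum (fun p : ℝ × ℝ => if p.1 ≤ T then p.2.toNNReal else 0)
      (ω n) : ℝ≥0) : ℝ) := fun s hs n => by
    rw [Real.norm_of_nonneg (NNReal.coe_nonneg _)]
    have : (s : ℝ) ≤ (T : ℝ) := by exact_mod_cast hs.le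
    exact pointSum_mono_time this _
  have heq : ∀ s, (jumpProcess d s ω : ℝ) = d * s + ∑' n, ((pointSum (fun p : ℝ × ℝ =>
      if p.1 ≤ s then p.2.toNNReal else 0) (ω n) : ℝ≥0) : ℝ) := fun s => by
    rw [(hω.hasSum d s).tsum_eq]; ring
  -- Here q u is the eventual truth value of u ≤ s as s → t along l: u ≤ t from the right, u < t
  -- from the left. Dominated convergence of the jump series treats both at once.
  have key : ∀ (l : Filter ℝ≥0), l ≤ 𝓝 t → ∀ q : ℝ → Prop,
      (∀ u : ℝ, ∀ᶠ s : ℝ≥0 in l, (u ≤ s ↔ q u)) →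
      ∃ a : ℝ, Tendsto (fun s => (jumpProcess d s ω : ℝ)) l (𝓝 a) := by
    classical
    intro l hl q hq
    have h1 : Tendsto (fun s : ℝ≥0 => ∑' n, ((pointSum (fun p : ℝ × ℝ =>
        if p.1 ≤ s then p.2.toNNReal else 0) (ω n) : ℝ≥0) : ℝ)) l
        (𝓝 (∑' n, ((pointSum (fun p : ℝ × ℝ => if q p.1 then p.2.toNNReal else 0)
          (ω n) : ℝ≥0) : ℝ))) := by
      refine tendsto_tsum_of_dominated_convergence hTω (fun n => ?_) ((hev.filter_mono hl).mono hbd)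
      refine (NNReal.continuous_coe.tendsto _).comp ?_
      unfold pointSum
      refine tendsto_finsetSum _ fun i _ => tendsto_const_nhds.congr' ?_
      filter_upwards [hq ((ω n).2 i).1] with s hs
      simp only [hs]
    have h2 : Tendsto (fun s : ℝ≥0 => (d : ℝ) * s) l (𝓝 (d * t)) :=
      (((continuous_const.mul NNReal.continuous_coe).tendsto t).mono_left hl)
    exact ⟨_, (h2.add h1).congr fun s => (heq s).symm⟩
  refine ⟨?_, key (𝓝[<] t) nhdsWithin_le_nhds (fun u => u < t) fun u => ?_⟩
  · obtain ⟨a, ha⟩ := key (𝓝[≥] t) nhdsWithin_le_nhds (fun u => u ≤ t) fun u => by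
      rcases le_or_gt u t with h | h
      · filter_upwards [self_mem_nhdsWithin] with s hs
        exact ⟨fun _ => h, fun h' => h'.trans (NNReal.coe_le_coe.2 hs)⟩
      · have h1 : ∀ᶠ s : ℝ≥0 in 𝓝 t, (s : ℝ) < u :=
          (NNReal.continuous_coe.tendsto t).eventually_lt_const h
        filter_upwards [nhdsWithin_le_nhds h1] with s hs
        exact ⟨fun h' => absurd hs (not_lt.2 h'), fun h' => absurd h (not_lt.2 h')⟩
    have h2 : a = (jumpProcess d t ω : ℝ) :=
      tendsto_nhds_unique (ha.mono_left (pure_le_nhdsWithin self_mem_Ici))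
        (tendsto_pure_nhds (fun s => (jumpProcess d s ω : ℝ)) t)
    rw [h2] at ha
    exact ha
  · rcases lt_or_ge u t with h | h
    · have h1 : ∀ᶠ s : ℝ≥0 in 𝓝 t, u < (s : ℝ) :=
        (NNReal.continuous_coe.tendsto t).eventually_const_lt h
      filter_upwards [nhdsWithin_le_nhds h1] with s hs
      exact ⟨fun _ => h, fun _ => hs.le⟩
    · filter_upwards [self_mem_nhdsWithin] with s hs
      exact ⟨fun h' => absurd (NNReal.coe_lt_coe.2 hs) (not_lt.2 (h.trans h')),
        fun h' => absurd h' (not_lt.2 h)⟩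

/-- The exponent `∫ (exp(zx) - 1) ν(dx)`. -/
def jumpExponent (ν : Measure ℝ) (z : ℂ) : ℂ := ∫ x : ℝ, (Complex.exp (z * x) - 1) ∂ν

theorem jumpExponent_zero (ν : Measure ℝ) : jumpExponent ν 0 = 0 := by simp [jumpExponent]

section

variable {ν : Measure ℝ}

/-- The weight is bounded and vanishes after time T, so min(Cx, 1) ≤ (C + 1) min(x, 1) reduces
integrability to a bounded time interval times ν. -/
theorem integrable_min_weight (hν : ∀ᵐ x ∂ν, 0 < x) (hmin : Integrable (fun x : ℝ => min x 1) ν)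
    {w : ℝ → ℂ} (hw : Measurable w) {C T : ℝ} (hC : ∀ u, ‖w u‖ ≤ C)
    (hT : ∀ u, T < u → w u = 0) :
    Integrable (fun p : ℝ × ℝ => min ‖w p.1 * (p.2.toNNReal : ℂ)‖ 1)
      ((volume.restrict (Ioi 0)).prod ν) := by
  have hC0 : 0 ≤ C := (norm_nonneg _).trans (hC 0)
  have h1 : Integrable (fun u : ℝ => (Iic T).indicator (fun _ => C + 1) u)
      (volume.restrict (Ioi (0 : ℝ))) := by
    rw [integrable_indicator_iff measurableSet_Iic]
    refine integrableOn_const ?_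
    rw [Measure.restrict_apply measurableSet_Iic, Iic_inter_Ioi, Real.volume_Ioc]
    exact ENNReal.ofReal_ne_top
  refine (h1.mul_prod hmin).mono' (Measurable.aestronglyMeasurable (by fun_prop)) ?_
  have hpos : ∀ᵐ p : ℝ × ℝ ∂((volume.restrict (Ioi 0)).prod ν), 0 < p.2 :=
    Measure.quasiMeasurePreserving_snd.ae hν
  filter_upwards [hpos] with p hp
  rw [Real.norm_of_nonneg (le_min (norm_nonneg _) zero_le_one), norm_mul]
  have e : ‖((p.2.toNNReal : ℝ≥0) : ℂ)‖ = p.2 := by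
    rw [Complex.norm_real, Real.coe_toNNReal _ hp.le,
      Real.norm_of_nonneg hp.le]
  rw [e]
  by_cases hu : p.1 ∈ Iic T
  · rw [indicator_of_mem hu]
    have := hC p.1
    rcases le_total p.2 1 with h | h
    · rw [min_eq_left h]
      exact (min_le_left _ _).trans (mul_le_mul_of_nonneg_right (by linarith) hp.le)
    · rw [min_eq_right h]
      exact (min_le_right _ _).trans (by linarith)
  · rw [indicator_of_notMem hu, hT _ (not_le.1 hu)]
    simp

theorem integral_weight_eq [SFinite ν] (hν : ∀ᵐ x ∂ν, 0 < x) (hmin : Integrable (fun x : ℝ => min x 1) ν)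
    {w : ℝ → ℂ} (hw : Measurable w) (h0 : ∀ u, (w u).re ≤ 0) {C T : ℝ} (hC : ∀ u, ‖w u‖ ≤ C)
    (hT : ∀ u, T < u → w u = 0) :
    ∫ p : ℝ × ℝ, (Complex.exp (w p.1 * (p.2.toNNReal : ℂ)) - 1)
      ∂((volume.restrict (Ioi 0)).prod ν) = ∫ u in Ioi (0 : ℝ), jumpExponent ν (w u) := by
  have hint : Integrable (fun p : ℝ × ℝ => Complex.exp (w p.1 * (p.2.toNNReal : ℂ)) - 1)
      ((volume.restrict (Ioi 0)).prod ν) := by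
    refine ((integrable_min_weight hν hmin hw hC hT).const_mul 2).mono'
      (Measurable.aestronglyMeasurable (by fun_prop)) (Eventually.of_forall fun p => ?_)
    refine norm_cexp_sub_one_le ?_
    rw [Complex.re_mul_ofReal]
    exact mul_nonpos_of_nonpos_of_nonneg (h0 _) (NNReal.coe_nonneg _)
  rw [integral_prod _ hint]
  congr 1; ext u
  refine integral_congr_ae (hν.mono fun x hx => ?_)
  dsimp only
  rw [Real.coe_toNNReal _ hx.le]

variable {P : Measure (ℕ → ℕ × (ℕ → ℝ × ℝ))}

theorem IsPoissonRandomMeasure.ae_summableJumps (hν : ∀ᵐ x ∂ν, 0 < x)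
    (hmin : Integrable (fun x : ℝ => min x 1) ν)
    (hP : IsPoissonRandomMeasure ((volume.restrict (Ioi (0 : ℝ))).prod ν) P) :
    ∀ᵐ ω ∂P, SummableJumps ω := by
  refine ae_all_iff.2 fun T => ?_
  -- The value -1 satisfies the sign condition while the modulus reproduces the jump.
  obtain ⟨w, hw⟩ : ∃ w : ℝ → ℂ, w = fun u => if u ≤ (T : ℝ) then -1 else 0 := ⟨_, rfl⟩
  have hwm : Measurable w := by
    rw [hw]
    exact Measurable.ite measurableSet_Iic measurable_const measurable_const
  have hw0 : ∀ u, (w u).re ≤ 0 := fun u => by rw [hw]; dsimp only; split_ifs <;> simp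
  have hwC : ∀ u, ‖w u‖ ≤ 1 := fun u => by rw [hw]; dsimp only; split_ifs <;> simp
  have hwT : ∀ u, (T : ℝ) < u → w u = 0 := fun u hu => by rw [hw]; exact if_neg (not_le.2 hu)
  have h1 := hP.ae_summable (fun p => w p.1 * (p.2.toNNReal : ℂ)) (by fun_prop) (fun p => by
    rw [Complex.re_mul_ofReal]
    exact mul_nonpos_of_nonpos_of_nonneg (hw0 _) (NNReal.coe_nonneg _))
    (integrable_min_weight hν hmin hwm hwC hwT)
  filter_upwards [h1] with ω hω
  rw [← NNReal.summable_coe]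
  refine hω.congr fun n => ?_
  simp only [pointSum, NNReal.coe_sum]
  refine Finset.sum_congr rfl fun i _ => ?_
  rw [hw]
  dsimp only
  split_ifs <;> simp

/-- The intensity gives no mass to times u ≤ 0, so by Campbell's formula the jumps up to time 0 have
mean zero. -/
theorem IsPoissonRandomMeasure.ae_jumpProcess_zero (d : ℝ≥0)
    (hP : IsPoissonRandomMeasure ((volume.restrict (Ioi (0 : ℝ))).prod ν) P) :
    ∀ᵐ ω ∂P, jumpProcess d 0 ω = 0 := by
  obtain ⟨g, hg⟩ : ∃ g : ℝ × ℝ → ℝ≥0∞, g = fun p => if p.1 ≤ 0 then (p.2.toNNReal : ℝ≥0∞) else 0 :=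
    ⟨_, rfl⟩
  have hgm : Measurable g := by
    rw [hg]
    exact Measurable.ite (measurableSet_le (by fun_prop) (by fun_prop)) (by fun_prop) (by fun_prop)
  have h1 := hP.lintegral_eq g hgm
  have h2 : ∫⁻ p, g p ∂((volume.restrict (Ioi 0)).prod ν) = 0 := by
    have hpos : ∀ᵐ p : ℝ × ℝ ∂((volume.restrict (Ioi 0)).prod ν), p.1 ∈ Ioi (0 : ℝ) :=
      Measure.quasiMeasurePreserving_fst.ae (ae_restrict_mem measurableSet_Ioi)
    rw [lintegral_congr_ae (g := fun _ => 0) (hpos.mono fun p hp => by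
      rw [hg]; exact if_neg (not_le.2 hp)), lintegral_zero]
  have hsum : Measurable fun ω : ℕ → ℕ × (ℕ → ℝ × ℝ) => ∑' n, pointSum g (ω n) :=
    Measurable.tsum fun n => (measurable_pointSum hgm).comp (measurable_pi_apply n)
  rw [h2, lintegral_eq_zero_iff hsum] at h1
  filter_upwards [h1] with ω hω
  have h3 : ∀ n, pointSum (fun p : ℝ × ℝ => if p.1 ≤ ((0 : ℝ≥0) : ℝ) then p.2.toNNReal else 0)
      (ω n) = 0 := fun n => by
    have h4 := ENNReal.tsum_eq_zero.1 hω n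
    simp only [hg, pointSum, Finset.sum_eq_zero_iff] at h4 ⊢
    intro i hi
    have h5 := h4 i hi
    by_cases h6 : ((ω n).2 i).1 ≤ 0
    · rw [if_pos h6] at h5
      exact (if_pos h6).trans (by exact_mod_cast h5)
    · exact if_neg h6
  rw [jumpProcess]
  simp only [h3, tsum_zero, mul_zero, add_zero]

variable [SFinite ν]

/-- The exponential formula applied to a step function of time. The range Re c ≤ 0 covers Fourier
arguments, for the law of the increments, and Laplace arguments, for the exponent. -/
theorem IsPoissonRandomMeasure.integral_cexp_increments (d : ℝ≥0) (hν : ∀ᵐ x ∂ν, 0 < x)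
    (hmin : Integrable (fun x : ℝ => min x 1) ν)
    (hP : IsPoissonRandomMeasure ((volume.restrict (Ioi (0 : ℝ))).prod ν) P) {n : ℕ}
    {t : Fin (n + 1) → ℝ≥0} (ht : Monotone t) {c : Fin n → ℂ} (hc : ∀ k, (c k).re ≤ 0) :
    ∫ ω, Complex.exp (∑ k, c k * (((jumpProcess d (t k.succ) ω : ℝ) -
        jumpProcess d (t k.castSucc) ω : ℝ) : ℂ)) ∂P =
      ∏ k, Complex.exp (((t k.succ : ℝ) - t k.castSucc) * (d * c k + jumpExponent ν (c k))) := by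
  have hle : ∀ k : Fin n, t k.castSucc ≤ t k.succ := fun k => ht (Fin.castSucc_lt_succ).le
  obtain ⟨w, hw⟩ : ∃ w : ℝ → ℂ, w = fun u =>
    ∑ k, c k * (stepDiff (t k.castSucc) (t k.succ) u : ℂ) := ⟨_, rfl⟩
  have hstep : ∀ k : Fin n, Measurable (stepDiff (t k.castSucc) (t k.succ)) := fun k => by
    rw [stepDiff_eq_indicator (hle k)]
    exact measurable_const.indicator measurableSet_Ioc
  have hstep0 : ∀ (k : Fin n) u, 0 ≤ stepDiff (t k.castSucc) (t k.succ) u ∧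
      stepDiff (t k.castSucc) (t k.succ) u ≤ 1 := fun k u => by
    rw [stepDiff_eq_indicator (hle k)]
    exact ⟨indicator_nonneg (fun _ _ => zero_le_one) _, indicator_le_self' (fun _ _ => zero_le_one) _⟩
  have hwm : Measurable w := by
    rw [hw]
    exact Finset.measurable_fun_sum _ fun k _ =>
      measurable_const.mul (Complex.measurable_ofReal.comp (hstep k))
  have hw0 : ∀ u, (w u).re ≤ 0 := fun u => by
    rw [hw, Complex.re_sum]
    refine Finset.sum_nonpos fun k _ => ?_
    rw [Complex.re_mul_ofReal]
    exact mul_nonpos_of_nonpos_of_nonneg (hc k) (hstep0 k u).1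
  have hwC : ∀ u, ‖w u‖ ≤ ∑ k, ‖c k‖ := fun u => by
    rw [hw]
    refine norm_sum_le_of_le _ fun k _ => ?_
    rw [norm_mul, Complex.norm_real, Real.norm_of_nonneg (hstep0 k u).1]
    exact mul_le_of_le_one_right (norm_nonneg _) (hstep0 k u).2
  have hwT : ∀ u, (t (Fin.last n) : ℝ) < u → w u = 0 := fun u hu => by
    rw [hw]
    refine Finset.sum_eq_zero fun k _ => ?_
    have h2 : (t k.succ : ℝ) ≤ t (Fin.last n) := ht (Fin.le_last _)
    rw [stepDiff_eq_indicator (hle k), indicator_of_notMem fun h => by linarith [h.2]]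
    simp
  have h1 := hP.integral_cexp (fun p => w p.1 * (p.2.toNNReal : ℂ)) (by fun_prop) (fun p => by
    rw [Complex.re_mul_ofReal]
    exact mul_nonpos_of_nonpos_of_nonneg (hw0 _) (NNReal.coe_nonneg _))
    (integrable_min_weight hν hmin hwm hwC hwT)
  rw [integral_weight_eq hν hmin hwm hw0 hwC hwT] at h1
  have h2 : ∫ u in Ioi (0 : ℝ), jumpExponent ν (w u) =
      ∑ k, jumpExponent ν (c k) * ((t k.succ : ℝ) - t k.castSucc) := by
    simp_rw [hw, apply_sum_stepDiff ht _ (jumpExponent_zero ν) c]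
    have hI : ∀ k : Fin n, IntegrableOn (stepDiff (t k.castSucc) (t k.succ)) (Ioi (0 : ℝ)) :=
      fun k => by
        rw [stepDiff_eq_indicator (hle k)]
        exact ((integrable_indicator_iff measurableSet_Ioc).2
          (integrableOn_const (by simp))).integrableOn
    rw [integral_finsetSum _ fun k _ => (hI k).ofReal.const_mul _]
    refine Finset.sum_congr rfl fun k _ => ?_
    rw [integral_const_mul, integral_complex_ofReal, stepDiff_eq_indicator (hle k),
      setIntegral_indicator measurableSet_Ioc, inter_eq_self_of_subset_right
      (show Ioc (t k.castSucc : ℝ) (t k.succ) ⊆ Ioi 0 from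
        fun x hx => lt_of_le_of_lt (NNReal.coe_nonneg _) hx.1)]
    have hle' : (t k.castSucc : ℝ) ≤ t k.succ := hle k
    simp [hle']
  rw [h2] at h1
  calc _ = ∫ ω, Complex.exp (∑ k, c k * (d * ((t k.succ : ℝ) - t k.castSucc))) *
        Complex.exp (∑' i, pointSum (fun p : ℝ × ℝ => w p.1 * (p.2.toNNReal : ℂ)) (ω i)) ∂P := by
        refine integral_congr_ae ((hP.ae_summableJumps hν hmin).mono fun ω hω => ?_)
        dsimp only
        rw [hω.sum_increments d t c, Complex.exp_add, hw]
    _ = _ := by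
        rw [integral_const_mul, h1, ← Complex.exp_add, ← Finset.sum_add_distrib, Complex.exp_sum]
        refine Finset.prod_congr rfl fun k _ => ?_
        congr 1; ring

theorem exists_subordinator (d : ℝ≥0) (hν : ∀ᵐ x ∂ν, 0 < x)
    (hmin : Integrable (fun x : ℝ => min x 1) ν) :
    ∃ (Ω₁ : Type) (_ : MeasurableSpace Ω₁) (P₁ : Measure Ω₁) (Z : ℝ≥0 → Ω₁ → ℝ≥0),
      IsProbabilityMeasure P₁ ∧ IsSubordinator Z P₁ ∧
      HasLaplaceExponent Z P₁ fun q => d * q - jumpExponent ν (-q) := by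
  obtain ⟨P, hPRM⟩ := exists_poissonRandomMeasure ((volume.restrict (Ioi (0 : ℝ))).prod ν)
  have hP := hPRM.isProbabilityMeasure
  have hm : ∀ t, Measurable fun ω => (jumpProcess d t ω : ℝ) := fun t =>
    (measurable_jumpProcess d t).coe_nnreal_real
  have hgood := hPRM.ae_summableJumps hν hmin
  have hzero := hPRM.ae_jumpProcess_zero d
  have hone : ∀ (s t : ℝ≥0) (c : ℂ), c.re ≤ 0 →
      ∫ ω, Complex.exp (c * (((jumpProcess d (s + t) ω : ℝ) - jumpProcess d s ω : ℝ) : ℂ)) ∂P =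
        Complex.exp ((t : ℝ) * (d * c + jumpExponent ν c)) := by
    intro s t c hc
    have hmono : Monotone ![s, s + t] := by
      intro i j hij
      fin_cases i <;> fin_cases j <;> simp_all
    have := hPRM.integral_cexp_increments d hν hmin hmono (c := fun _ => c) fun _ => hc
    simpa using this
  have hone0 : ∀ (t : ℝ≥0) (c : ℂ), c.re ≤ 0 →
      ∫ ω, Complex.exp (c * ((jumpProcess d t ω : ℝ) : ℂ)) ∂P =
        Complex.exp ((t : ℝ) * (d * c + jumpExponent ν c)) := by
    intro t c hc
    rw [← hone 0 t c hc]
    refine integral_congr_ae (hzero.mono fun ω hω => ?_)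
    dsimp only
    rw [hω, zero_add, NNReal.coe_zero, sub_zero]
  refine ⟨_, inferInstance, P, jumpProcess d, hP, ⟨hm, ?_, ?_, ?_, ?_⟩, ?_⟩
  · filter_upwards [hzero] with ω hω
    rw [hω, NNReal.coe_zero]
  · exact hasIndepIncrements_of_integral_cexp hm
      (φ := fun ξ => d * (Complex.I * ξ) + jumpExponent ν (Complex.I * ξ)) fun n t ht ξ =>
      hPRM.integral_cexp_increments d hν hmin ht (c := fun k => Complex.I * ξ k) fun k => by simp
  · intro s t
    have hms : Measurable fun ω => (jumpProcess d (s + t) ω : ℝ) - jumpProcess d s ω :=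
      (hm (s + t)).sub (hm s)
    refine ⟨hms.aemeasurable, (hm t).aemeasurable, ?_⟩
    have p1 := Measure.isProbabilityMeasure_map (μ := P) hms.aemeasurable
    have p2 := Measure.isProbabilityMeasure_map (μ := P) (hm t).aemeasurable
    refine Measure.ext_of_charFun (funext fun ξ => ?_)
    rw [charFun_map_eq_integral (hm t), charFun_map_eq_integral hms, hone0 t _ (by simp)]
    exact hone s t _ (by simp)
  · filter_upwards [hgood] with ω hω t using hω.cadlag d t
  · intro t q hq
    rw [← integral_complex_ofReal]
    have := hone0 t (-q) (by simpa using hq)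
    rw [show -((t : ℝ) * (d * (q : ℂ) - jumpExponent ν (-q))) =
      (t : ℝ) * (d * -(q : ℂ) + jumpExponent ν (-q)) by ring, ← this]
    congr 1; ext ω
    push_cast; ring_nf

end

/-- Ψ is in Bernstein form with drift v/2 and a Lévy measure integrating min(x, 1), so the general
construction applies; v ≥ 0 makes the drift admissible. -/
theorem SquareRepresentation.exists_subordinator {ψ : ℂ → ℂ} {μm μp v β : ℝ} {G₁ G₂ : Measure ℝ}
    (hμ : μm < μp) (hβ : β = -(μm + μp) / 2) (hv : 0 ≤ v)
    (hS : SquareRepresentation ψ μm μp v β G₁ G₂)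
    (hLap : ∀ x : ℝ, 0 < x → 0 ≤ laplaceDiff G₁ G₂ x) :
    ∃ (Ω₁ : Type) (_ : MeasurableSpace Ω₁) (P₁ : Measure Ω₁) (Z : ℝ≥0 → Ω₁ → ℝ≥0),
      IsProbabilityMeasure P₁ ∧ IsSubordinator Z P₁ ∧
      HasLaplaceExponent Z P₁ (subLaplaceExponent ψ β) := by
  have : SFinite (sslLevyMeasure 0 0 G₁ G₂) := by rw [sslLevyMeasure_zero]; infer_instance
  obtain ⟨Ω₁, _, P₁, Z, hP, hZ, hL⟩ := StieltjesLevy.exists_subordinator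
    (ν := sslLevyMeasure 0 0 G₁ G₂) (v / 2).toNNReal
    (SquareRepresentation.ae_pos_sslLevyMeasure G₁ G₂) (hS.integrable_min hμ hLap)
  refine ⟨Ω₁, _, P₁, Z, hP, hZ, fun t q hq => ?_⟩
  have h3 := hL t q hq
  dsimp only at h3
  rw [h3, hS.subLaplaceExponent_eq hμ hβ hq]
  have h1 := (hS.integral_one_sub_exp hμ hLap (z := q) (by simpa using hq)).2
  have h2 : jumpExponent (sslLevyMeasure 0 0 G₁ G₂) (-q) =
      -(laplaceExponent v G₁ G₂ q - v / 2 * q) := by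
    rw [← h1, jumpExponent, ← integral_neg]
    congr 1; ext x; ring_nf
  rw [h2, Real.coe_toNNReal _ (by positivity)]
  congr 3
  push_cast; ring

/-! ### Laws of processes and their increments -/

/-- The points of I are listed in order with ⊥ in front; since x vanishes at ⊥, values are partial
sums of increments. -/
theorem exists_restrict_eq_increments {T : Type*} [LinearOrder T] [OrderBot T] (I : Finset T) :
    ∃ t : Fin (I.card + 1) → T, Monotone t ∧ t 0 = ⊥ ∧
      ∃ g : (Fin I.card → ℝ) → I → ℝ, Measurable g ∧
        ∀ x : T → ℝ, x ⊥ = 0 → I.restrict x = g fun k => x (t k.succ) - x (t k.castSucc) := by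
  refine ⟨Fin.cons ⊥ (I.orderEmbOfFin rfl), ?_, rfl,
    fun y i => ∑ j ∈ Finset.Iic ((I.orderIsoOfFin rfl).symm i), y j, by fun_prop, fun x hx => ?_⟩
  · intro i j
    refine Fin.cases (fun _ => by simp) (fun i => Fin.cases (fun h => ?_) (fun j h => ?_) j) i
    · exact absurd h (by simp [Fin.succ_ne_zero])
    · simpa using h
  · ext i
    dsimp only
    rw [Fin.sum_Iic_sub _ fun j => x ((Fin.cons ⊥ (I.orderEmbOfFin rfl) : Fin (I.card + 1) → T) j)]
    simp [hx, Finset.orderEmbOfFin]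

theorem charFun_map_toLp {Ω : Type*} [MeasurableSpace Ω] {P : Measure Ω} {n : ℕ}
    {U : Fin n → Ω → ℝ} (hU : AEMeasurable (fun ω k => U k ω) P) (ξ : EuclideanSpace ℝ (Fin n)) :
    charFun ((P.map fun ω k => U k ω).map (MeasurableEquiv.toLp 2 (Fin n → ℝ))) ξ =
      ∫ ω, Complex.exp (∑ k, Complex.I * ξ k * (U k ω : ℂ)) ∂P := by
  rw [charFun_apply, integral_map (by fun_prop) (Measurable.aestronglyMeasurable (by fun_prop)),
    integral_map hU (Measurable.aestronglyMeasurable (by fun_prop))]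
  congr 1; ext ω
  congr 1
  rw [PiLp.inner_apply]
  push_cast
  rw [Finset.sum_mul]
  refine Finset.sum_congr rfl fun k _ => ?_
  simp
  ring

theorem map_eq_of_integral_cexp {Ω Ω' : Type*} [MeasurableSpace Ω] [MeasurableSpace Ω']
    {P : Measure Ω} {P' : Measure Ω'} [IsProbabilityMeasure P] [IsProbabilityMeasure P'] {n : ℕ}
    {U : Fin n → Ω → ℝ} {V : Fin n → Ω' → ℝ} (hU : ∀ k, AEMeasurable (U k) P)
    (hV : ∀ k, AEMeasurable (V k) P')
    (h : ∀ ξ : Fin n → ℝ, ∫ ω, Complex.exp (∑ k, Complex.I * ξ k * (U k ω : ℂ)) ∂P =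
      ∫ ω, Complex.exp (∑ k, Complex.I * ξ k * (V k ω : ℂ)) ∂P') :
    P.map (fun ω k => U k ω) = P'.map (fun ω k => V k ω) := by
  have hU' : AEMeasurable (fun ω k => U k ω) P := aemeasurable_pi_lambda _ hU
  have hV' : AEMeasurable (fun ω k => V k ω) P' := aemeasurable_pi_lambda _ hV
  have p1 := Measure.isProbabilityMeasure_map hU'
  have p2 := Measure.isProbabilityMeasure_map hV'
  apply (MeasurableEquiv.toLp 2 (Fin n → ℝ)).map_measurableEquiv_injective
  have q1 := Measure.isProbabilityMeasure_map (μ := P.map fun ω k => U k ω)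
    (MeasurableEquiv.toLp 2 (Fin n → ℝ)).measurable.aemeasurable
  have q2 := Measure.isProbabilityMeasure_map (μ := P'.map fun ω k => V k ω)
    (MeasurableEquiv.toLp 2 (Fin n → ℝ)).measurable.aemeasurable
  refine Measure.ext_of_charFun (funext fun ξ => ?_)
  rw [charFun_map_toLp hU', charFun_map_toLp hV', h]

/-- Increments determine the finite-dimensional laws, and a law on the product space is the unique
projective limit of these. -/
theorem identDistrib_of_integral_cexp_increments {Ω Ω' T : Type*} [MeasurableSpace Ω]
    [MeasurableSpace Ω'] {P : Measure Ω} {P' : Measure Ω'} [IsProbabilityMeasure P]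
    [IsProbabilityMeasure P'] [LinearOrder T] [OrderBot T] {X : T → Ω → ℝ} {Y : T → Ω' → ℝ}
    (hX : AEMeasurable (fun ω t => X t ω) P) (hY : AEMeasurable (fun ω t => Y t ω) P')
    (hX0 : ∀ᵐ ω ∂P, X ⊥ ω = 0) (hY0 : ∀ᵐ ω ∂P', Y ⊥ ω = 0)
    (h : ∀ (n : ℕ) (t : Fin (n + 1) → T), Monotone t → t 0 = ⊥ → ∀ ξ : Fin n → ℝ,
      ∫ ω, Complex.exp (∑ k, Complex.I * ξ k * ((X (t k.succ) ω - X (t k.castSucc) ω : ℝ) : ℂ)) ∂P =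
      ∫ ω, Complex.exp (∑ k, Complex.I * ξ k *
        ((Y (t k.succ) ω - Y (t k.castSucc) ω : ℝ) : ℂ)) ∂P') :
    IdentDistrib (fun ω t => X t ω) (fun ω t => Y t ω) P P' := by
  refine ⟨hX, hY, ?_⟩
  have hXt : ∀ t, AEMeasurable (X t) P := fun t => (measurable_pi_apply t).comp_aemeasurable hX
  have hYt : ∀ t, AEMeasurable (Y t) P' := fun t => (measurable_pi_apply t).comp_aemeasurable hY
  have p1 := Measure.isProbabilityMeasure_map hX
  have p2 := Measure.isProbabilityMeasure_map hY
  refine (isProjectiveLimit_map hX).unique ?_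
  have : (fun I : Finset T => P.map fun ω => I.restrict (X · ω)) =
      fun I : Finset T => P'.map fun ω => I.restrict (Y · ω) := by
    ext1 I
    obtain ⟨t, ht, ht0, g, hg, hgx⟩ := exists_restrict_eq_increments I
    have e := map_eq_of_integral_cexp (U := fun k ω => X (t k.succ) ω - X (t k.castSucc) ω)
      (V := fun k ω => Y (t k.succ) ω - Y (t k.castSucc) ω)
      (fun k => (hXt _).sub (hXt _)) (fun k => (hYt _).sub (hYt _)) (h _ t ht ht0)
    have e1 : P.map (fun ω => I.restrict (X · ω)) =
        (P.map fun ω k => X (t k.succ) ω - X (t k.castSucc) ω).map g := by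
      have hm : AEMeasurable (fun ω (k : Fin I.card) => X (t k.succ) ω - X (t k.castSucc) ω) P :=
        aemeasurable_pi_lambda _ fun k => (hXt _).sub (hXt _)
      rw [AEMeasurable.map_map_of_aemeasurable hg.aemeasurable hm]
      exact Measure.map_congr (hX0.mono fun ω hω => hgx (X · ω) hω)
    have e2 : P'.map (fun ω => I.restrict (Y · ω)) =
        (P'.map fun ω k => Y (t k.succ) ω - Y (t k.castSucc) ω).map g := by
      have hm : AEMeasurable (fun ω (k : Fin I.card) => Y (t k.succ) ω - Y (t k.castSucc) ω) P' :=
        aemeasurable_pi_lambda _ fun k => (hYt _).sub (hYt _)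
      rw [AEMeasurable.map_map_of_aemeasurable hg.aemeasurable hm]
      exact Measure.map_congr (hY0.mono fun ω hω => hgx (Y · ω) hω)
    rw [e1, e2, e]
  rw [this]
  exact isProjectiveLimit_map hY

/-! ### Increments of a Lévy process -/

section

variable {Ω : Type*} [MeasurableSpace Ω] {P : Measure Ω} {X : ℝ≥0 → Ω → ℝ}

theorem IsLevyProcess.identDistrib_sub (hX : IsLevyProcess X P) {s t : ℝ≥0} (hst : s ≤ t) :
    IdentDistrib (fun ω => X t ω - X s ω) (X (t - s)) P P := by
  have := hX.stationary s (t - s)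
  rwa [add_tsub_cancel_of_le hst] at this

theorem IsLevyProcess.integral_cexp_sum_increments (hX : IsLevyProcess X P) {n : ℕ}
    {t : Fin (n + 1) → ℝ≥0} (ht : Monotone t) (c : Fin n → ℂ) :
    ∫ ω, Complex.exp (∑ k, c k * ((X (t k.succ) ω - X (t k.castSucc) ω : ℝ) : ℂ)) ∂P =
      ∏ k, ∫ ω, Complex.exp (c k * (X (t k.succ - t k.castSucc) ω : ℂ)) ∂P := by
  simp_rw [Complex.exp_sum]
  rw [(hX.indep_increments n t ht).integral_fun_prod_comp
    (f := fun k (x : ℝ) => Complex.exp (c k * (x : ℂ)))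
    (fun k => ((hX.measurable _).sub (hX.measurable _)).aemeasurable)
    fun k => Measurable.aestronglyMeasurable (by fun_prop)]
  refine Finset.prod_congr rfl fun k _ => ?_
  exact ((hX.identDistrib_sub (ht (Fin.castSucc_lt_succ).le)).comp
    (u := fun x : ℝ => Complex.exp (c k * (x : ℂ))) (by fun_prop)).integral_eq

/-- On the grid completed by T, X_T is the sum of all increments, so the density e^{βX_T} factorises
along with the Fourier weights. -/
theorem IsLevyProcess.integral_cexp_increments_esscherTransform [IsProbabilityMeasure P]
    (hX : IsLevyProcess X P) {β : ℝ} {φ : ℝ → ℂ}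
    (hint : ∀ t, Integrable (fun ω => Real.exp (β * X t ω)) P)
    (h : ∀ (t : ℝ≥0) (ξ : ℝ), ∫ ω, Complex.exp ((β + Complex.I * ξ) * X t ω) ∂P =
      ((∫ ω, Real.exp (β * X t ω) ∂P : ℝ) : ℂ) * Complex.exp (-((t : ℝ) * φ ξ)))
    {T : ℝ≥0} {n : ℕ} {t : Fin (n + 1) → ℝ≥0} (ht : Monotone t) (ht0 : t 0 = 0)
    (htT : t (Fin.last n) ≤ T) (ξ : Fin n → ℝ) :
    ∫ ω, Complex.exp (∑ k, Complex.I * ξ k * ((X (t k.succ) ω - X (t k.castSucc) ω : ℝ) : ℂ))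
      ∂(esscherTransform X P β T) =
      ∏ k, Complex.exp (-(((t k.succ - t k.castSucc : ℝ≥0) : ℝ) * φ (ξ k))) := by
  obtain ⟨m, hm⟩ : ∃ m : ℝ≥0 → ℂ, ∀ t, m t = ((∫ ω, Real.exp (β * X t ω) ∂P : ℝ) : ℂ) :=
    ⟨_, fun _ => rfl⟩
  have hm0 : ∀ t, m t ≠ 0 := fun t => by
    rw [hm]
    exact Complex.ofReal_ne_zero.2 (integral_exp_pos (hint t)).ne'
  -- Taking ξ = 0 in the hypothesis normalises φ; the additional interval up to T, which gets
  -- frequency 0, then contributes nothing.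
  have hφ0 : ∀ t : ℝ≥0, Complex.exp (-((t : ℝ) * φ 0)) = 1 := fun t => by
    have h1 := h t 0
    have h2 : ∫ ω, Complex.exp ((β + Complex.I * (0 : ℝ)) * X t ω) ∂P = m t := by
      rw [hm, ← integral_complex_ofReal]
      congr 1; ext ω
      push_cast; ring_nf
    rw [h2, ← hm] at h1
    exact (mul_left_cancel₀ (hm0 t) (by rw [← h1, mul_one])).symm
  obtain ⟨s, hs⟩ : ∃ s : Fin (n + 1 + 1) → ℝ≥0, s = Fin.snoc t T := ⟨_, rfl⟩
  have hsc : ∀ k : Fin (n + 1), s k.castSucc = t k := fun k => by rw [hs, Fin.snoc_castSucc]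
  have hsl : s (Fin.last (n + 1)) = T := by rw [hs, Fin.snoc_last]
  have hsm : Monotone s := by
    refine Fin.monotone_iff_le_succ.2 fun k => ?_
    refine Fin.lastCases ?_ (fun k => ?_) k
    · rw [Fin.succ_last, hsc, hsl]; exact htT
    · rw [Fin.succ_castSucc, hsc, hsc]
      exact ht (Fin.castSucc_lt_succ).le
  have hs0 : s 0 = 0 := by rw [← Fin.castSucc_zero, hsc, ht0]
  have key : ∀ ζ : Fin (n + 1) → ℝ,
      ∫ ω, Complex.exp (∑ k, (β + Complex.I * ζ k) *
        ((X (s k.succ) ω - X (s k.castSucc) ω : ℝ) : ℂ)) ∂P =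
      (∏ k : Fin (n + 1), m (s k.succ - s k.castSucc)) *
        ∏ k, Complex.exp (-(((s k.succ - s k.castSucc : ℝ≥0) : ℝ) * φ (ζ k))) := fun ζ => by
    rw [hX.integral_cexp_sum_increments hsm, ← Finset.prod_mul_distrib]
    refine Finset.prod_congr rfl fun k _ => ?_
    rw [h, hm]
  have htele : ∀ᵐ ω ∂P, (X T ω : ℂ) = ∑ k : Fin (n + 1),
      ((X (s k.succ) ω - X (s k.castSucc) ω : ℝ) : ℂ) := by
    filter_upwards [hX.start_zero] with ω hω
    have h1 := Fin.sum_Iic_sub (Fin.last n) fun k => X (s k) ω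
    rw [show Finset.Iic (Fin.last n) = Finset.univ from Finset.Iic_top] at h1
    rw [← Complex.ofReal_sum, h1, Fin.succ_last, hsl, hs0, hω, sub_zero]
  -- With all frequencies zero the factorisation shows that the normalising constants are
  -- multiplicative.
  have hmT : m T = ∏ k : Fin (n + 1), m (s k.succ - s k.castSucc) := by
    have h1 := key 0
    simp only [Pi.zero_apply, hφ0, Finset.prod_const_one, mul_one] at h1
    rw [← h1, hm, ← integral_complex_ofReal]
    refine integral_congr_ae (htele.mono fun ω hω => ?_)
    simp only [Complex.ofReal_zero, mul_zero, add_zero]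
    rw [← Finset.mul_sum, ← hω]
    push_cast; rfl
  have h1 := key (Fin.snoc ξ 0)
  rw [← hmT, Fin.prod_univ_castSucc] at h1
  simp only [Fin.snoc_castSucc, Fin.snoc_last, hφ0, mul_one, Fin.succ_castSucc, hsc] at h1
  rw [esscherTransform, integral_tilted]
  refine mul_left_cancel₀ (hm0 T) ?_
  rw [← h1, ← integral_const_mul]
  refine integral_congr_ae (htele.mono fun ω hω => ?_)
  have e : ∑ k : Fin (n + 1), ((β : ℂ) + Complex.I * ((Fin.snoc ξ 0 : Fin (n + 1) → ℝ) k : ℝ)) *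
      ((X (s k.succ) ω - X (s k.castSucc) ω : ℝ) : ℂ) =
      β * X T ω + ∑ k, Complex.I * ξ k * ((X (t k.succ) ω - X (t k.castSucc) ω : ℝ) : ℂ) := by
    simp_rw [add_mul]
    rw [Finset.sum_add_distrib, ← Finset.mul_sum, ← hω, Fin.sum_univ_castSucc (n := n)]
    simp only [Fin.snoc_castSucc, Fin.snoc_last, Fin.succ_castSucc, hsc]
    simp
  dsimp only
  simp only [hsc] at e
  rw [e, Complex.exp_add, Complex.real_smul, Complex.ofReal_div, ← mul_assoc]
  have e2 : m T * ((Real.exp (β * X T ω) : ℂ) / ((∫ ω, Real.exp (β * X T ω) ∂P : ℝ) : ℂ)) =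
      Complex.exp (β * X T ω) := by
    rw [← hm, mul_div_cancel₀ _ (hm0 T)]
    push_cast; rfl
  rw [e2]

end

/-! ### Subordination of Brownian motion -/

section

variable {Ω : Type*} [MeasurableSpace Ω] {P : Measure Ω}

/-- Measurable versions at countably many dense times, a null set on which the path is set to 0, and
continuity in between give everywhere measurable and continuous paths. Evaluation at a random time
needs this. -/
theorem exists_continuous_version [IsFiniteMeasure P] {W : ℝ≥0 → Ω → ℝ}
    (hW : ∀ t, AEMeasurable (W t) P) (hc : ∀ᵐ ω ∂P, Continuous fun t => W t ω) :
    ∃ W' : ℝ≥0 → Ω → ℝ, (∀ t, Measurable (W' t)) ∧ (∀ ω, Continuous fun t => W' t ω) ∧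
      ∀ᵐ ω ∂P, ∀ t, W t ω = W' t ω := by
  classical
  obtain ⟨q, hq⟩ := TopologicalSpace.exists_dense_seq ℝ≥0
  have hgood : ∀ᵐ ω ∂P, (Continuous fun t => W t ω) ∧ ∀ n, W (q n) ω = (hW (q n)).mk _ ω :=
    hc.and (ae_all_iff.2 fun n => (hW (q n)).ae_eq_mk)
  obtain ⟨N, hN⟩ : ∃ N, N = toMeasurable P {ω | ¬((Continuous fun t => W t ω) ∧
      ∀ n, W (q n) ω = (hW (q n)).mk _ ω)} := ⟨_, rfl⟩
  have hNm : MeasurableSet N := hN ▸ measurableSet_toMeasurable _ _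
  have hN0 : P N = 0 := by rw [hN, measure_toMeasurable]; exact hgood
  have hNg : ∀ ω ∉ N, (Continuous fun t => W t ω) ∧ ∀ n, W (q n) ω = (hW (q n)).mk _ ω := by
    intro ω hω
    by_contra h
    exact hω (hN ▸ subset_toMeasurable P _ h)
  refine ⟨fun t => Nᶜ.indicator (W t), fun t => ?_, fun ω => ?_, ?_⟩
  · have hqm : ∀ n, Measurable (Nᶜ.indicator (W (q n))) := fun n => by
      have : Nᶜ.indicator (W (q n)) = Nᶜ.indicator ((hW (q n)).mk _) :=
        indicator_congr fun ω hω => (hNg ω hω).2 n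
      rw [this]
      exact (hW (q n)).measurable_mk.indicator hNm.compl
    obtain ⟨u, hu, hut⟩ := mem_closure_iff_seq_limit.1 (hq t)
    choose k hk using hu
    refine measurable_of_tendsto_metrizable (fun n => hqm (k n)) (tendsto_pi_nhds.2 fun ω => ?_)
    by_cases hω : ω ∈ N
    · simp [indicator, hω]
    · simp only [indicator_of_mem (show ω ∈ Nᶜ from hω), hk]
      exact ((hNg ω hω).1.tendsto t).comp hut
  · by_cases hω : ω ∈ N
    · simpa [indicator, hω] using continuous_const
    · simpa [indicator, hω] using (hNg ω hω).1
  · filter_upwards [measure_eq_zero_iff_ae_notMem.1 hN0] with ω hω t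
    exact (indicator_of_mem (show ω ∈ Nᶜ from hω) _).symm

theorem integral_eq_integral_integral_of_indepFun [IsProbabilityMeasure P] {α γ : Type*}
    [MeasurableSpace α] [MeasurableSpace γ] {U : Ω → α} {V : Ω → γ} (hU : Measurable U)
    (hV : Measurable V) (hUV : IndepFun U V P) {F : α × γ → ℂ} (hF : Measurable F)
    (hb : ∀ x, ‖F x‖ ≤ 1) :
    ∫ ω, F (U ω, V ω) ∂P = ∫ ω', ∫ ω, F (U ω, V ω') ∂P ∂P := by
  have p1 := Measure.isProbabilityMeasure_map (μ := P) hU.aemeasurable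
  have p2 := Measure.isProbabilityMeasure_map (μ := P) hV.aemeasurable
  have h1 := (indepFun_iff_map_prod_eq_prod_map_map hU.aemeasurable hV.aemeasurable).1 hUV
  rw [← integral_map (φ := fun ω => (U ω, V ω)) (hU.prodMk hV).aemeasurable
    hF.aestronglyMeasurable, h1, integral_prod_symm]
  · rw [integral_map hV.aemeasurable
      (hF.stronglyMeasurable.integral_prod_left').aestronglyMeasurable]
    congr 1; ext ω'
    exact integral_map (f := fun x => F (x, V ω')) hU.aemeasurable
      (hF.comp measurable_prodMk_right).aestronglyMeasurable
  · exact (integrable_const (1 : ℝ)).mono' hF.aestronglyMeasurable (Eventually.of_forall hb)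

theorem integral_cexp_increments_brownian {W : ℝ≥0 → Ω → ℝ} (hW : IsPreBrownianReal W P) {n : ℕ}
    {z : Fin (n + 1) → ℝ≥0} (hz : Monotone z) (ξ : Fin n → ℝ) :
    ∫ ω, Complex.exp (∑ k, Complex.I * ξ k *
      ((√2 * W (z k.succ) ω - √2 * W (z k.castSucc) ω : ℝ) : ℂ)) ∂P =
      Complex.exp (∑ k, -((ξ k ^ 2 : ℝ) : ℂ) * (((z k.succ : ℝ) - z k.castSucc : ℝ) : ℂ)) := by
  have hle : ∀ k : Fin n, z k.castSucc ≤ z k.succ := fun k => hz (Fin.castSucc_lt_succ).le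
  rw [Complex.exp_sum]
  simp_rw [Complex.exp_sum]
  have h1 := (hW.hasIndepIncrements n z hz).integral_fun_prod_comp
    (f := fun k (x : ℝ) => Complex.exp (Complex.I * ξ k * ((√2 * x : ℝ) : ℂ)))
    (fun k => (hW.aemeasurable _).sub (hW.aemeasurable _))
    fun k => Measurable.aestronglyMeasurable (by fun_prop)
  simp only [mul_sub] at h1
  rw [h1]
  refine Finset.prod_congr rfl fun k _ => ?_
  have h2 := hW.hasLaw_sub (z k.succ) (z k.castSucc)
  have h3 : charFun (P.map (W (z k.succ) - W (z k.castSucc))) (√2 * ξ k) =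
      ∫ ω, Complex.exp (Complex.I * ξ k *
        ((√2 * W (z k.succ) ω - √2 * W (z k.castSucc) ω : ℝ) : ℂ)) ∂P := by
    rw [charFun_apply_real, integral_map h2.aemeasurable
      (Measurable.aestronglyMeasurable (by fun_prop))]
    congr 1; ext ω
    congr 1
    simp only [Pi.sub_apply]
    push_cast; ring
  rw [← h3, h2.map_eq, charFun_gaussianReal]
  congr 1
  have h4 : ((nndist (z k.succ).1 (z k.castSucc).1 : ℝ≥0) : ℝ) = z k.succ - z k.castSucc := by
    rw [coe_nndist, Real.dist_eq]
    exact abs_of_nonneg (sub_nonneg.2 (NNReal.coe_le_coe.2 (hle k)))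
  have h5 : ((√2 : ℝ) : ℂ) ^ 2 = 2 := by
    rw [← Complex.ofReal_pow, Real.sq_sqrt zero_le_two]; norm_num
  rw [← h4]
  push_cast
  rw [mul_pow, h5]
  ring

/-- Each increment has the law of a value of Z, hence is almost surely non-negative; a finite grid
needs only finitely many null sets. -/
theorem IsSubordinator.ae_monotone {Z : ℝ≥0 → Ω → ℝ≥0} (hZ : IsSubordinator Z P) {n : ℕ}
    {t : Fin (n + 1) → ℝ≥0} (ht : Monotone t) : ∀ᵐ ω ∂P, Monotone fun k => Z (t k) ω := by
  have h1 : ∀ k : Fin n, ∀ᵐ ω ∂P, Z (t k.castSucc) ω ≤ Z (t k.succ) ω := fun k => by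
    have h2 := (IsLevyProcess.identDistrib_sub hZ (ht (Fin.castSucc_lt_succ (i := k)).le)).symm
    have h3 := h2.ae_mem_snd measurableSet_Ici
      (Eventually.of_forall fun ω => (NNReal.coe_nonneg _ : (0 : ℝ) ≤ _))
    filter_upwards [h3] with ω hω
    exact NNReal.coe_le_coe.1 (sub_nonneg.1 hω)
  filter_upwards [ae_all_iff.2 h1] with ω hω
  exact Fin.monotone_iff_le_succ.2 hω

theorem IsSubordinator.integral_cexp_increments [IsProbabilityMeasure P]
    {Z : ℝ≥0 → Ω → ℝ≥0} (hZ : IsSubordinator Z P) {Ψ : ℝ → ℂ} (hL : HasLaplaceExponent Z P Ψ)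
    {n : ℕ} {t : Fin (n + 1) → ℝ≥0} (ht : Monotone t) {q : Fin n → ℝ} (hq : ∀ k, 0 ≤ q k) :
    ∫ ω, Complex.exp (∑ k, -(q k : ℂ) *
        (((Z (t k.succ) ω : ℝ) - Z (t k.castSucc) ω : ℝ) : ℂ)) ∂P =
      ∏ k, Complex.exp (-(((t k.succ - t k.castSucc : ℝ≥0) : ℝ) * Ψ (q k))) := by
  rw [IsLevyProcess.integral_cexp_sum_increments hZ ht fun k => -(q k : ℂ)]
  refine Finset.prod_congr rfl fun k _ => ?_
  rw [← hL _ _ (hq k), ← integral_complex_ofReal]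
  congr 1; ext ω
  push_cast; ring_nf

end

section

variable {Ω : Type*} [MeasurableSpace Ω] {P : Measure Ω} [IsProbabilityMeasure P]
  {W : ℝ≥0 → Ω → ℝ} {Z : ℝ≥0 → Ω → ℝ≥0}

/-- Conditioning on Z freezes the times, which are almost surely increasing, and the Brownian
factors exp(-ξ²ΔZ) are then averaged by the Laplace exponent at ξ². -/
theorem integral_cexp_increments_subordinated_of_continuous (hWm : ∀ t, Measurable (W t))
    (hWc : ∀ ω, Continuous fun t => W t ω) (hW : IsPreBrownianReal W P)
    (hZ : IsSubordinator Z P) {Ψ : ℝ → ℂ} (hL : HasLaplaceExponent Z P Ψ)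
    (hWZ : IndepFun (fun ω t => W t ω) (fun ω t => Z t ω) P)
    {n : ℕ} {t : Fin (n + 1) → ℝ≥0} (ht : Monotone t) (ξ : Fin n → ℝ) :
    ∫ ω, Complex.exp (∑ k, Complex.I * ξ k * ((√2 * W (Z (t k.succ) ω) ω -
        √2 * W (Z (t k.castSucc) ω) ω : ℝ) : ℂ)) ∂P =
      ∏ k, Complex.exp (-(((t k.succ - t k.castSucc : ℝ≥0) : ℝ) * Ψ (ξ k ^ 2))) := by
  have hZm : ∀ t, Measurable (Z t) := fun t => by
    simpa using (hZ.measurable t).real_toNNReal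
  -- W is viewed in the space of continuous paths, where evaluation is jointly measurable in time
  -- and path; on the full product space it need not be.
  let U : Ω → {f : ℝ≥0 → ℝ // Continuous f} := fun ω => ⟨fun s => W s ω, hWc ω⟩
  have hU : Measurable U := (measurable_pi_lambda _ hWm).subtype_mk
  let V : Ω → Fin (n + 1) → ℝ≥0 := fun ω k => Z (t k) ω
  have hV : Measurable V := measurable_pi_lambda _ fun k => hZm _
  have hUV : IndepFun U V P := by
    have h1 : IndepFun (fun ω t => W t ω) V P :=
      hWZ.comp (φ := id) (ψ := fun (z : ℝ≥0 → ℝ≥0) k => z (t k)) measurable_id (by fun_prop)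
    rw [IndepFun_iff_Indep] at h1 ⊢
    have : MeasurableSpace.comap U inferInstance =
        MeasurableSpace.comap (fun ω t => W t ω) MeasurableSpace.pi :=
      MeasurableSpace.comap_comp
    rwa [this]
  have hev : Measurable fun p : ℝ≥0 × {f : ℝ≥0 → ℝ // Continuous f} => p.2.1 p.1 :=
    measurable_uncurry_of_continuous_of_measurable
      (u := fun s (f : {f : ℝ≥0 → ℝ // Continuous f}) => f.1 s) (fun f => f.2)
      fun s => (measurable_pi_apply s).comp measurable_subtype_coe
  have hevk : ∀ k : Fin (n + 1), Measurable
      fun p : {f : ℝ≥0 → ℝ // Continuous f} × (Fin (n + 1) → ℝ≥0) => p.1.1 (p.2 k) := fun k =>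
    hev.comp (g := fun p : ℝ≥0 × {f : ℝ≥0 → ℝ // Continuous f} => p.2.1 p.1)
      (f := fun p : {f : ℝ≥0 → ℝ // Continuous f} × (Fin (n + 1) → ℝ≥0) => (p.2 k, p.1))
      (((measurable_pi_apply k).comp measurable_snd).prodMk measurable_fst)
  have h1 := integral_eq_integral_integral_of_indepFun hU hV hUV
    (F := fun p => Complex.exp (∑ k, Complex.I * ξ k * ((√2 * p.1.1 (p.2 k.succ) -
        √2 * p.1.1 (p.2 k.castSucc) : ℝ) : ℂ)))
    (Complex.measurable_exp.comp (Finset.measurable_fun_sum _ fun k _ => measurable_const.mul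
      (Complex.measurable_ofReal.comp (((hevk _).const_mul _).sub ((hevk _).const_mul _)))))
    fun p => by
      rw [Complex.norm_exp, Complex.re_sum, Finset.sum_eq_zero, Real.exp_zero]
      intro k _
      rw [Complex.re_mul_ofReal]
      simp
  refine h1.trans ?_
  rw [← IsSubordinator.integral_cexp_increments hZ hL ht (q := fun k => ξ k ^ 2)
    fun k => sq_nonneg _]
  refine integral_congr_ae ((IsSubordinator.ae_monotone hZ ht).mono fun ω hω => ?_)
  exact integral_cexp_increments_brownian hW hω ξ

end

/-- The law of `√2 W_Z` is characterised by the exponent `ξ ↦ Ψ(ξ²)`. -/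
theorem identDistrib_subordinated {Ω Ω' : Type*} [MeasurableSpace Ω] [MeasurableSpace Ω']
    {P' : Measure Ω'} [IsProbabilityMeasure P'] {P : Measure Ω} [IsProbabilityMeasure P]
    {W : ℝ≥0 → Ω → ℝ} {Z : ℝ≥0 → Ω → ℝ≥0} (hW : IsBrownianReal W P)
    (hZ : IsSubordinator Z P) {Ψ : ℝ → ℂ} (hL : HasLaplaceExponent Z P Ψ)
    (hWZ : IndepFun (fun ω t => W t ω) (fun ω t => Z t ω) P) {T : ℝ≥0} {X : ℝ≥0 → Ω' → ℝ}
    (hX : ∀ t, Measurable (X t)) (hX0 : ∀ᵐ ω ∂P', X 0 ω = 0)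
    (h : ∀ (n : ℕ) (t : Fin (n + 1) → ℝ≥0), Monotone t → t 0 = 0 → t (Fin.last n) ≤ T →
      ∀ ξ : Fin n → ℝ,
      ∫ ω, Complex.exp (∑ k, Complex.I * ξ k * ((X (t k.succ) ω - X (t k.castSucc) ω : ℝ) : ℂ)) ∂P' =
      ∏ k, Complex.exp (-(((t k.succ - t k.castSucc : ℝ≥0) : ℝ) * Ψ (ξ k ^ 2)))) :
    IdentDistrib (fun ω (t : Iic T) => X t ω) (fun ω (t : Iic T) => √2 * W (Z t ω) ω) P' P := by
  obtain ⟨W', hWm, hWc, hWW⟩ := exists_continuous_version hW.aemeasurable hW.cont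
  have hW' : IsPreBrownianReal W' P :=
    hW.toIsPreBrownianReal.congr fun t => hWW.mono fun ω hω => hω t
  have hWZ' : IndepFun (fun ω t => W' t ω) (fun ω t => Z t ω) P :=
    hWZ.congr (hWW.mono fun ω hω => funext hω) EventuallyEq.rfl
  have hZm : ∀ t, Measurable (Z t) := fun t => by
    simpa using (hZ.measurable t).real_toNNReal
  have hY : (fun ω (t : Iic T) => √2 * W' (Z t ω) ω) =ᵐ[P]
      fun ω (t : Iic T) => √2 * W (Z t ω) ω := by
    filter_upwards [hWW] with ω hω
    funext t
    rw [hω]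
  have hYm : Measurable fun ω (t : Iic T) => √2 * W' (Z t ω) ω :=
    measurable_pi_lambda _ fun t => ((measurable_uncurry_of_continuous_of_measurable
      (u := W') hWc hWm).comp ((hZm t).prodMk measurable_id)).const_mul _
  have hI : IdentDistrib (fun ω (t : Iic T) => X t ω) (fun ω (t : Iic T) => √2 * W' (Z t ω) ω)
      P' P := by
    refine identDistrib_of_integral_cexp_increments (X := fun (t : Iic T) ω => X t ω)
      (Y := fun (t : Iic T) ω => √2 * W' (Z t ω) ω)
      (measurable_pi_lambda (fun ω (t : Iic T) => X t ω) fun t => hX t).aemeasurable hYm.aemeasurable hX0 ?_ ?_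
    · filter_upwards [hZ.start_zero, hW'.eval_zero_ae_eq_zero] with ω h1 h2
      have h3 : Z 0 ω = 0 := NNReal.coe_eq_zero.1 h1
      change √2 * W' (Z 0 ω) ω = 0
      rw [h3, h2, mul_zero]
    · intro n t ht ht0 ξ
      have ht' : Monotone fun k => (t k : ℝ≥0) := fun i j hij => ht hij
      rw [h n (fun k => (t k : ℝ≥0)) ht' (by rw [ht0]; rfl) (t (Fin.last n)).2 ξ]
      exact (integral_cexp_increments_subordinated_of_continuous hWm hWc hW' hZ hL hWZ' ht' ξ).symm
  exact hI.trans (IdentDistrib.of_ae_eq hYm.aemeasurable hY)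

end StieltjesLevy

end

/-! ### The subordination theorem -/

theorem mainTheorem6 {Ω : Type*} [MeasurableSpace Ω] (P : Measure Ω) [IsProbabilityMeasure P]
    (X : ℝ≥0 → Ω → ℝ) (ψ : ℂ → ℂ) (μm μp v b β : ℝ) (F : Measure ℝ)
    (hμm : μm ≤ 0) (hμp : 0 ≤ μp) (hμ : μm < μp)
    -- `X` is an sSL-process with characteristic exponent `ψ`
    (hX : StieltjesLevy.HasLevyTriplet X P v b F)
    (hF : StieltjesLevy.IsSSLLevyMeasure μm μp F)
    (hψ : StieltjesLevy.HasCharExponent X P ψ)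
    -- the exponent of the jump component is determined by the triplet up to a linear term
    -- that depends on the truncation convention; any linear term is allowed
    (hver : ∃ c : ℝ, StieltjesLevy.VerificationConditions ψ
      (fun ξ => ψ ξ - v / 2 * ξ ^ 2 + Complex.I * c * ξ) μm μp)
    (hβ : β = -(μm + μp) / 2)
    (hsym : ∀ ξ : ℂ, ξ - Complex.I * β ∈ StieltjesLevy.slitDomain μm μp →
      ψ (ξ - Complex.I * β) = ψ (-ξ - Complex.I * β))
    (hLap : ∀ x : ℝ, 0 < x → 0 ≤ StieltjesLevy.laplaceDiff
      (StieltjesLevy.subMeasurePos ψ β) (StieltjesLevy.subMeasureNeg ψ β) x) :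
    -- `G` is an sSL-measure
    StieltjesLevy.IsSSLMeasure ((μp - μm) ^ 2 / 4)
      (StieltjesLevy.subMeasurePos ψ β) (StieltjesLevy.subMeasureNeg ψ β) ∧
    -- there is a subordinator with Laplace exponent `Ψ_Z`
    (∃ (Ω₁ : Type) (_ : MeasurableSpace Ω₁) (P₁ : Measure Ω₁) (Z : ℝ≥0 → Ω₁ → ℝ≥0),
      IsProbabilityMeasure P₁ ∧ StieltjesLevy.IsSubordinator Z P₁ ∧
      StieltjesLevy.HasLaplaceExponent Z P₁ (StieltjesLevy.subLaplaceExponent ψ β)) ∧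
    -- every such subordinator is of class `sSL⁺_μ` with sSL-measure `G`, and `X` under the
    -- Esscher transform has the law of `√2 W` subordinated by it
    (∀ (Ω₁ : Type*) [MeasurableSpace Ω₁] (P₁ : Measure Ω₁) [IsProbabilityMeasure P₁]
      (Z : ℝ≥0 → Ω₁ → ℝ≥0), StieltjesLevy.IsSubordinator Z P₁ →
      StieltjesLevy.HasLaplaceExponent Z P₁ (StieltjesLevy.subLaplaceExponent ψ β) →
      StieltjesLevy.IsSSLPlusProcess (fun t ω => (Z t ω : ℝ)) P₁ ((μp - μm) ^ 2 / 4)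
        (StieltjesLevy.subMeasurePos ψ β) (StieltjesLevy.subMeasureNeg ψ β) ∧
      ∀ W : ℝ≥0 → Ω₁ → ℝ, IsBrownianReal W P₁ →
        IndepFun (fun ω t => W t ω) (fun ω t => Z t ω) P₁ →
        ∀ T : ℝ≥0, IdentDistrib
          (fun ω (t : Set.Iic T) => X t ω)
          (fun ω (t : Set.Iic T) => √2 * W (Z t ω) ω)
          (StieltjesLevy.esscherTransform X P β T) P₁) := by
  obtain ⟨c, hver⟩ := hver
  have hS := StieltjesLevy.squareRepresentation hμm hμp hμ hX hF hψ hver hβ hsym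
  refine ⟨hS.isSSLMeasure hLap, hS.exists_subordinator hμ hβ hX.nonneg hLap, ?_⟩
  intro Ω₁ _ P₁ _ Z hZ hL
  refine ⟨hS.isSSLPlusProcess hμ hβ hLap hZ hL, fun W hW hWZ T => ?_⟩
  have hE := hS.integral_cexp_esscher hμm hμp hμ hX hF hψ hver.analytic hβ hZ hL
  have hQ : IsProbabilityMeasure (StieltjesLevy.esscherTransform X P β T) :=
    isProbabilityMeasure_tilted (hE T).1
  refine StieltjesLevy.identDistrib_subordinated hW hZ hL hWZ hX.isLevy.measurable
    (tilted_absolutelyContinuous P _ hX.isLevy.start_zero) fun n t ht ht0 htT ξ => ?_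
  rw [hX.isLevy.integral_cexp_increments_esscherTransform (fun t => (hE t).1)
    (fun t => (hE t).2) ht ht0 htT]
  refine Finset.prod_congr rfl fun k _ => ?_
  rw [hS.subLaplaceExponent_eq hμ hβ (sq_nonneg _)]
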